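/- A weighted arena $G=(S=S_1\uplus S_2,s_0,T,\mu_1,\mu_2,C_1,C_2)$ consists of finite disjoint sets $S_1,S_2$ of positions of Players 1 and 2, an initial position $s_0\in S_1$, edges $T\subseteq S\times S$, weights $\mu_i:T\to\mathbb N$ and target sets $C_i\subseteq S$. It is positive if all weights are strictly positive. Let $M^G$ be the largest weight $\mu_i(e)$, $e\in T$, $i\in\{1,2\}$ ($0$ if $T=\emptyset$). A strategy of Player $i$ maps each finite play $\pi$ (a path from $s_0$) that ends in $S_i$ to a successor of its last position, or to $\bot$ if there is none; $\Lambda_i(G)$ is the set of these strategies. The utility $u_i(\lambda_1,\lambda_2)\in\mathbb N\cup\{+\infty\}$, which Player $i$ wants to minimize, is the sum of the weights $\mu_i$ along the outcome of $(\lambda_1,\lambda_2)$ up to its first visit to $C_i$, and $+\infty$ if $C_i$ is never visited. For $P_1\subseteq\Lambda_1(G)$, $P_2\subseteq\Lambda_2(G)$, $i\in\{1,2\}$ and $-i$ the opponent of $i$, put (with $+\infty-(+\infty)=+\infty$) $$\mathrm{reg}_i^{P}(\lambda_i)=\max_{\lambda_{-i}\in P_{-i}}\Bigl(u_i(\lambda_i,\lambda_{-i})-\min_{\lambda_i^*\in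 P_i}u_i(\lambda_i^*,\lambda_{-i})\Bigr),\qquad \mathrm{reg}_i^{P}=\min_{\lambda_i\in P_i}\mathrm{reg}_i^{P}(\lambda_i).$$ Let $P_i^0=\Lambda_i(G)$, $P_i^{j+1}=\{\lambda_i\in P_i^j : \mathrm{reg}_i^{P^j}(\lambda_i)=\mathrm{reg}_i^{P^j}\}$ and $\mathrm{reg}_i^{G,j+1}=\mathrm{reg}_i^{P^j}$. The iterated regret $\mathrm{reg}_i^{G,\star}\in\mathbb N\cup\{+\infty\}$ of Player $i$ is the value at which the sequence $(\mathrm{reg}_i^{G,j})_{j\ge1}$ is eventually constant. **Theorem.** The iterated regret for both players in a positive weighted arena $G$ can be computed in pseudo-exponential time (exponential in $|S|$, $|T|$ and $M^G$). That is, there are one program and one polynomial $p$ such that, for every positive weighted arena $G$, the iterated regrets of both players exist and the program, given $G$ (positions numbered $0,\dots,|S|-1$, adjacency matrix with weights), outputs $\mathrm{reg}_1^{G,\star}$ and $\mathrm{reg}_2^{G,\star}$ after at most $2^{p(|S|+|T|+M^G)}$ steps. Programs run on a random access machine with natural-number memory cells, computed addresses, addition, truncated subtraction and structured control flow, each elementary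 operation counting as one step. -/

import Mathlib

namespace RegretGame

/-! ### Weighted game arenas -/

inductive Player where
  | one
  | two
  deriving DecidableEq

/-- The opponent. -/
def Player.other : Player → Player
  | .one => .two
  | .two => .one

/-- A weighted game arena on a set `S` of positions (`S` is assumed finite where it matters).
`owner` splits `S` into the positions of Player 1 and of Player 2; `weight i s s'` is the weight
for Player `i` of the edge `(s, s')` and is meaningless when `(s, s')` is not an edge. -/
structure Arena (S : Type) where
  owner : S → Player
  init : S
  owner_init : owner init = .one
  edges : Finset (S × S)
  weight : Player → S → S → ℕ
  target : Player → Finset S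

/-- The values of a strategy: it maps a finite play to a position, or to `none` (for `⊥`).
Finite plays are recorded as lists *with the most recent position first*. -/
abbrev Strat (S : Type) := List S → Option S

namespace Arena

variable {S : Type}

/-- All edges carry strictly positive weights, for both players. -/
def Positive (G : Arena S) : Prop :=
  ∀ e ∈ G.edges, ∀ i, 0 < G.weight i e.1 e.2

/-- The largest weight of an edge, over both players (`0` if there is no edge). -/
def maxWeight (G : Arena S) : ℕ :=
  G.edges.sup fun e => max (G.weight .one e.1 e.2) (G.weight .two e.1 e.2)

/-- Finite plays, most recent position first. -/
def IsPlay (G : Arena S) : List S → Prop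
  | [] => False
  | [s] => s = G.init
  | s' :: s :: π => (s, s') ∈ G.edges ∧ IsPlay G (s :: π)

/-- The strategies of Player `i`: on a finite play that ends in a position `s` of Player `i`,
the answer is `⊥` if `s` has no outgoing edge and a successor of `s` otherwise.
(The values on other lists are never used.) -/
def strategies (G : Arena S) (i : Player) : Set (Strat S) :=
  {f | ∀ s π, G.IsPlay (s :: π) → G.owner s = i →
    match f (s :: π) with
    | none => ∀ s', (s, s') ∉ G.edges
    | some s' => (s, s') ∈ G.edges}

/-- The prefix with `k` moves of the outcome of the strategies `σ .one` and `σ .two`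
(the whole outcome, if it has fewer than `k` moves). -/
def outcome (G : Arena S) (σ : Player → Strat S) : ℕ → List S
  | 0 => [G.init]
  | k + 1 =>
    match outcome G σ k with
    | [] => []
    | s :: π =>
      match σ (G.owner s) (s :: π) with
      | none => s :: π
      | some s' => s' :: s :: π

/-- The sum of the weights for Player `i` along a finite play (most recent position first). -/
def pathWeight (G : Arena S) (i : Player) : List S → ℕ
  | [] => 0
  | [_] => 0
  | s' :: s :: π => pathWeight G i (s :: π) + G.weight i s s'

/-- The outcome of `σ` is at a target of Player `i` after `k` moves. -/
def AtTarget (G : Arena S) (i : Player) (σ : Player → Strat S) (k : ℕ) : Prop :=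
  ∃ s ∈ G.target i, (G.outcome σ k).head? = some s

open Classical in
/-- The utility (a penalty) of Player `i`: the weight of the outcome up to its first visit to the
target set of Player `i`, and `+∞` if there is no such visit. -/
noncomputable def utility (G : Arena S) (i : Player) (σ : Player → Strat S) : ℕ∞ :=
  if h : ∃ k, G.AtTarget i σ k then (G.pathWeight i (G.outcome σ (Nat.find h)) : ℕ∞) else ⊤

end Arena

/-- The pair of strategies in which Player `i` plays `a` and her opponent plays `b`. -/
def pair {S : Type} (i : Player) (a b : Strat S) : Player → Strat S :=
  fun k => if k = i then a else b

namespace Arena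

variable {S : Type}

/-! ### Iterated regret

`P : Player → Set (Strat S)` is a pair of sets of strategies.  Minima and maxima are taken
in `ℕ∞ = ℕ ∪ {+∞}`. -/

/-- The least utility Player `i` can achieve in `P i` against `b`. -/
noncomputable def bestResponse (G : Arena S) (P : Player → Set (Strat S)) (i : Player)
    (b : Strat S) : ℕ∞ :=
  ⨅ a ∈ P i, G.utility i (pair i a b)

/-- The regret of Player `i` for `a` against `b`, where `(+∞) - x = +∞` for all `x`, in particular
`(+∞) - (+∞) = +∞`. -/
noncomputable def regretAgainst (G : Arena S) (P : Player → Set (Strat S)) (i : Player)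
    (a b : Strat S) : ℕ∞ :=
  if G.utility i (pair i a b) = ⊤ then ⊤
  else G.utility i (pair i a b) - G.bestResponse P i b

/-- The regret of the strategy `a` of Player `i` against the strategies in `P i.other`. -/
noncomputable def regretOf (G : Arena S) (P : Player → Set (Strat S)) (i : Player)
    (a : Strat S) : ℕ∞ :=
  ⨆ b ∈ P i.other, G.regretAgainst P i a b

/-- The regret of Player `i` when both players are restricted to `P`. -/
noncomputable def regret (G : Arena S) (P : Player → Set (Strat S)) (i : Player) : ℕ∞ :=
  ⨅ a ∈ P i, G.regretOf P i a

/-- The delete operator: both players keep only the strategies that minimize their regret. -/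
def delete (G : Arena S) (P : Player → Set (Strat S)) : Player → Set (Strat S) :=
  fun i => {a ∈ P i | G.regret P i = G.regretOf P i a}

/-- The strategies of rank `j` of both players. -/
def rank (G : Arena S) (j : ℕ) : Player → Set (Strat S) :=
  G.delete^[j] G.strategies

/-- The `(j + 1)`-th regret of Player `i`. -/
noncomputable def regretSucc (G : Arena S) (i : Player) (j : ℕ) : ℕ∞ :=
  G.regret (G.rank j) i

/-- `r` is the iterated regret of Player `i`: the sequence of her `j`-th regrets is eventually
constant, with value `r`. -/
def IsIteratedRegret (G : Arena S) (i : Player) (r : ℕ∞) : Prop :=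
  ∃ N, ∀ j ≥ N, G.regretSucc i j = r

end Arena

/-! ### Programs on a random access memory, with uniform cost

The memory consists of cells `0, 1, 2, …`, each holding a natural number.  Available operations are
constants, reading a cell (whose address may be computed), addition and truncated subtraction,
assignment to a cell (whose address may be computed), and structured control flow.  Each of
these takes one unit of time.  (There is no multiplication, so that with uniform cost the model is
polynomially equivalent to Turing machines.) -/

abbrev Memory := ℕ → ℕ

inductive Expr where
  | const (n : ℕ)
  | read (addr : Expr)
  | add (a b : Expr)
  | sub (a b : Expr)

def Expr.eval (m : Memory) : Expr → ℕ
  | .const n => n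
  | .read a => m (a.eval m)
  | .add a b => a.eval m + b.eval m
  | .sub a b => a.eval m - b.eval m

/-- The time to evaluate an expression: one unit for each operation. -/
def Expr.cost : Expr → ℕ
  | .const _ => 1
  | .read a => a.cost + 1
  | .add a b => a.cost + b.cost + 1
  | .sub a b => a.cost + b.cost + 1

inductive Program where
  | skip
  | assign (addr val : Expr)
  | seq (c d : Program)
  | cond (guard : Expr) (c d : Program)
  | loop (guard : Expr) (c : Program)

/-- `Exec c m t m'`: the program `c`, started in the memory `m`, halts after exactly `t` units
of time with memory `m'`.  Guards are true iff they are nonzero. -/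
inductive Exec : Program → Memory → ℕ → Memory → Prop where
  | skip (m : Memory) : Exec .skip m 1 m
  | assign (a v : Expr) (m : Memory) :
      Exec (.assign a v) m (a.cost + v.cost + 1) (Function.update m (a.eval m) (v.eval m))
  | seq {c d : Program} {m m₁ m₂ : Memory} {t₁ t₂ : ℕ} :
      Exec c m t₁ m₁ → Exec d m₁ t₂ m₂ → Exec (.seq c d) m (t₁ + t₂) m₂
  | condTrue {g : Expr} {c d : Program} {m m₁ : Memory} {t : ℕ} :
      g.eval m ≠ 0 → Exec c m t m₁ → Exec (.cond g c d) m (g.cost + 1 + t) m₁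
  | condFalse {g : Expr} {c d : Program} {m m₁ : Memory} {t : ℕ} :
      g.eval m = 0 → Exec d m t m₁ → Exec (.cond g c d) m (g.cost + 1 + t) m₁
  | loopStop {g : Expr} {c : Program} {m : Memory} :
      g.eval m = 0 → Exec (.loop g c) m (g.cost + 1) m
  | loopStep {g : Expr} {c : Program} {m m₁ m₂ : Memory} {t₁ t₂ : ℕ} :
      g.eval m ≠ 0 → Exec c m t₁ m₁ → Exec (.loop g c) m₁ t₂ m₂ →
        Exec (.loop g c) m (g.cost + 1 + t₁ + t₂) m₂

/-! ### Input and output -/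

/-- The memory whose first cells hold the list `l`, all other cells being `0`. -/
def memoryOfList (l : List ℕ) : Memory := fun k => l.getD k 0

def Player.code : Player → ℕ
  | .one => 0
  | .two => 1

/-- The description of an arena whose positions are numbered `0, …, n - 1`: the number of positions,
the initial position, then for each position its owner and whether it is in each target set, and
finally the adjacency matrix, row by row, with three entries for each pair of positions: whether it
is an edge, and its two weights (`0` for a pair that is not an edge). -/
def Arena.encode {S : Type} [DecidableEq S] (G : Arena S) {n : ℕ} (e : S ≃ Fin n) : List ℕ :=
  [n, (e G.init : ℕ)] ++
  ((List.finRange n).flatMap fun k =>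
    [(G.owner (e.symm k)).code,
      if e.symm k ∈ G.target .one then 1 else 0,
      if e.symm k ∈ G.target .two then 1 else 0]) ++
  ((List.finRange n).flatMap fun k => (List.finRange n).flatMap fun l =>
    if (e.symm k, e.symm l) ∈ G.edges then
      [1, G.weight .one (e.symm k) (e.symm l), G.weight .two (e.symm k) (e.symm l)]
    else [0, 0, 0])

/-- The code of a regret value: `0` for `+∞`, and `k + 1` for `k ∈ ℕ`. -/
def regretCode : ℕ∞ → ℕ
  | none => 0
  | some k => k + 1

end RegretGame

/-!
The proof has two parts.

**Iterated regret on finite trees.**  A finite play is a history, and a set of strategies is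
described by a tree of histories: those that remain possible (`Describes`).  With a horizon `D`, and
with `D + 1` in the place of `+∞`, let `util` be the utility of a player on a history `h`,
`best` the least utility on an extension of `h` in the tree, and `dev` the least `best` that she
could have obtained by leaving `h` with one of her own moves.  A maximal history has regret
`util - dev` for her, if `util` is finite, since an opponent who is consistent with the history can
react to any deviation by full cooperation (`exists_opponent`).  Hence the regret of a player is
the value `val` of the finite game in which she minimizes this quantity and her opponent
maximizes it (`regret_eq_uncap`), and her optimal strategies are those that never reach a
history of larger value than the root.  So deleting strategies is pruning the tree
(`Describes.delete`).

This requires that optimal strategies with finite regret have utilities of at most `D`.  A player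
with infinite regret does not lose any moves, and neither does a player who has reached her target
(`FreeFor.prune`, `FreeAfter.prune`).  If no moves are pruned after the first `L` ones, a player with
a winning strategy also has one that, from the `L`-th move on, follows an attractor to her target
(`exists_utility_le`).  It has a utility of at most `(L + |S|) * M`, and optimal
strategies have at most twice that.  The first player to obtain a finite regret does so with `L = 0`,
and thereafter always reaches her target within a known number of moves.  This number is the `L` for
the other player.  When both have obtained finite regrets, all remaining plays reach both
targets, and nothing more is needed (`Status.step`).  As weights are positive, utilities
bound the number of moves, so that a depth `D` that is polynomial in `|S|` and `M` suffices.

A step of the iteration either prunes a node of the tree of depth `D` or is the last one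
(`tree_eq_of_le`), so that the iterated regrets exist and are the values of the tree after as many
steps as it has nodes.

**The program.**  The tree is stored like a heap in arrays, and each step of the iteration consists of
a few passes over it.  The algorithm is written in a language of bounded loops over
arrays, in which correctness is a matter of loop invariants, and which is compiled to the random access
machine by interleaving the arrays in memory.  If the registers that hold the lengths of the loops
do not change and are at most `X`, the running time is polynomial in `X` (`Cmd.exec_compile`).
Since `X` is at most exponential in a polynomial of `|S| + M` (`le_two_pow_logBound`), the bound
follows.
-/

namespace RegretGame
namespace Arena

variable {S : Type} {G : Arena S} {i : Player} {σ : Player → Strat S}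

/-! ### Plays and outcomes -/

theorem IsPlay.ne_nil {h : List S} (hh : G.IsPlay h) : h ≠ [] := by
  rintro rfl; exact hh

theorem isPlay_cons {s' s : S} {π : List S} :
    G.IsPlay (s' :: s :: π) ↔ (s, s') ∈ G.edges ∧ G.IsPlay (s :: π) := by
  rw [IsPlay]

theorem isPlay_singleton {s : S} : G.IsPlay [s] ↔ s = G.init := by
  rw [IsPlay]

theorem IsPlay.init_suffix {h : List S} (hh : G.IsPlay h) : [G.init] <:+ h := by
  induction h with
  | nil => exact hh.elim
  | cons s' h ih =>
    cases h with
    | nil => rw [isPlay_singleton.1 hh]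
    | cons s π => exact (ih (isPlay_cons.1 hh).2).trans (List.suffix_cons _ _)

theorem pathWeight_cons {s' s : S} {π : List S} :
    G.pathWeight i (s' :: s :: π) = G.pathWeight i (s :: π) + G.weight i s s' := by
  rw [pathWeight]

theorem pathWeight_mono {g h : List S} (hg : g <:+ h) : G.pathWeight i g ≤ G.pathWeight i h := by
  induction h with
  | nil => rw [List.suffix_nil.1 hg]
  | cons s' h ih =>
    rcases List.suffix_cons_iff.1 hg with rfl | hg'
    · exact le_rfl
    · refine (ih hg').trans ?_
      cases h with
      | nil => simp [pathWeight]
      | cons s π => rw [pathWeight_cons]; omega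

theorem length_le_pathWeight (hpos : G.Positive) {h : List S} (hh : G.IsPlay h) :
    h.length ≤ G.pathWeight i h + 1 := by
  induction h with
  | nil => simp
  | cons s' h ih =>
    cases h with
    | nil => simp
    | cons s π =>
      have := ih (isPlay_cons.1 hh).2
      have h2 := hpos _ (isPlay_cons.1 hh).1 i
      rw [pathWeight_cons]
      simp only [List.length_cons] at *
      omega

theorem weight_le_maxWeight {s s' : S} (h : (s, s') ∈ G.edges) : G.weight i s s' ≤ G.maxWeight := by
  have := Finset.le_sup (f := fun e : S × S => max (G.weight .one e.1 e.2) (G.weight .two e.1 e.2)) h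
  refine le_trans ?_ this
  cases i
  · exact le_max_left _ _
  · exact le_max_right _ _

theorem pathWeight_le {h : List S} (hh : G.IsPlay h) :
    G.pathWeight i h ≤ (h.length - 1) * G.maxWeight := by
  induction h with
  | nil => simp [pathWeight]
  | cons s' h ih =>
    cases h with
    | nil => simp [pathWeight]
    | cons s π =>
      have := ih (isPlay_cons.1 hh).2
      have h2 := weight_le_maxWeight (i := i) (isPlay_cons.1 hh).1
      rw [pathWeight_cons]
      simp only [List.length_cons, Nat.add_sub_cancel] at *
      rw [Nat.add_mul, one_mul]
      omega

/-- Both components of `σ` are strategies. -/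
def Legal (G : Arena S) (σ : Player → Strat S) : Prop := ∀ i, σ i ∈ G.strategies i

theorem mem_edges_of_mem_strategies {f : Strat S} (hf : f ∈ G.strategies i) {s s' : S} {π : List S}
    (hh : G.IsPlay (s :: π)) (ho : G.owner s = i) (he : f (s :: π) = some s') :
    (s, s') ∈ G.edges := by
  have := hf s π hh ho
  rw [he] at this
  exact this

theorem notMem_edges_of_mem_strategies {f : Strat S} (hf : f ∈ G.strategies i) {s : S} {π : List S}
    (hh : G.IsPlay (s :: π)) (ho : G.owner s = i) (he : f (s :: π) = none) (s' : S) :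
    (s, s') ∉ G.edges := by
  have := hf s π hh ho
  rw [he] at this
  exact this s'

theorem outcome_succ_of_some {k : ℕ} {s s' : S} {π : List S} (h : G.outcome σ k = s :: π)
    (hs : σ (G.owner s) (s :: π) = some s') : G.outcome σ (k + 1) = s' :: s :: π := by
  rw [outcome, h]; simp [hs]

theorem outcome_succ_of_none {k : ℕ} {s : S} {π : List S} (h : G.outcome σ k = s :: π)
    (hs : σ (G.owner s) (s :: π) = none) : G.outcome σ (k + 1) = s :: π := by
  rw [outcome, h]; simp [hs]

theorem isPlay_outcome (hσ : G.Legal σ) (k : ℕ) : G.IsPlay (G.outcome σ k) := by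
  induction k with
  | zero => rw [outcome, isPlay_singleton]
  | succ k ih =>
    cases h : G.outcome σ k with
    | nil => rw [h] at ih; exact ih.elim
    | cons s π =>
      rw [h] at ih
      cases hs : σ (G.owner s) (s :: π) with
      | none => rw [outcome_succ_of_none h hs]; exact ih
      | some s' =>
        rw [outcome_succ_of_some h hs, isPlay_cons]
        exact ⟨mem_edges_of_mem_strategies (hσ _) ih rfl hs, ih⟩

theorem outcome_succ_eq_or (σ : Player → Strat S) (k : ℕ) :
    G.outcome σ (k + 1) = G.outcome σ k ∨ ∃ s, G.outcome σ (k + 1) = s :: G.outcome σ k := by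
  cases h : G.outcome σ k with
  | nil => left; rw [outcome, h]
  | cons s π =>
    cases hs : σ (G.owner s) (s :: π) with
    | none => left; exact outcome_succ_of_none h hs
    | some s' => right; exact ⟨s', outcome_succ_of_some h hs⟩

theorem outcome_suffix (σ : Player → Strat S) {k m : ℕ} (h : k ≤ m) :
    G.outcome σ k <:+ G.outcome σ m := by
  induction m, h using Nat.le_induction with
  | base => exact List.suffix_refl _
  | succ m _ ih =>
    rcases outcome_succ_eq_or (G := G) σ m with h | ⟨s, h⟩ <;> rw [h]
    · exact ih
    · exact ih.trans (List.suffix_cons _ _)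

theorem outcome_succ_congr {k m : ℕ} (h : G.outcome σ k = G.outcome σ m) :
    G.outcome σ (k + 1) = G.outcome σ (m + 1) := by
  rw [outcome, outcome, h]

theorem outcome_eq_of_stalled {k m : ℕ} (h : G.outcome σ (k + 1) = G.outcome σ k) (hm : k ≤ m) :
    G.outcome σ m = G.outcome σ k := by
  induction m, hm using Nat.le_induction with
  | base => rfl
  | succ m _ ih => rw [outcome_succ_congr ih, h]

theorem length_outcome_or_stalled (σ : Player → Strat S) (k : ℕ) :
    (G.outcome σ k).length = k + 1 ∨ G.outcome σ (k + 1) = G.outcome σ k := by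
  induction k with
  | zero => left; simp [outcome]
  | succ k ih =>
    rcases ih with ih | ih
    · rcases outcome_succ_eq_or (G := G) σ k with h | ⟨s, h⟩
      · right; exact outcome_succ_congr h
      · left; rw [h, List.length_cons, ih]
    · right; exact outcome_succ_congr ih

theorem length_outcome_le (σ : Player → Strat S) (k : ℕ) : (G.outcome σ k).length ≤ k + 1 := by
  induction k with
  | zero => simp [outcome]
  | succ k ih =>
    rcases outcome_succ_eq_or (G := G) σ k with h | ⟨s, h⟩ <;> rw [h]
    · omega
    · simp only [List.length_cons]; omega

theorem outcome_eq_of_length_le {k D : ℕ} (hk : D ≤ k) (hl : (G.outcome σ k).length ≤ D + 1) :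
    G.outcome σ k = G.outcome σ D := by
  rcases length_outcome_or_stalled (G := G) σ D with h | h
  · exact ((outcome_suffix σ hk).eq_of_length_le (by omega)).symm
  · exact outcome_eq_of_stalled h hk

theorem exists_eq_outcome_of_suffix {g : List S} {k : ℕ} (hg : g <:+ G.outcome σ k) (hne : g ≠ []) :
    ∃ m ≤ k, g = G.outcome σ m := by
  induction k with
  | zero =>
    rw [outcome, List.suffix_cons_iff] at hg
    rcases hg with rfl | hg
    · exact ⟨0, le_rfl, by rw [outcome]⟩
    · exact absurd (List.suffix_nil.1 hg) hne
  | succ k ih =>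
    rcases outcome_succ_eq_or (G := G) σ k with h | ⟨s, h⟩
    · rw [h] at hg
      obtain ⟨m, hm, e⟩ := ih hg
      exact ⟨m, by omega, e⟩
    · rw [h, List.suffix_cons_iff] at hg
      rcases hg with rfl | hg
      · exact ⟨k + 1, le_rfl, h.symm⟩
      · obtain ⟨m, hm, e⟩ := ih hg
        exact ⟨m, by omega, e⟩

/-! ### Capped utilities of histories -/

theorem utility_le_iff {x : ℕ} :
    G.utility i σ ≤ x ↔ ∃ k, G.AtTarget i σ k ∧ G.pathWeight i (G.outcome σ k) ≤ x := by
  classical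
  unfold utility
  split_ifs with h
  · rw [Nat.cast_le]
    constructor
    · intro hx; exact ⟨_, Nat.find_spec h, by convert hx⟩
    · rintro ⟨k, hk, hx⟩
      exact (pathWeight_mono (outcome_suffix σ (Nat.find_min' h hk))).trans hx
  · simp only [top_le_iff, ENat.natCast_ne_top, false_iff]
    rintro ⟨k, hk, -⟩
    exact h ⟨k, hk⟩

open Classical in
/-- The utility of Player `i` on a finite history: the weight up to the first visit to her target,
capped at `K`, and `K` if there is no visit.  The cap `K` plays the role of `+∞`. -/
noncomputable def util (G : Arena S) (K : ℕ) (i : Player) : List S → ℕ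
  | [] => K
  | s :: π => min (util G K i π) (if s ∈ G.target i then G.pathWeight i (s :: π) else K)

theorem util_le (K : ℕ) (h : List S) : G.util K i h ≤ K := by
  induction h with
  | nil => exact le_rfl
  | cons s π ih => rw [util]; exact (min_le_left _ _).trans ih

theorem util_le_iff {K x : ℕ} (hx : x < K) {h : List S} :
    G.util K i h ≤ x ↔ ∃ s π, (s :: π) <:+ h ∧ s ∈ G.target i ∧ G.pathWeight i (s :: π) ≤ x := by
  induction h with
  | nil => simp [util]; omega
  | cons s π ih =>
    rw [util, min_le_iff, ih]
    constructor
    · rintro (⟨t, ρ, h1, h2⟩ | h)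
      · exact ⟨t, ρ, h1.trans (List.suffix_cons _ _), h2⟩
      · split_ifs at h with hs
        · exact ⟨s, π, List.suffix_refl _, hs, h⟩
        · omega
    · rintro ⟨t, ρ, h1, h2, h3⟩
      rcases List.suffix_cons_iff.1 h1 with h | h
      · obtain ⟨rfl, rfl⟩ := List.cons.inj h
        right; rwa [if_pos h2]
      · left; exact ⟨t, ρ, h, h2, h3⟩

/-- Weights only grow along a play, so that later visits to the target do not matter. -/
theorem util_cons_of_lt {K : ℕ} {s' : S} {π : List S} (hlt : G.util K i π < K) :
    G.util K i (s' :: π) = G.util K i π := by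
  refine le_antisymm (by rw [util]; exact min_le_left _ _) ?_
  rw [util]
  refine le_min le_rfl ?_
  split_ifs
  · obtain ⟨t, ρ, h1, h2, h3⟩ := (util_le_iff hlt).1 le_rfl
    exact ((util_le_iff (h3.trans_lt hlt)).2 ⟨t, ρ, h1, h2, le_rfl⟩).trans
      (pathWeight_mono (h1.trans (List.suffix_cons _ _)))
  · exact hlt.le

theorem util_eq_of_suffix {K : ℕ} {g h : List S} (hlt : G.util K i g < K) (hg : g <:+ h) :
    G.util K i h = G.util K i g := by
  induction h with
  | nil => rw [List.suffix_nil.1 hg]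
  | cons s h ih =>
    rcases List.suffix_cons_iff.1 hg with rfl | hg'
    · rfl
    · rw [util_cons_of_lt (by rw [ih hg']; exact hlt), ih hg']

/-- As all weights are positive, a utility of at most `D` is reached within `D` moves. -/
theorem utility_le_iff_util (hpos : G.Positive) (hσ : G.Legal σ) {x D : ℕ} (hx : x ≤ D) :
    G.utility i σ ≤ x ↔ G.util (D + 1) i (G.outcome σ D) ≤ x := by
  rw [utility_le_iff, util_le_iff (by omega)]
  constructor
  · rintro ⟨k, ⟨s, hs, hk⟩, hw⟩
    have hlen : (G.outcome σ k).length ≤ D + 1 := by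
      have := length_le_pathWeight (i := i) hpos (isPlay_outcome hσ k); omega
    cases hO : G.outcome σ k with
    | nil => rw [hO] at hk; simp at hk
    | cons s₁ π =>
      rw [hO] at hk hw
      obtain rfl : s₁ = s := by simpa using hk
      refine ⟨s₁, π, ?_, hs, hw⟩
      rw [← hO]
      rcases le_total k D with h | h
      · exact outcome_suffix σ h
      · rw [outcome_eq_of_length_le h hlen]
  · rintro ⟨s, π, hsuf, hs, hw⟩
    obtain ⟨m, -, hm⟩ := exists_eq_outcome_of_suffix hsuf (by simp)
    exact ⟨m, ⟨s, hs, by rw [← hm]; rfl⟩, by rw [← hm]; exact hw⟩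

theorem utility_eq_util (hpos : G.Positive) (hσ : G.Legal σ) {D : ℕ}
    (hlt : G.util (D + 1) i (G.outcome σ D) ≤ D) :
    G.utility i σ = G.util (D + 1) i (G.outcome σ D) := by
  refine le_antisymm ((utility_le_iff_util hpos hσ hlt).2 le_rfl) ?_
  have h1 := (utility_le_iff_util hpos hσ hlt).2 le_rfl
  obtain ⟨y, hy⟩ := ENat.ne_top_iff_exists.1 (ne_top_of_le_ne_top (ENat.natCast_ne_top _) h1)
  rw [← hy, Nat.cast_le] at h1 ⊢
  exact (utility_le_iff_util hpos hσ (h1.trans hlt)).1 hy.ge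

end Arena
end RegretGame

namespace RegretGame
namespace Arena

variable {S : Type} {G : Arena S} {i : Player} {σ : Player → Strat S}

/-! ### Trees of histories, and the strategies that stay in them -/

/-- A set `T` of histories that is a pruning of the unfolding of `G`: it is closed under prefixes,
pruning creates no dead ends, and nothing is pruned after the first `D` moves. -/
structure IsTree (G : Arena S) (D : ℕ) (T : List S → Prop) : Prop where
  isPlay : ∀ {h}, T h → G.IsPlay h
  init : T [G.init]
  parent : ∀ {s' s π}, T (s' :: s :: π) → T (s :: π)
  child : ∀ {s π s'}, T (s :: π) → (s, s') ∈ G.edges → ∃ s'', T (s'' :: s :: π)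
  free : ∀ {s π s'}, T (s :: π) → D < (s :: π).length → (s, s') ∈ G.edges → T (s' :: s :: π)

variable {D : ℕ} {T : List S → Prop}

theorem IsTree.of_suffix (hT : G.IsTree D T) {g h : List S} (hh : T h) (hg : g <:+ h)
    (hne : g ≠ []) : T g := by
  induction h with
  | nil => exact absurd (List.suffix_nil.1 hg) hne
  | cons s' h ih =>
    rcases List.suffix_cons_iff.1 hg with rfl | hg'
    · exact hh
    · cases h with
      | nil => exact absurd (List.suffix_nil.1 hg') hne
      | cons s π => exact ih (hT.parent hh) hg'

/-- Along the history `h`, all moves of Player `i` are those of the strategy `f`. -/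
def Follows (G : Arena S) (f : Strat S) (i : Player) (h : List S) : Prop :=
  ∀ s' s π, (s' :: s :: π) <:+ h → G.owner s = i → f (s :: π) = some s'

theorem Follows.of_suffix {f : Strat S} {g h : List S} (hh : G.Follows f i h) (hg : g <:+ h) :
    G.Follows f i g :=
  fun s' s π hs => hh s' s π (hs.trans hg)

theorem follows_cons {f : Strat S} {s' s : S} {π : List S} :
    G.Follows f i (s' :: s :: π) ↔
      G.Follows f i (s :: π) ∧ (G.owner s = i → f (s :: π) = some s') := by
  constructor
  · intro h
    exact ⟨h.of_suffix (List.suffix_cons _ _), h s' s π (List.suffix_refl _)⟩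
  · rintro ⟨h1, h2⟩ t' t ρ ht ho
    rcases List.suffix_cons_iff.1 ht with e | ht
    · cases e; exact h2 ho
    · exact h1 _ _ _ ht ho

theorem follows_singleton (f : Strat S) (s : S) : G.Follows f i [s] := by
  intro s' t π h
  have := h.length_le
  simp at this

theorem Follows.congr {f f' : Strat S} {h : List S} (hh : G.Follows f i h)
    (hf : ∀ s' s π, (s' :: s :: π) <:+ h → f' (s :: π) = f (s :: π)) : G.Follows f' i h :=
  fun s' s π hs ho => by rw [hf s' s π hs]; exact hh s' s π hs ho

/-- The strategies of Player `i` that never leave `T` on the histories they can reach in `T`. -/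
def Conform (G : Arena S) (T : List S → Prop) (i : Player) : Set (Strat S) :=
  {f | f ∈ G.strategies i ∧ ∀ s π s', T (s :: π) → G.owner s = i → G.Follows f i (s :: π) →
    f (s :: π) = some s' → T (s' :: s :: π)}

/-- `P` restricted to `T` is the pair of sets of all strategies that stay in `T`. -/
def Describes (G : Arena S) (T : List S → Prop) (P : Player → Set (Strat S)) : Prop :=
  ∀ i, (∀ f ∈ P i, f ∈ G.Conform T i) ∧ ∀ f ∈ G.Conform T i, ∃ f' ∈ P i, ∀ h, T h → f' h = f h

/-- Strategies may be built by choosing a move in `T` at every history, as long as there is one. -/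
theorem IsTree.exists_strategy (hT : G.IsTree D T) (R : List S → S → Prop)
    (hR : ∀ h s, T (s :: h) → ∃ s', T (s' :: h) ∧ R h s') :
    ∃ f : Strat S, (∀ i, f ∈ G.Conform T i) ∧
      ∀ h s, T (s :: h) → ∃ s', f h = some s' ∧ T (s' :: h) ∧ R h s' := by
  classical
  have key : ∀ h : List S, ∃ o : Option S,
      (∀ s, T (s :: h) → ∃ s', o = some s' ∧ T (s' :: h) ∧ R h s') ∧
      ((∀ s, ¬ T (s :: h)) → ∀ s π, h = s :: π →
        match o with
        | none => ∀ s', (s, s') ∉ G.edges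
        | some s' => (s, s') ∈ G.edges) := by
    intro h
    by_cases hc : ∃ s, T (s :: h)
    · obtain ⟨s, hs⟩ := hc
      obtain ⟨s', h1, h2⟩ := hR h s hs
      exact ⟨some s', fun _ _ => ⟨s', rfl, h1, h2⟩, fun hn => absurd hs (hn s)⟩
    · push Not at hc
      cases h with
      | nil => exact ⟨none, fun s hs => absurd hs (hc s), by simp⟩
      | cons s π =>
        by_cases he : ∃ s', (s, s') ∈ G.edges
        · obtain ⟨s', hs'⟩ := he
          refine ⟨some s', fun s hs => absurd hs (hc s), fun _ t ρ e => ?_⟩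
          cases e; exact hs'
        · push Not at he
          refine ⟨none, fun s hs => absurd hs (hc s), fun _ t ρ e => ?_⟩
          cases e; exact he
  choose f hf1 hf2 using key
  refine ⟨f, fun i => ⟨?_, ?_⟩, hf1⟩
  · intro s π hp _
    by_cases hc : ∃ s', T (s' :: s :: π)
    · obtain ⟨s', hs'⟩ := hc
      obtain ⟨t, e, ht, -⟩ := hf1 _ s' hs'
      rw [e]
      exact (isPlay_cons.1 (hT.isPlay ht)).1
    · push Not at hc
      exact hf2 _ hc s π rfl
  · intro s π s' hs _ _ e
    have hp := hT.isPlay hs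
    by_cases hc : ∃ t, T (t :: s :: π)
    · obtain ⟨t, ht⟩ := hc
      obtain ⟨t', e', ht', -⟩ := hf1 _ t ht
      rw [e] at e'
      cases e'; exact ht'
    · push Not at hc
      have h3 := hf2 _ hc s π rfl
      rw [e] at h3
      obtain ⟨t, ht⟩ := hT.child hs h3
      exact absurd ht (hc t)

theorem legal_of_conform (hσ : ∀ j, σ j ∈ G.Conform T j) : G.Legal σ := fun j => (hσ j).1

theorem outcome_mem (hT : G.IsTree D T) (hσ : ∀ j, σ j ∈ G.Conform T j) (k : ℕ) :
    T (G.outcome σ k) ∧ ∀ j, G.Follows (σ j) j (G.outcome σ k) := by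
  induction k with
  | zero => rw [outcome]; exact ⟨hT.init, fun j => follows_singleton _ _⟩
  | succ k ih =>
    cases h : G.outcome σ k with
    | nil => rw [h] at ih; exact absurd rfl (hT.isPlay ih.1).ne_nil
    | cons s π =>
      rw [h] at ih
      cases hs : σ (G.owner s) (s :: π) with
      | none => rw [outcome_succ_of_none h hs]; exact ih
      | some s' =>
        rw [outcome_succ_of_some h hs]
        refine ⟨(hσ _).2 s π s' ih.1 rfl (ih.2 _) hs, fun j => follows_cons.2 ⟨ih.2 j, ?_⟩⟩
        rintro rfl; exact hs

theorem suffix_or_diverge {h h' : List S} (hh : G.IsPlay h) (hh' : G.IsPlay h') :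
    h <:+ h' ∨ h' <:+ h ∨ ∃ s' s'' s π, s' ≠ s'' ∧ (s' :: s :: π) <:+ h ∧
      (s'' :: s :: π) <:+ h' := by
  induction h' with
  | nil => exact hh'.elim
  | cons s'' g ih =>
    cases g with
    | nil =>
      right; left
      rw [isPlay_singleton.1 hh']; exact hh.init_suffix
    | cons s π =>
      rcases ih (isPlay_cons.1 hh').2 with h1 | ⟨l, h1⟩ | ⟨t', t'', t, ρ, h1, h2, h3⟩
      · left; exact h1.trans (List.suffix_cons _ _)
      · rcases List.eq_nil_or_concat l with rfl | ⟨l, s', rfl⟩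
        · left
          rw [List.nil_append] at h1
          rw [← h1]; exact List.suffix_cons _ _
        · have h4 : (s' :: s :: π) <:+ h := ⟨l, by rw [← h1]; simp⟩
          by_cases e : s' = s''
          · subst e; right; left; exact h4
          · right; right
            exact ⟨s', s'', s, π, e, h4, List.suffix_refl _⟩
      · right; right
        exact ⟨t', t'', t, ρ, h1, h2, h3.trans (List.suffix_cons _ _)⟩

theorem suffix_or_suffix_of_follows {h h' : List S} (hh : G.IsPlay h) (hh' : G.IsPlay h')
    (hf : ∀ j, G.Follows (σ j) j h) (hf' : ∀ j, G.Follows (σ j) j h') : h <:+ h' ∨ h' <:+ h := by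
  rcases suffix_or_diverge hh hh' with h1 | h1 | ⟨s', s'', s, π, hne, h1, h2⟩
  · exact Or.inl h1
  · exact Or.inr h1
  · have e1 := hf _ _ _ _ h1 rfl
    have e2 := hf' _ _ _ _ h2 rfl
    rw [e1] at e2
    exact absurd (Option.some.inj e2) hne

theorem eq_or_eq_other (i j : Player) : j = i ∨ j = i.other := by
  cases i <;> cases j <;> simp [Player.other]

theorem other_ne (i : Player) : i.other ≠ i := by cases i <;> simp [Player.other]

theorem pair_same (i : Player) (a b : Strat S) : pair i a b i = a := if_pos rfl

theorem pair_other (i : Player) (a b : Strat S) : pair i a b i.other = b := if_neg (other_ne i)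

/-- A property of both components of a pair of strategies. -/
theorem forall_pair {p : Player → Strat S → Prop} {a b : Strat S} (ha : p i a) (hb : p i.other b) :
    ∀ j, p j (pair i a b j) := by
  intro j
  rcases eq_or_eq_other i j with rfl | rfl
  · rwa [pair_same]
  · rwa [pair_other]

variable {P : Player → Set (Strat S)}

theorem regretOf_le_iff {a : Strat S} {r : ℕ∞} :
    G.regretOf P i a ≤ r ↔ ∀ b ∈ P i.other, G.regretAgainst P i a b ≤ r := by
  simp [regretOf]

theorem Describes.conform (hP : G.Describes T P) {a b : Strat S} (ha : a ∈ P i)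
    (hb : b ∈ P i.other) : ∀ j, pair i a b j ∈ G.Conform T j :=
  forall_pair (p := fun j f => f ∈ G.Conform T j) ((hP i).1 a ha) ((hP i.other).1 b hb)

/-! ### Backward induction -/

section Backup

variable [Fintype S]

open Classical in
/-- The moves in `T` after the history `h`, within the horizon of `D` moves. -/
noncomputable def kids (T : List S → Prop) (D : ℕ) (h : List S) : Finset S :=
  Finset.univ.filter fun s => T (s :: h) ∧ h.length ≤ D

theorem mem_kids {s : S} {h : List S} : s ∈ kids T D h ↔ T (s :: h) ∧ h.length ≤ D := by
  simp [kids]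

open Classical in
/-- Backward induction with `k` moves to go: `q` tells where to minimize (elsewhere, maximize),
and `leaf` gives the values of the maximal histories.  Values are capped at `D + 1`. -/
noncomputable def backupAux (T : List S → Prop) (D : ℕ) (q : List S → Prop) (leaf : List S → ℕ) :
    ℕ → List S → ℕ
  | 0, h => leaf h
  | k + 1, h =>
    if (kids T D h).Nonempty then
      if q h then (kids T D h).fold min (D + 1) fun s => backupAux T D q leaf k (s :: h)
      else (kids T D h).sup fun s => backupAux T D q leaf k (s :: h)
    else leaf h

/-- The value of the history `h` under backward induction on the first `D` levels of `T`. -/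
noncomputable def backup (T : List S → Prop) (D : ℕ) (q : List S → Prop) (leaf : List S → ℕ)
    (h : List S) : ℕ :=
  backupAux T D q leaf (D + 1 - h.length) h

variable {q : List S → Prop} {leaf : List S → ℕ} {h : List S}

open Classical in
theorem backup_of_nonempty (hk : (kids T D h).Nonempty) :
    backup T D q leaf h =
      if q h then (kids T D h).fold min (D + 1) fun s => backup T D q leaf (s :: h)
      else (kids T D h).sup fun s => backup T D q leaf (s :: h) := by
  obtain ⟨s, hs⟩ := id hk
  have hl := (mem_kids.1 hs).2
  have e : D + 1 - h.length = (D - h.length) + 1 := by omega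
  have e2 : ∀ s : S, backup T D q leaf (s :: h) = backupAux T D q leaf (D - h.length) (s :: h) := by
    intro s
    rw [backup, List.length_cons, Nat.add_sub_add_right]
  simp only [e2]
  rw [backup, e, backupAux, if_pos hk]

theorem backup_of_empty (hk : kids T D h = ∅) : backup T D q leaf h = leaf h := by
  rw [backup]
  cases D + 1 - h.length with
  | zero => rfl
  | succ k => rw [backupAux, if_neg (by simp [hk])]

theorem backup_le (hl : ∀ h, leaf h ≤ D + 1) (h : List S) : backup T D q leaf h ≤ D + 1 := by
  rw [backup]
  generalize D + 1 - h.length = k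
  induction k generalizing h with
  | zero => exact hl h
  | succ k ih =>
    rw [backupAux]
    split_ifs
    · rw [Finset.fold_min_le]; exact Or.inl le_rfl
    · exact Finset.sup_le fun s _ => ih _
    · exact hl h

theorem backup_le_of_min {s : S} (hq : q h) (hs : s ∈ kids T D h) :
    backup T D q leaf h ≤ backup T D q leaf (s :: h) := by
  rw [backup_of_nonempty ⟨s, hs⟩, if_pos hq, Finset.fold_min_le]
  exact Or.inr ⟨s, hs, le_rfl⟩

theorem exists_backup_le_of_min (hl : ∀ h, leaf h ≤ D + 1) (hq : q h) (hk : (kids T D h).Nonempty) :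
    ∃ s ∈ kids T D h, backup T D q leaf (s :: h) ≤ backup T D q leaf h := by
  have h1 := backup_of_nonempty (q := q) (leaf := leaf) hk
  rw [if_pos hq] at h1
  rcases (Finset.fold_min_le _).1 h1.ge with h2 | h2
  · obtain ⟨s, hs⟩ := hk
    exact ⟨s, hs, (backup_le hl _).trans h2⟩
  · exact h2

theorem backup_le_of_max {s : S} (hq : ¬ q h) (hs : s ∈ kids T D h) :
    backup T D q leaf (s :: h) ≤ backup T D q leaf h := by
  rw [backup_of_nonempty ⟨s, hs⟩, if_neg hq]
  exact Finset.le_sup (f := fun s => backup T D q leaf (s :: h)) hs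

theorem exists_le_backup_of_max (hq : ¬ q h) (hk : (kids T D h).Nonempty) :
    ∃ s ∈ kids T D h, backup T D q leaf h ≤ backup T D q leaf (s :: h) := by
  rw [backup_of_nonempty hk, if_neg hq]
  obtain ⟨s, hs, e⟩ := Finset.exists_mem_eq_sup _ hk fun s => backup T D q leaf (s :: h)
  exact ⟨s, hs, e.le⟩

/-- A maximal history of `T`, within the horizon of `D` moves. -/
def IsLeaf (T : List S → Prop) (D : ℕ) (h : List S) : Prop :=
  T h ∧ h.length ≤ D + 1 ∧ kids T D h = ∅

theorem IsLeaf.eq_of_suffix (hT : G.IsTree D T) {h h' : List S} (hh : IsLeaf T D h)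
    (hs : h <:+ h') (hT' : T h') (hl : h'.length ≤ D + 1) : h' = h := by
  obtain ⟨l, rfl⟩ := hs
  rcases List.eq_nil_or_concat l with rfl | ⟨l, s, rfl⟩
  · rfl
  · exfalso
    have h1 : T (s :: h) := hT.of_suffix hT' ⟨l, by simp⟩ (by simp)
    have h2 : s ∈ kids T D h := mem_kids.2 ⟨h1, by simp at hl; omega⟩
    rw [hh.2.2] at h2
    simp at h2

theorem isLeaf_outcome (hT : G.IsTree D T) (hσ : ∀ j, σ j ∈ G.Conform T j) :
    IsLeaf T D (G.outcome σ D) := by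
  refine ⟨(outcome_mem hT hσ D).1, length_outcome_le σ D, ?_⟩
  rw [Finset.eq_empty_iff_forall_notMem]
  intro t ht
  obtain ⟨h1, h2⟩ := mem_kids.1 ht
  have h3 := (length_outcome_or_stalled (G := G) σ D).resolve_left (by omega)
  have hp := isPlay_outcome (legal_of_conform hσ) D
  cases h : G.outcome σ D with
  | nil => rw [h] at hp; exact hp
  | cons s π =>
    rw [h] at hp h1 h3
    cases hs : σ (G.owner s) (s :: π) with
    | none =>
      exact notMem_edges_of_mem_strategies (hσ _).1 hp rfl hs t (isPlay_cons.1 (hT.isPlay h1)).1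
    | some s' =>
      rw [outcome_succ_of_some h hs] at h3
      simpa using congrArg List.length h3

theorem IsLeaf.eq_outcome (hT : G.IsTree D T) (hσ : ∀ j, σ j ∈ G.Conform T j) {h : List S}
    (hh : IsLeaf T D h) (hf : ∀ j, G.Follows (σ j) j h) : G.outcome σ D = h := by
  have h1 := isLeaf_outcome hT hσ
  rcases suffix_or_suffix_of_follows (hT.isPlay hh.1) (hT.isPlay h1.1) hf (outcome_mem hT hσ D).2
    with h2 | h2
  · exact hh.eq_of_suffix hT h2 h1.1 h1.2.1
  · exact (h1.eq_of_suffix hT h2 hh.1 hh.2.1).symm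

end Backup

end Arena
end RegretGame

namespace RegretGame
namespace Arena

variable {S : Type} [Fintype S] {G : Arena S} {i : Player} {σ : Player → Strat S}
variable {D : ℕ} {T : List S → Prop} {h : List S}

/-! ### The regret of a history -/

/-- The history ends in a position of Player `i`. -/
def Turn (G : Arena S) (i : Player) : List S → Prop
  | [] => False
  | s :: _ => G.owner s = i

/-- The least utility of Player `i` on an extension of `h` in `T`, if both players cooperate. -/
noncomputable def best (G : Arena S) (T : List S → Prop) (D : ℕ) (i : Player) : List S → ℕ :=
  backup T D (fun _ => True) (G.util (D + 1) i)

open Classical in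
/-- The least utility that Player `i` could have obtained in `T` by making, at one of her positions
along the history, another move than the one that she made. -/
noncomputable def dev (G : Arena S) (T : List S → Prop) (D : ℕ) (i : Player) : List S → ℕ
  | s' :: s :: π =>
    min (dev G T D i (s :: π))
      (if G.owner s = i then
        (Finset.univ.filter fun s'' => T (s'' :: s :: π) ∧ s'' ≠ s').fold min (D + 1)
          fun s'' => G.best T D i (s'' :: s :: π)
      else D + 1)
  | _ => D + 1

open Classical in
/-- The regret of Player `i` on a maximal history of `T`: her utility there, compared with what she
could have obtained by deviating. -/
noncomputable def leafVal (G : Arena S) (T : List S → Prop) (D : ℕ) (i : Player) (h : List S) : ℕ :=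
  if G.util (D + 1) i h ≤ D then G.util (D + 1) i h - G.dev T D i h else D + 1

/-- The regret that Player `i` can guarantee from the history `h` on. -/
noncomputable def val (G : Arena S) (T : List S → Prop) (D : ℕ) (i : Player) : List S → ℕ :=
  backup T D (G.Turn i) (G.leafVal T D i)

theorem dev_singleton (s : S) : G.dev T D i [s] = D + 1 := by rw [dev]; simp

theorem dev_le_succ (h : List S) : G.dev T D i h ≤ D + 1 := by
  induction h with
  | nil => rw [dev]; simp
  | cons s' h ih =>
    cases h with
    | nil => rw [dev_singleton]
    | cons s π => rw [dev]; exact (min_le_left _ _).trans ih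

theorem leafVal_le (h : List S) : G.leafVal T D i h ≤ D + 1 := by
  rw [leafVal]; split_ifs <;> omega

theorem val_le (h : List S) : G.val T D i h ≤ D + 1 := backup_le leafVal_le h

theorem best_cons_le {s : S} (hT : T (s :: h)) (hl : h.length ≤ D) :
    G.best T D i h ≤ G.best T D i (s :: h) :=
  backup_le_of_min trivial (mem_kids.2 ⟨hT, hl⟩)

theorem best_leaf (hh : IsLeaf T D h) : G.best T D i h = G.util (D + 1) i h :=
  backup_of_empty hh.2.2

theorem best_le_util {g : List S} (hT : G.IsTree D T) (hh : IsLeaf T D h) (hg : g <:+ h)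
    (hne : g ≠ []) : G.best T D i g ≤ G.util (D + 1) i h := by
  rw [← best_leaf hh]
  obtain ⟨l, rfl⟩ := hg
  have h1 := hh.1
  have h2 := hh.2.1
  clear hh
  induction l with
  | nil => exact le_rfl
  | cons s l ih =>
    have hne' : l ++ g ≠ [] := by simp [hne]
    simp only [List.cons_append, List.length_cons] at h1 h2 ⊢
    exact (ih (hT.of_suffix h1 (List.suffix_cons _ _) hne') (by omega)).trans
      (best_cons_le h1 (by omega))

theorem exists_best_cons_le {s : S} (hT : T (s :: h)) (hl : h.length ≤ D) :
    ∃ s', T (s' :: h) ∧ G.best T D i (s' :: h) ≤ G.best T D i h := by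
  obtain ⟨s', h1, h2⟩ := exists_backup_le_of_min (T := T) (D := D) (q := fun _ => True)
    (leaf := G.util (D + 1) i) (util_le (D + 1)) trivial ⟨s, mem_kids.2 ⟨hT, hl⟩⟩
  exact ⟨s', (mem_kids.1 h1).1, h2⟩

theorem dev_le_best {s' s'' s : S} {π : List S} (hh : (s' :: s :: π) <:+ h) (ho : G.owner s = i)
    (hT : T (s'' :: s :: π)) (hne : s'' ≠ s') : G.dev T D i h ≤ G.best T D i (s'' :: s :: π) := by
  classical
  induction h with
  | nil => simp at hh
  | cons t h ih =>
    rcases List.suffix_cons_iff.1 hh with e | hh'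
    · cases e
      rw [dev, min_le_iff]; right
      rw [if_pos ho, Finset.fold_min_le]
      exact Or.inr ⟨s'', by simp [hT, hne], le_rfl⟩
    · cases h with
      | nil => simp at hh'
      | cons u ρ => rw [dev]; exact (min_le_left _ _).trans (ih hh')

theorem exists_best_le_dev (hh : G.dev T D i h ≤ D) :
    ∃ s' s'' s π, (s' :: s :: π) <:+ h ∧ G.owner s = i ∧ T (s'' :: s :: π) ∧ s'' ≠ s' ∧
      G.best T D i (s'' :: s :: π) ≤ G.dev T D i h := by
  classical
  induction h with
  | nil => rw [dev] at hh <;> first | omega | simp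
  | cons t h ih =>
    cases h with
    | nil => rw [dev_singleton] at hh; omega
    | cons u ρ =>
      rcases le_total (G.dev T D i (u :: ρ)) (G.dev T D i (t :: u :: ρ)) with hle | hle
      · obtain ⟨s', s'', s, π, h1, h2, h3, h4, h5⟩ := ih (hle.trans hh)
        exact ⟨s', s'', s, π, h1.trans (List.suffix_cons _ _), h2, h3, h4, h5.trans hle⟩
      · by_cases hlt : G.dev T D i (u :: ρ) ≤ G.dev T D i (t :: u :: ρ)
        · obtain ⟨s', s'', s, π, h1, h2, h3, h4, h5⟩ := ih (hlt.trans hh)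
          exact ⟨s', s'', s, π, h1.trans (List.suffix_cons _ _), h2, h3, h4, h5.trans hlt⟩
        · have e := Arena.dev.eq_1 G T D i t u ρ
          have h6 := e.ge
          rw [min_le_iff] at h6
          have h7 := h6.resolve_left hlt
          split_ifs at h7 with ho
          · rcases (Finset.fold_min_le _).1 h7 with h8 | ⟨s'', h8, h9⟩
            · omega
            · simp only [Finset.mem_filter, Finset.mem_univ, true_and] at h8
              exact ⟨t, s'', u, ρ, List.suffix_refl _, ho, h8.1, h8.2, h9⟩
          · omega

/-! ### Regret in terms of maximal histories -/

variable {P : Player → Set (Strat S)}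

/-- There is a strategy, for both players, that leads to the history `h` and continues so as to
make the utility of Player `i` as small as possible. -/
theorem exists_toward (hT : G.IsTree D T) (i : Player) (hh : T h) :
    ∃ f : Strat S, (∀ j, f ∈ G.Conform T j) ∧
      (∀ s' s π, (s' :: s :: π) <:+ h → f (s :: π) = some s') ∧
      ∀ g s, T (s :: g) → g.length ≤ D → (∀ s', ¬ (s' :: g) <:+ h) →
        ∃ s', f g = some s' ∧ G.best T D i (s' :: g) ≤ G.best T D i g := by
  classical
  obtain ⟨f, hf1, hf2⟩ := hT.exists_strategy
    (fun g s => (∀ s', (s' :: g) <:+ h → s' = s) ∧ (g.length ≤ D → (∀ s', ¬ (s' :: g) <:+ h) →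
      G.best T D i (s :: g) ≤ G.best T D i g)) (by
    intro g s hs
    by_cases hc : ∃ s', (s' :: g) <:+ h
    · obtain ⟨s', hs'⟩ := hc
      refine ⟨s', hT.of_suffix hh hs' (by simp), ?_, fun _ hn => absurd hs' (hn s')⟩
      intro t ht
      have := List.suffix_of_suffix_length_le ht hs' (by simp)
      exact (List.cons.inj (this.eq_of_length (by simp))).1
    · push Not at hc
      by_cases hl : g.length ≤ D
      · obtain ⟨s', h1, h2⟩ := exists_best_cons_le (G := G) (i := i) hs hl
        exact ⟨s', h1, fun t ht => absurd ht (hc t), fun _ _ => h2⟩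
      · exact ⟨s, hs, fun t ht => absurd ht (hc t), fun h' => absurd h' hl⟩)
  refine ⟨f, hf1, ?_, ?_⟩
  · intro s' s π hs
    obtain ⟨t, e, -, h1, -⟩ := hf2 _ _ (hT.of_suffix hh hs (by simp))
    rw [e, h1 s' hs]
  · intro g s hs hl hn
    obtain ⟨t, e, -, -, h2⟩ := hf2 g s hs
    exact ⟨t, e, h2 hl hn⟩

/-- Against `b`, the regret on the outcome bounds the utility of `a` minus that of `a'`: if the two
outcomes differ, then they split at a position of Player `i`. -/
theorem min_util_dev_le (hT : G.IsTree D T) {a a' b : Strat S} (ha : a ∈ G.Conform T i)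
    (ha' : a' ∈ G.Conform T i) (hb : b ∈ G.Conform T i.other) :
    min (G.util (D + 1) i (G.outcome (pair i a b) D)) (G.dev T D i (G.outcome (pair i a b) D)) ≤
      G.util (D + 1) i (G.outcome (pair i a' b) D) := by
  have hc : ∀ j, pair i a b j ∈ G.Conform T j :=
    forall_pair (p := fun j f => f ∈ G.Conform T j) ha hb
  have hc' : ∀ j, pair i a' b j ∈ G.Conform T j :=
    forall_pair (p := fun j f => f ∈ G.Conform T j) ha' hb
  have l1 := isLeaf_outcome hT hc
  have l2 := isLeaf_outcome hT hc'
  have f1 := (outcome_mem hT hc D).2 i.other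
  have f2 := (outcome_mem hT hc' D).2 i.other
  rw [pair_other] at f1 f2
  generalize G.outcome (pair i a b) D = h at *
  generalize G.outcome (pair i a' b) D = h' at *
  rcases suffix_or_diverge (hT.isPlay l1.1) (hT.isPlay l2.1) with
    h1 | h1 | ⟨s', s'', s, π, hne, h1, h2⟩
  · rw [l1.eq_of_suffix hT h1 l2.1 l2.2.1]; exact min_le_left _ _
  · rw [l2.eq_of_suffix hT h1 l1.1 l1.2.1]; exact min_le_left _ _
  · rcases eq_or_eq_other i (G.owner s) with ho | ho
    · refine (min_le_right _ _).trans ?_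
      exact (dev_le_best h1 ho (hT.of_suffix l2.1 h2 (by simp)) hne.symm).trans
        (best_le_util hT l2 h2 (by simp))
    · have e1 := f1 _ _ _ h1 ho
      have e2 := f2 _ _ _ h2 ho
      rw [e1] at e2
      exact absurd (Option.some.inj e2) hne

/-- Every maximal history that is consistent with `a` is the outcome of `a` against some `b`, and
`b` can be chosen so that the best deviation from the history is available to Player `i`. -/
theorem exists_opponent (hT : G.IsTree D T) (hP : G.Describes T P) {a : Strat S} (ha : a ∈ P i)
    (hh : IsLeaf T D h) (hf : G.Follows a i h) :
    ∃ b ∈ P i.other, G.outcome (pair i a b) D = h ∧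
      (G.dev T D i h ≤ D → ∃ a' ∈ P i,
        G.util (D + 1) i (G.outcome (pair i a' b) D) ≤ G.dev T D i h) := by
  obtain ⟨b₀, hb₀, hb1, hb2⟩ := exists_toward hT i hh.1
  obtain ⟨b, hb, hbe⟩ := (hP i.other).2 b₀ (hb₀ _)
  have hfb : G.Follows b i.other h := by
    intro s' s π hs _
    rw [hbe _ (hT.of_suffix hh.1 ((List.suffix_cons _ _).trans hs) (by simp))]
    exact hb1 _ _ _ hs
  refine ⟨b, hb, hh.eq_outcome hT (hP.conform ha hb)
    (forall_pair (p := fun j f => G.Follows f j h) hf hfb), fun hd => ?_⟩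
  obtain ⟨s', s'', s, π, h1, h2, h3, h4, h5⟩ := exists_best_le_dev hd
  obtain ⟨a₀, ha₀, ha1, ha2⟩ := exists_toward hT i h3
  obtain ⟨a', ha', hae⟩ := (hP i).2 a₀ (ha₀ _)
  refine ⟨a', ha', le_trans ?_ h5⟩
  have hc := hP.conform ha' hb
  have l := isLeaf_outcome hT hc
  have fo := (outcome_mem hT hc D).2
  have foa := fo i
  have fob := fo i.other
  rw [pair_same] at foa
  rw [pair_other] at fob
  generalize hO : G.outcome (pair i a' b) D = h' at *
  have hlen : (s :: π).length ≤ D := by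
    have := h1.length_le
    have := hh.2.1
    simp only [List.length_cons] at *; omega
  -- the outcome goes through the deviation `s'' :: s :: π`
  have hfa : G.Follows a' i (s'' :: s :: π) := by
    intro t' t ρ ht _
    rw [hae _ (hT.of_suffix h3 ((List.suffix_cons _ _).trans ht) (by simp))]
    exact ha1 _ _ _ ht
  have hfb' : G.Follows b i.other (s'' :: s :: π) :=
    follows_cons.2 ⟨hfb.of_suffix ((List.suffix_cons _ _).trans h1), fun ho => by
      rw [h2] at ho; exact absurd ho.symm (other_ne i)⟩
  have hsuf : (s'' :: s :: π) <:+ h' := by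
    rcases suffix_or_suffix_of_follows (σ := pair i a' b) (hT.isPlay h3) (hT.isPlay l.1)
      (forall_pair (p := fun j f => G.Follows f j _) hfa hfb') fo with h6 | h6
    · exact h6
    · rw [l.eq_of_suffix hT h6 h3 (by simp only [List.length_cons] at *; omega)]
  -- and from there on both players cooperate
  have key : ∀ l : List S, (l ++ s'' :: s :: π) <:+ h' →
      G.best T D i (l ++ s'' :: s :: π) ≤ G.best T D i (s'' :: s :: π) := by
    intro l'
    induction l' with
    | nil => intro _; exact le_rfl
    | cons t l' ih =>
      intro hl'
      rw [List.cons_append] at hl'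
      refine le_trans ?_ (ih ((List.suffix_cons _ _).trans hl'))
      have hTt := hT.of_suffix l.1 hl' (by simp)
      have hTg := hT.of_suffix l.1 ((List.suffix_cons _ _).trans hl') (by simp)
      have hlt : (l' ++ s'' :: s :: π).length ≤ D := by
        have := hl'.length_le
        have := l.2.1
        simp only [List.length_cons] at *; omega
      obtain ⟨u, ρ, hu⟩ : ∃ u ρ, l' ++ s'' :: s :: π = u :: ρ := by
        cases l' with
        | nil => exact ⟨_, _, rfl⟩
        | cons u ρ => exact ⟨u, ρ ++ s'' :: s :: π, rfl⟩
      rw [List.cons_append, hu]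
      rw [hu] at hl' hTt hTg hlt
      have hsuf2 : (s'' :: s :: π) <:+ (u :: ρ) := ⟨l', hu⟩
      rcases eq_or_eq_other i (G.owner u) with ho | ho
      · obtain ⟨t', e, hle⟩ := ha2 (u :: ρ) t hTt hlt (fun t' ht' => by
          have := ht'.length_le
          have := hsuf2.length_le
          simp only [List.length_cons] at *; omega)
        have e2 := foa _ _ _ hl' ho
        rw [hae _ hTg, e] at e2
        cases e2; exact hle
      · obtain ⟨t', e, hle⟩ := hb2 (u :: ρ) t hTt hlt (fun t' ht' => by
          have h7 : (s'' :: s :: π) <:+ h := hsuf2.trans ((List.suffix_cons _ _).trans ht')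
          have := List.suffix_of_suffix_length_le h7 h1 (by simp)
          exact h4 (List.cons.inj (this.eq_of_length (by simp))).1)
        have e2 := fob _ _ _ hl' ho
        rw [hbe _ hTg, e] at e2
        cases e2; exact hle
  obtain ⟨l', hl'⟩ := hsuf
  have := key l' (by rw [hl'])
  rw [hl', best_leaf l] at this
  exact this

/-- The strategies of finite utility at most `D` with regret at most `r` are those for which every
consistent maximal history has regret at most `r`. -/
theorem regretOf_le_iff_leafVal (hpos : G.Positive) (hT : G.IsTree D T) (hP : G.Describes T P)
    {a : Strat S} (ha : a ∈ P i) {r : ℕ} (hr : r ≤ D) :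
    (G.regretOf P i a ≤ r ∧ ∀ b ∈ P i.other, G.utility i (pair i a b) ≤ D) ↔
      ∀ h, IsLeaf T D h → G.Follows a i h → G.leafVal T D i h ≤ r := by
  constructor
  · rintro ⟨h1, h2⟩ h hh hf
    obtain ⟨b, hb, rfl, hd⟩ := exists_opponent hT hP ha hh hf
    have hL := legal_of_conform (hP.conform ha hb)
    have h3 := (utility_le_iff_util hpos hL le_rfl).1 (h2 b hb)
    rw [leafVal, if_pos h3]
    by_cases hD : G.dev T D i (G.outcome (pair i a b) D) ≤ D
    · obtain ⟨a', ha', hle⟩ := hd hD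
      have hL' := legal_of_conform (hP.conform ha' hb)
      have h4 := regretOf_le_iff.1 h1 b hb
      have h5 := utility_eq_util hpos hL h3
      rw [regretAgainst, if_neg (by rw [h5]; exact ENat.natCast_ne_top _), h5,
        tsub_le_iff_right] at h4
      have h6 : G.bestResponse P i b ≤ (G.dev T D i (G.outcome (pair i a b) D) : ℕ∞) :=
        (iInf₂_le a' ha').trans ((utility_le_iff_util hpos hL' hD).2 hle)
      have h7 := h4.trans (add_le_add_right h6 _)
      rw [tsub_le_iff_right]
      exact_mod_cast h7
    · omega
  · intro H
    have key : ∀ b ∈ P i.other, G.util (D + 1) i (G.outcome (pair i a b) D) ≤ D ∧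
        G.util (D + 1) i (G.outcome (pair i a b) D) -
          G.dev T D i (G.outcome (pair i a b) D) ≤ r := by
      intro b hb
      have hc := hP.conform ha hb
      have fo := (outcome_mem hT hc D).2 i
      rw [pair_same] at fo
      have := H _ (isLeaf_outcome hT hc) fo
      rw [leafVal] at this
      split_ifs at this with h1
      · exact ⟨h1, this⟩
      · omega
    refine ⟨regretOf_le_iff.2 fun b hb => ?_, fun b hb =>
      (utility_le_iff_util hpos (legal_of_conform (hP.conform ha hb)) le_rfl).2 (key b hb).1⟩
    obtain ⟨h1, h2⟩ := key b hb
    have h5 := utility_eq_util hpos (legal_of_conform (hP.conform ha hb)) h1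
    rw [regretAgainst, if_neg (by rw [h5]; exact ENat.natCast_ne_top _), h5, tsub_le_iff_left,
      bestResponse]
    simp only [ENat.iInf_add]
    refine le_iInf₂ fun a' ha' => ?_
    have hL' := legal_of_conform (hP.conform ha' hb)
    have h6 := min_util_dev_le hT ((hP i).1 a ha) ((hP i).1 a' ha') ((hP i.other).1 b hb)
    rcases lt_or_ge (D : ℕ∞) (G.utility i (pair i a' b)) with h7 | h7
    · refine le_add_right (le_trans ?_ h7.le)
      exact_mod_cast h1
    · have h8 := utility_eq_util hpos hL' ((utility_le_iff_util hpos hL' le_rfl).1 h7)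
      rw [h8]
      have : G.util (D + 1) i (G.outcome (pair i a b) D) ≤
          G.util (D + 1) i (G.outcome (pair i a' b) D) + r := by
        rcases min_le_iff.1 h6 with h9 | h9 <;> omega
      exact_mod_cast this

end Arena
end RegretGame

namespace RegretGame
namespace Arena

variable {S : Type} [Fintype S] {G : Arena S} {i : Player} {σ : Player → Strat S}
variable {D : ℕ} {T : List S → Prop} {h : List S} {P : Player → Set (Strat S)}

/-! ### Optimal strategies -/

theorem val_of_isLeaf (hh : IsLeaf T D h) : G.val T D i h = G.leafVal T D i h :=
  backup_of_empty hh.2.2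

theorem val_cons_le {s s' : S} {π : List S} (hT : T (s' :: s :: π)) (hl : (s :: π).length ≤ D)
    (ho : G.owner s ≠ i) : G.val T D i (s' :: s :: π) ≤ G.val T D i (s :: π) :=
  backup_le_of_max (q := G.Turn i) ho (mem_kids.2 ⟨hT, hl⟩)

theorem exists_val_cons_le {s s' : S} {π : List S} (hT : T (s' :: s :: π))
    (hl : (s :: π).length ≤ D) (ho : G.owner s = i) :
    ∃ t, T (t :: s :: π) ∧ G.val T D i (t :: s :: π) ≤ G.val T D i (s :: π) := by
  obtain ⟨t, h1, h2⟩ := exists_backup_le_of_min (q := G.Turn i) (leaf := G.leafVal T D i)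
    (h := s :: π) leafVal_le ho ⟨s', mem_kids.2 ⟨hT, hl⟩⟩
  exact ⟨t, (mem_kids.1 h1).1, h2⟩

/-- A strategy that, for Player `i`, never makes the guaranteed regret larger. -/
theorem exists_greedy (hT : G.IsTree D T) (i : Player) :
    ∃ f : Strat S, (∀ j, f ∈ G.Conform T j) ∧
      ∀ s s' π, T (s' :: s :: π) → (s :: π).length ≤ D → G.owner s = i →
        ∃ t, f (s :: π) = some t ∧ T (t :: s :: π) ∧
          G.val T D i (t :: s :: π) ≤ G.val T D i (s :: π) := by
  obtain ⟨f, hf1, hf2⟩ := hT.exists_strategy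
    (fun g s => g.length ≤ D → G.Turn i g → G.val T D i (s :: g) ≤ G.val T D i g) (by
    intro g s hs
    by_cases hc : g.length ≤ D ∧ G.Turn i g
    · cases g with
      | nil => exact hc.2.elim
      | cons u π =>
        obtain ⟨t, h1, h2⟩ := exists_val_cons_le (G := G) hs hc.1 hc.2
        exact ⟨t, h1, fun _ _ => h2⟩
    · exact ⟨s, hs, fun h1 h2 => absurd ⟨h1, h2⟩ hc⟩)
  refine ⟨f, hf1, fun s s' π hs hl ho => ?_⟩
  obtain ⟨t, e, h1, h2⟩ := hf2 _ _ hs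
  exact ⟨t, e, h1, h2 hl ho⟩

/-- Whatever Player `i` does, her opponent can steer to a maximal history of regret at least the
value of the current one. -/
theorem exists_isLeaf_val_le (hT : G.IsTree D T) {a : Strat S} (ha : a ∈ G.Conform T i)
    (hh : T h) (hl : h.length ≤ D + 1) (hf : G.Follows a i h) :
    ∃ h', IsLeaf T D h' ∧ G.Follows a i h' ∧ G.val T D i h ≤ G.leafVal T D i h' := by
  induction hk : D + 1 - h.length generalizing h with
  | zero =>
    have hle : IsLeaf T D h := ⟨hh, hl, by
      rw [Finset.eq_empty_iff_forall_notMem]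
      intro s hs
      have := (mem_kids.1 hs).2
      omega⟩
    exact ⟨h, hle, hf, (val_of_isLeaf hle).le⟩
  | succ k ih =>
    rcases Finset.eq_empty_or_nonempty (kids T D h) with he | hne
    · have hle : IsLeaf T D h := ⟨hh, hl, he⟩
      exact ⟨h, hle, hf, (val_of_isLeaf hle).le⟩
    · have hne' := hne
      obtain ⟨s', hs'⟩ := hne'
      obtain ⟨hs', hl'⟩ := mem_kids.1 hs'
      have hp := hT.isPlay hh
      obtain ⟨s, π, rfl⟩ : ∃ s π, h = s :: π := by
        cases h with
        | nil => exact hp.elim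
        | cons s π => exact ⟨s, π, rfl⟩
      have step : ∃ t, T (t :: s :: π) ∧ G.Follows a i (t :: s :: π) ∧
          G.val T D i (s :: π) ≤ G.val T D i (t :: s :: π) := by
        by_cases ho : G.owner s = i
        · cases he : a (s :: π) with
          | none =>
            exact absurd (isPlay_cons.1 (hT.isPlay hs')).1
              (notMem_edges_of_mem_strategies ha.1 hp ho he s')
          | some t =>
            have hTt := ha.2 _ _ _ hh ho hf he
            exact ⟨t, hTt, follows_cons.2 ⟨hf, fun _ => he⟩,
              backup_le_of_min (q := G.Turn i) ho (mem_kids.2 ⟨hTt, hl'⟩)⟩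
        · obtain ⟨t, h1, h2⟩ := exists_le_backup_of_max (q := G.Turn i) (leaf := G.leafVal T D i)
            (h := s :: π) ho hne
          exact ⟨t, (mem_kids.1 h1).1, follows_cons.2 ⟨hf, fun h => absurd h ho⟩, h2⟩
      obtain ⟨t, h1, h2, h3⟩ := step
      obtain ⟨h', h4, h5, h6⟩ := ih h1 (by simp only [List.length_cons] at *; omega) h2
        (by simp only [List.length_cons] at *; omega)
      exact ⟨h', h4, h5, h3.trans h6⟩

theorem forall_leafVal_le_iff (hT : G.IsTree D T) {a : Strat S} (ha : a ∈ G.Conform T i) {r : ℕ} :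
    (∀ h, IsLeaf T D h → G.Follows a i h → G.leafVal T D i h ≤ r) ↔
      ∀ h, T h → h.length ≤ D + 1 → G.Follows a i h → G.val T D i h ≤ r := by
  constructor
  · intro H h hh hl hf
    obtain ⟨h', h1, h2, h3⟩ := exists_isLeaf_val_le hT ha hh hl hf
    exact h3.trans (H h' h1 h2)
  · intro H h hh hf
    rw [← val_of_isLeaf hh]
    exact H h hh.1 hh.2.1 hf

theorem Describes.nonempty (hT : G.IsTree D T) (hP : G.Describes T P) (i : Player) :
    (P i).Nonempty := by
  obtain ⟨f, hf, -⟩ := exists_greedy hT i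
  obtain ⟨f', hf', -⟩ := (hP i).2 f (hf i)
  exact ⟨f', hf'⟩

/-- If a strategy moves greedily where it is not known to stay below the value of the root, then it
stays below. -/
theorem val_le_of_greedy (hT : G.IsTree D T) {a : Strat S}
    (ha : ∀ s s' π, T (s' :: s :: π) → (s :: π).length ≤ D → G.owner s = i →
      G.Follows a i (s :: π) → G.val T D i (s :: π) ≤ G.val T D i [G.init] →
        a (s :: π) = some s' → G.val T D i (s' :: s :: π) ≤ G.val T D i [G.init])
    (hh : T h) (hl : h.length ≤ D + 1) (hf : G.Follows a i h) :
    G.val T D i h ≤ G.val T D i [G.init] := by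
  induction h with
  | nil => exact absurd rfl (hT.isPlay hh).ne_nil
  | cons s' h ih =>
    cases h with
    | nil => rw [isPlay_singleton.1 (hT.isPlay hh)]
    | cons s π =>
      simp only [List.length_cons] at hl
      obtain ⟨hf1, hf2⟩ := follows_cons.1 hf
      have h1 := ih (hT.parent hh) (by simp only [List.length_cons]; omega) hf1
      have hl' : (s :: π).length ≤ D := by simp only [List.length_cons]; omega
      by_cases ho : G.owner s = i
      · exact ha _ _ _ hh hl' ho hf1 h1 (hf2 ho)
      · exact (val_cons_le hh hl' ho).trans h1

theorem exists_val_le (hT : G.IsTree D T) (hP : G.Describes T P) (i : Player) :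
    ∃ a ∈ P i, ∀ h, T h → h.length ≤ D + 1 → G.Follows a i h →
      G.val T D i h ≤ G.val T D i [G.init] := by
  obtain ⟨f, hf, hg⟩ := exists_greedy hT i
  obtain ⟨a, ha, hae⟩ := (hP i).2 f (hf i)
  refine ⟨a, ha, fun h hh hl hfo => val_le_of_greedy hT ?_ hh hl hfo⟩
  intro s s' π hs hl ho _ hv e
  obtain ⟨t, e', -, h2⟩ := hg s s' π hs hl ho
  rw [hae _ (hT.parent hs), e'] at e
  cases e
  exact h2.trans hv

/-- Optimal strategies have finite utilities, of at most `D`, unless the regret is infinite. -/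
def Bounded (G : Arena S) (P : Player → Set (Strat S)) (D : ℕ) (i : Player) : Prop :=
  G.regret P i ≠ ⊤ → ∀ a ∈ P i, G.regret P i = G.regretOf P i a →
    ∀ b ∈ P i.other, G.utility i (pair i a b) ≤ D

/-- The extended natural number that is represented by a number capped at `D + 1`. -/
noncomputable def uncap (D v : ℕ) : ℕ∞ := if v ≤ D then (v : ℕ∞) else ⊤

omit [Fintype S] in
theorem regretOf_le_of_utility_le {a : Strat S}
    (ha : ∀ b ∈ P i.other, G.utility i (pair i a b) ≤ D) : G.regretOf P i a ≤ D := by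
  refine regretOf_le_iff.2 fun b hb => ?_
  rw [regretAgainst, if_neg (ne_top_of_le_ne_top (ENat.natCast_ne_top _) (ha b hb))]
  exact tsub_le_self.trans (ha b hb)

omit [Fintype S] in
theorem exists_regretOf_eq (hne : (P i).Nonempty) : ∃ a ∈ P i, G.regret P i = G.regretOf P i a := by
  have : Nonempty (P i) := hne.to_subtype
  have h2 := ciInf_mem fun a : P i => G.regretOf P i a
  obtain ⟨a, ha⟩ := h2
  refine ⟨a, a.2, ?_⟩
  rw [regret, ← iInf_subtype'' , ← ha]

/-- The regret is the value of backward induction at the root: a strategy that keeps the value low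
exists, and no strategy can force a smaller one. -/
theorem regret_eq_uncap (hpos : G.Positive) (hT : G.IsTree D T) (hP : G.Describes T P)
    (hB : G.Bounded P D i) : G.regret P i = uncap D (G.val T D i [G.init]) := by
  obtain ⟨a, ha, hr⟩ := exists_regretOf_eq (G := G) (hP.nonempty hT i)
  -- a finite regret is at least the value of the root
  have lower : ∀ r : ℕ, r ≤ D → G.regret P i = r → G.val T D i [G.init] ≤ r := by
    intro r hrD hre
    have h1 := (regretOf_le_iff_leafVal hpos hT hP ha hrD).1
      ⟨by rw [← hr, hre], hB (by rw [hre]; exact ENat.natCast_ne_top _) a ha hr⟩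
    exact (forall_leafVal_le_iff hT ((hP i).1 a ha)).1 h1 _ hT.init (by simp)
      (follows_singleton _ _)
  have fin : G.regret P i ≠ ⊤ → ∃ r : ℕ, r ≤ D ∧ G.regret P i = r := by
    intro hne
    have h1 := regretOf_le_of_utility_le (hB hne a ha hr)
    rw [← hr] at h1
    obtain ⟨r, hr'⟩ := ENat.ne_top_iff_exists.1 hne
    rw [← hr', Nat.cast_le] at h1
    exact ⟨r, h1, hr'.symm⟩
  rw [uncap]
  split_ifs with hv
  · obtain ⟨a', ha', hv'⟩ := exists_val_le hT hP i
    have h1 := ((regretOf_le_iff_leafVal hpos hT hP ha' hv).2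
      ((forall_leafVal_le_iff hT ((hP i).1 a' ha')).2 hv')).1
    have h2 : G.regret P i ≤ (G.val T D i [G.init] : ℕ) := (iInf₂_le a' ha').trans h1
    obtain ⟨r, hrD, hre⟩ := fin (ne_top_of_le_ne_top (ENat.natCast_ne_top _) h2)
    refine le_antisymm h2 ?_
    rw [hre]
    exact_mod_cast lower r hrD hre
  · by_contra hne
    obtain ⟨r, hrD, hre⟩ := fin hne
    have := lower r hrD hre
    omega

/-- The optimal strategies are those that never lead to a larger value than that of the root. -/
theorem regret_eq_regretOf_iff (hpos : G.Positive) (hT : G.IsTree D T) (hP : G.Describes T P)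
    (hB : G.Bounded P D i) {a : Strat S} (ha : a ∈ P i) :
    G.regret P i = G.regretOf P i a ↔
      ∀ h, T h → h.length ≤ D + 1 → G.Follows a i h → G.val T D i h ≤ G.val T D i [G.init] := by
  have hR := regret_eq_uncap hpos hT hP hB
  have hle : G.regret P i ≤ G.regretOf P i a := iInf₂_le a ha
  by_cases hv : G.val T D i [G.init] ≤ D
  · rw [uncap, if_pos hv] at hR
    rw [← forall_leafVal_le_iff hT ((hP i).1 a ha), ← regretOf_le_iff_leafVal hpos hT hP ha hv]
    constructor
    · intro e
      exact ⟨by rw [← e, hR], hB (by rw [hR]; exact ENat.natCast_ne_top _) a ha e⟩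
    · rintro ⟨h1, -⟩
      exact le_antisymm hle (by rw [hR]; exact h1)
  · rw [uncap, if_neg hv] at hR
    rw [hR] at hle ⊢
    refine ⟨fun _ h _ _ _ => (val_le h).trans (by omega), fun _ => (top_le_iff.1 hle).symm⟩

/-! ### Pruning -/

/-- The histories of `T` that remain when both players keep only their strategies of least
regret. -/
def prune (G : Arena S) (D : ℕ) (T : List S → Prop) : List S → Prop
  | [] => False
  | [s] => T [s]
  | s' :: s :: π => T (s' :: s :: π) ∧ prune G D T (s :: π) ∧
      ((s' :: s :: π).length ≤ D + 1 → ∀ i, G.val T D i (s' :: s :: π) ≤ G.val T D i [G.init])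

theorem prune_cons {s' s : S} {π : List S} :
    G.prune D T (s' :: s :: π) ↔ T (s' :: s :: π) ∧ G.prune D T (s :: π) ∧
      ((s' :: s :: π).length ≤ D + 1 →
        ∀ i, G.val T D i (s' :: s :: π) ≤ G.val T D i [G.init]) := by
  rw [prune]

theorem prune_le (hh : G.prune D T h) : T h := by
  cases h with
  | nil => exact hh.elim
  | cons s' h =>
    cases h with
    | nil => rwa [prune] at hh
    | cons s π => exact (prune_cons.1 hh).1

theorem val_le_of_prune (hT : G.IsTree D T) (hh : G.prune D T h) (hl : h.length ≤ D + 1)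
    (i : Player) : G.val T D i h ≤ G.val T D i [G.init] := by
  cases h with
  | nil => exact hh.elim
  | cons s' h =>
    cases h with
    | nil => rw [isPlay_singleton.1 (hT.isPlay (prune_le hh))]
    | cons s π => exact (prune_cons.1 hh).2.2 hl i

theorem isTree_prune (hT : G.IsTree D T) : G.IsTree D (G.prune D T) where
  isPlay h := hT.isPlay (prune_le h)
  init := by rw [prune]; exact hT.init
  parent h := (prune_cons.1 h).2.1
  child := by
    intro s π s' hh he
    obtain ⟨t, ht⟩ := hT.child (prune_le hh) he
    by_cases hl : (s :: π).length ≤ D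
    · obtain ⟨u, hu, hv⟩ := exists_val_cons_le (G := G) ht hl rfl
      refine ⟨u, prune_cons.2 ⟨hu, hh, fun hl' j => ?_⟩⟩
      refine le_trans ?_ (val_le_of_prune hT hh (by omega) j)
      by_cases ho : G.owner s = j
      · subst ho; exact hv
      · exact val_cons_le hu hl ho
    · exact ⟨t, prune_cons.2 ⟨ht, hh, fun hl' => by simp only [List.length_cons] at *; omega⟩⟩
  free := by
    intro s π s' hh hl he
    exact prune_cons.2 ⟨hT.free (prune_le hh) hl he, hh, fun hl' => by
      simp only [List.length_cons] at *; omega⟩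

/-- One step of the iteration: deleting the strategies that do not minimize regret amounts to
pruning the tree. -/
theorem Describes.delete (hpos : G.Positive) (hT : G.IsTree D T) (hP : G.Describes T P)
    (hB : ∀ i, G.Bounded P D i) : G.Describes (G.prune D T) (G.delete P) := by
  classical
  have mem : ∀ i a, a ∈ G.delete P i ↔ a ∈ P i ∧ ∀ h, T h → h.length ≤ D + 1 → G.Follows a i h →
      G.val T D i h ≤ G.val T D i [G.init] := by
    intro i a
    constructor
    · rintro ⟨h1, h2⟩
      exact ⟨h1, (regret_eq_regretOf_iff hpos hT hP (hB i) h1).1 h2⟩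
    · rintro ⟨h1, h2⟩
      exact ⟨h1, (regret_eq_regretOf_iff hpos hT hP (hB i) h1).2 h2⟩
  intro i
  constructor
  · intro f hf
    obtain ⟨h1, h2⟩ := (mem i f).1 hf
    obtain ⟨h3, h4⟩ := (hP i).1 f h1
    refine ⟨h3, fun s π s' hs ho hfo e => ?_⟩
    have hTs := h4 s π s' (prune_le hs) ho hfo e
    refine prune_cons.2 ⟨hTs, hs, fun hl j => ?_⟩
    by_cases hj : G.owner s = j
    · rw [ho] at hj; subst hj
      exact h2 _ hTs hl (follows_cons.2 ⟨hfo, fun _ => e⟩)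
    · have hl' : (s :: π).length ≤ D := by simp only [List.length_cons] at *; omega
      exact (val_cons_le hTs hl' hj).trans (val_le_of_prune hT hs (by omega) j)
  · intro f hf
    obtain ⟨g, hg1, hg2⟩ := exists_greedy hT i
    -- follow `f` in the pruned tree, and move greedily outside of it
    let f₂ : Strat S := fun h => if G.prune D T h then f h else g h
    have hsuf : ∀ h, G.prune D T h → G.Follows f₂ i h → G.Follows f i h := by
      intro h hh hfo s' s π hs ho
      rw [← hfo s' s π hs ho]
      exact (if_pos ((isTree_prune hT).of_suffix hh ((List.suffix_cons _ _).trans hs)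
        (by simp))).symm
    have hf₂ : f₂ ∈ G.Conform T i := by
      constructor
      · intro s π hp ho
        by_cases hc : G.prune D T (s :: π)
        · have := hf.1 s π hp ho
          simpa only [f₂, if_pos hc] using this
        · have := (hg1 i).1 s π hp ho
          simpa only [f₂, if_neg hc] using this
      · intro s π s' hs ho hfo e
        by_cases hc : G.prune D T (s :: π)
        · simp only [f₂, if_pos hc] at e
          exact prune_le (hf.2 s π s' hc ho (hsuf _ hc hfo) e)
        · simp only [f₂, if_neg hc] at e
          by_cases hk : ∃ t, T (t :: s :: π) ∧ (s :: π).length ≤ D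
          · obtain ⟨t, ht, hl⟩ := hk
            obtain ⟨u, e', hu, -⟩ := hg2 s t π ht hl ho
            rw [e] at e'; cases e'; exact hu
          · have he := mem_edges_of_mem_strategies (hg1 i).1 (hT.isPlay hs) ho e
            obtain ⟨t, ht⟩ := hT.child hs he
            exact hT.free hs (by by_contra hl; exact hk ⟨t, ht, by omega⟩) he
    obtain ⟨f', hf', hfe⟩ := (hP i).2 f₂ hf₂
    refine ⟨f', (mem i f').2 ⟨hf', ?_⟩, fun h hh => ?_⟩
    · have key := fun h => val_le_of_greedy (h := h) hT (a := f₂) (i := i) (by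
        intro s s' π hh hl ho hf1 h1 e
        by_cases hc : G.prune D T (s :: π)
        · simp only [f₂, if_pos hc] at e
          exact val_le_of_prune hT (hf.2 s π s' hc ho (hsuf _ hc hf1) e)
            (by simp only [List.length_cons] at *; omega) i
        · simp only [f₂, if_neg hc] at e
          obtain ⟨u, e', -, hv⟩ := hg2 s s' π hh hl ho
          rw [e] at e'; cases e'
          exact hv.trans h1)
      intro h hh hl hfo
      refine key h hh hl (hfo.congr fun s' s π hs => (hfe _ (hT.of_suffix hh
        ((List.suffix_cons _ _).trans hs) (by simp))).symm)
    · rw [hfe h (prune_le hh)]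
      exact if_pos hh

end Arena
end RegretGame

namespace RegretGame
namespace Arena

variable {S : Type} [Fintype S] {G : Arena S} {i : Player} {σ : Player → Strat S}
variable {D : ℕ} {T : List S → Prop} {h : List S} {P : Player → Set (Strat S)}

/-! ### Attractors and bounds on utilities -/

/-- The positions from which Player `i` can force a visit to her target within `k` moves. -/
def attr (G : Arena S) (i : Player) : ℕ → Set S
  | 0 => {s | s ∈ G.target i}
  | k + 1 => attr G i k ∪
      {s | (G.owner s = i ∧ ∃ s', (s, s') ∈ G.edges ∧ s' ∈ attr G i k) ∨
        (G.owner s ≠ i ∧ (∃ s', (s, s') ∈ G.edges) ∧ ∀ s', (s, s') ∈ G.edges → s' ∈ attr G i k)}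

omit [Fintype S] in
theorem attr_subset_succ (k : ℕ) : G.attr i k ⊆ G.attr i (k + 1) := by
  rw [attr.eq_2]; exact Set.subset_union_left

omit [Fintype S] in
theorem attr_mono : Monotone (G.attr i) := monotone_nat_of_le_succ attr_subset_succ

omit [Fintype S] in
theorem step_of_mem_attr {s : S} {k : ℕ} (hs : s ∈ G.attr i (k + 1)) (ht : s ∉ G.target i) :
    (∃ s', (s, s') ∈ G.edges) ∧ (G.owner s = i → ∃ s', (s, s') ∈ G.edges ∧ s' ∈ G.attr i k) ∧
      (G.owner s ≠ i → ∀ s', (s, s') ∈ G.edges → s' ∈ G.attr i k) := by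
  induction k with
  | zero =>
    rw [attr] at hs
    rcases hs with hs | ⟨ho, s', h1, h2⟩ | ⟨ho, h1, h2⟩
    · exact absurd hs ht
    · exact ⟨⟨s', h1⟩, fun _ => ⟨s', h1, h2⟩, fun h => absurd ho h⟩
    · exact ⟨h1, fun h => absurd h ho, fun _ => h2⟩
  | succ k ih =>
    rw [attr] at hs
    rcases hs with hs | ⟨ho, s', h1, h2⟩ | ⟨ho, h1, h2⟩
    · obtain ⟨h1, h2, h3⟩ := ih hs
      refine ⟨h1, fun h => ?_, fun h s' he => attr_subset_succ k (h3 h s' he)⟩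
      obtain ⟨s', h4, h5⟩ := h2 h
      exact ⟨s', h4, attr_subset_succ k h5⟩
    · exact ⟨⟨s', h1⟩, fun _ => ⟨s', h1, h2⟩, fun h => absurd ho h⟩
    · exact ⟨h1, fun h => absurd h ho, fun _ => h2⟩

theorem attr_card_stable : G.attr i (Fintype.card S + 1) = G.attr i (Fintype.card S) := by
  have hfin : ∀ A : Set S, A.Finite := fun A => Set.toFinite A
  have eq_of : ∀ m, (G.attr i m).ncard = (G.attr i (m + 1)).ncard →
      G.attr i m = G.attr i (m + 1) := fun m hm =>
    Set.eq_of_subset_of_ncard_le (attr_subset_succ m) hm.ge (hfin _)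
  have h1 := Nat.stabilises_of_monotone (f := fun m => (G.attr i m).ncard)
    (b := Fintype.card S) (n := Fintype.card S + 1)
    (fun a b hab => Set.ncard_le_ncard (attr_mono hab) (hfin _))
    (fun m => by
      rw [← Nat.card_eq_fintype_card]
      exact Set.ncard_le_card _)
    (fun m hm => by
      have h2 := eq_of m hm
      have h3 : G.attr i (m + 1) = G.attr i (m + 1 + 1) := by
        rw [attr.eq_2 G i (m + 1), ← h2, ← attr.eq_2, h2]
      exact congrArg Set.ncard h3)
    (Nat.le_succ _)
  exact (eq_of _ h1.symm).symm

/-- Outside of the full attractor, the opponent can stay outside. -/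
theorem of_notMem_attr {s : S} (hs : s ∉ G.attr i (Fintype.card S)) :
    (G.owner s = i → ∀ s', (s, s') ∈ G.edges → s' ∉ G.attr i (Fintype.card S)) ∧
      (G.owner s ≠ i → (∃ s', (s, s') ∈ G.edges) →
        ∃ s', (s, s') ∈ G.edges ∧ s' ∉ G.attr i (Fintype.card S)) := by
  rw [← attr_card_stable, attr] at hs
  constructor
  · intro ho s' he hm
    exact hs (Or.inr (Or.inl ⟨ho, s', he, hm⟩))
  · intro ho hex
    by_contra hcon
    push Not at hcon
    exact hs (Or.inr (Or.inr ⟨ho, hex, hcon⟩))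

omit [Fintype S] in
theorem notMem_edges_of_stalled (hσ : G.Legal σ) {k : ℕ}
    (hk : G.outcome σ (k + 1) = G.outcome σ k) {s : S} {π : List S}
    (h : G.outcome σ k = s :: π) (s' : S) : (s, s') ∉ G.edges := by
  have hp := isPlay_outcome hσ k
  rw [h] at hp hk
  cases hs : σ (G.owner s) (s :: π) with
  | none => exact notMem_edges_of_mem_strategies (hσ _) hp rfl hs s'
  | some t =>
    rw [outcome_succ_of_some h hs] at hk
    simpa using congrArg List.length hk

omit [Fintype S] in
theorem exists_atTarget (hu : G.utility i σ ≠ ⊤) : ∃ k, G.AtTarget i σ k := by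
  by_contra hcon
  exact hu (by rw [utility, dif_neg hcon])

omit [Fintype S] in
theorem AtTarget.exists_mem {k : ℕ} (hk : G.AtTarget i σ k) :
    ∃ s ∈ G.outcome σ k, s ∈ G.target i := by
  obtain ⟨s, hs, h⟩ := hk
  exact ⟨s, List.mem_of_mem_head? h, hs⟩

/-- The moves of Player `i` are not pruned in the histories of more than `L` positions. -/
def FreeFor (G : Arena S) (T : List S → Prop) (i : Player) (L : ℕ) : Prop :=
  ∀ s π s', T (s :: π) → G.owner s = i → L < (s :: π).length → (s, s') ∈ G.edges →
    T (s' :: s :: π)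

/-- If the tree `T` is unpruned after `L` moves, a strategy that wins the reachability objective of
Player `i` leads to the attractor of her target. -/
theorem mem_attr_of_winning (hT : G.IsTree D T) (hP : G.Describes T P) {L : ℕ}
    (hfree : G.FreeFor T i.other L) {a : Strat S} (ha : a ∈ P i)
    (hfin : ∀ b ∈ P i.other, G.utility i (pair i a b) ≠ ⊤) {s : S} {π : List S} (hh : T (s :: π))
    (hl : (s :: π).length = L + 1) (hf : G.Follows a i (s :: π))
    (hno : ∀ x ∈ s :: π, x ∉ G.target i) : s ∈ G.attr i (Fintype.card S) := by
  classical
  by_contra hs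
  -- the opponent plays towards `s :: π`, and from there on avoids the attractor
  obtain ⟨b₀, hb₀, hb1⟩ := hT.exists_strategy
    (fun g t => (∀ s', (s' :: g) <:+ (s :: π) → s' = t) ∧ (L < g.length →
      ∀ u ρ, g = u :: ρ → G.owner u = i.other → u ∉ G.attr i (Fintype.card S) →
        t ∉ G.attr i (Fintype.card S))) (by
    intro g t ht
    by_cases hc : ∃ s', (s' :: g) <:+ (s :: π)
    · obtain ⟨s', hs'⟩ := hc
      refine ⟨s', hT.of_suffix hh hs' (by simp), fun t' ht' => ?_, fun hlt => ?_⟩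
      · have := List.suffix_of_suffix_length_le ht' hs' (by simp)
        exact (List.cons.inj (this.eq_of_length (by simp))).1
      · have := hs'.length_le
        simp only [List.length_cons] at *; omega
    · push Not at hc
      by_cases hu : L < g.length ∧ ∃ u ρ, g = u :: ρ ∧ G.owner u = i.other ∧
          u ∉ G.attr i (Fintype.card S)
      · obtain ⟨hlt, u, ρ, rfl, ho, hu⟩ := hu
        have hTg := hT.parent ht
        have he := (isPlay_cons.1 (hT.isPlay ht)).1
        obtain ⟨t', he', ht'⟩ := (of_notMem_attr hu).2 (by rw [ho]; exact other_ne i) ⟨t, he⟩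
        exact ⟨t', hfree u ρ t' hTg ho hlt he', fun s' h => absurd h (hc s'),
          fun _ _ _ _ _ _ => ht'⟩
      · refine ⟨t, ht, fun s' h => absurd h (hc s'), fun hlt u ρ e ho hu' => ?_⟩
        exact absurd ⟨hlt, u, ρ, e, ho, hu'⟩ hu)
  obtain ⟨b, hb, hbe⟩ := (hP i.other).2 b₀ (hb₀ _)
  have hc := hP.conform ha hb
  have hfb : G.Follows b i.other (s :: π) := by
    intro s' t ρ hs' _
    obtain ⟨t', e, -, h1, -⟩ := hb1 _ _ (hT.of_suffix hh hs' (by simp))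
    rw [hbe _ (hT.of_suffix hh ((List.suffix_cons _ _).trans hs') (by simp)), e, h1 s' hs']
  have key : ∀ l : List S, T (l ++ s :: π) → G.Follows a i (l ++ s :: π) →
      G.Follows b i.other (l ++ s :: π) → (∀ x ∈ l ++ s :: π, x ∉ G.target i) ∧
        ∃ u ρ, l ++ s :: π = u :: ρ ∧ u ∉ G.attr i (Fintype.card S) := by
    intro l
    induction l with
    | nil => intro _ _ _; exact ⟨hno, s, π, rfl, hs⟩
    | cons t l ih =>
      intro h1 h2 h3
      have hlen : L < (l ++ s :: π).length := by
        rw [List.length_append, hl]; omega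
      rw [List.cons_append] at h1 h2 h3 ⊢
      obtain ⟨h4, u, ρ, e, hu⟩ := ih (hT.of_suffix h1 (List.suffix_cons _ _) (by simp))
        (h2.of_suffix (List.suffix_cons _ _)) (h3.of_suffix (List.suffix_cons _ _))
      rw [e] at h1 h2 h3 h4 hlen ⊢
      have ht : t ∉ G.attr i (Fintype.card S) := by
        rcases eq_or_eq_other i (G.owner u) with ho | ho
        · exact (of_notMem_attr hu).1 ho t (isPlay_cons.1 (hT.isPlay h1)).1
        · obtain ⟨t', e', -, -, h5⟩ := hb1 _ _ h1
          have e2 := h3 _ _ _ (List.suffix_refl _) ho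
          rw [hbe _ (hT.parent h1), e'] at e2
          cases e2
          exact h5 hlen u ρ rfl ho hu
      refine ⟨fun x hx => ?_, t, _, rfl, ht⟩
      rcases List.mem_cons.1 hx with rfl | hx
      · exact fun h => ht (attr_mono (Nat.zero_le _) (by rw [attr]; exact h))
      · exact h4 x hx
  obtain ⟨k, hk⟩ := exists_atTarget (hfin b hb)
  obtain ⟨x, hx, hxt⟩ := hk.exists_mem
  have ho := outcome_mem hT hc k
  rcases suffix_or_suffix_of_follows (hT.isPlay hh) (hT.isPlay ho.1)
    (forall_pair (p := fun j f => G.Follows f j _) hf hfb) ho.2 with ⟨l, h6⟩ | h6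
  · have hoa := ho.2 i
    have hob := ho.2 i.other
    rw [pair_same] at hoa
    rw [pair_other] at hob
    rw [← h6] at hoa hob hx
    exact (key l (by rw [h6]; exact ho.1) hoa hob).1 x hx hxt
  · exact hno x (h6.subset hx) hxt

/-- If the tree `T` is unpruned after `L` moves, and Player `i` has a strategy of finite utility
against all opponents, then she has one whose utilities are bounded in terms of `L`: from the
`L`-th move on, she follows an attractor strategy. -/
theorem exists_utility_le (hT : G.IsTree D T) (hP : G.Describes T P) {L : ℕ}
    (hfree : ∀ j, G.FreeFor T j L) {a : Strat S} (ha : a ∈ P i)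
    (hfin : ∀ b ∈ P i.other, G.utility i (pair i a b) ≠ ⊤) :
    ∃ a' ∈ P i, ∀ b ∈ P i.other,
      G.utility i (pair i a' b) ≤ ((L + Fintype.card S) * G.maxWeight : ℕ) := by
  classical
  set n := Fintype.card S with hn
  obtain ⟨f, hf, hf1⟩ := hT.exists_strategy
    (fun g t => (g.length ≤ L → G.Turn i g → G.Follows a i g → a g = some t) ∧
      ∀ k u ρ, g.length = L + k + 1 → g = u :: ρ → G.owner u = i → k + 1 ≤ n →
        u ∈ G.attr i (n - k) → u ∉ G.target i → t ∈ G.attr i (n - (k + 1))) (by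
    intro g t ht
    by_cases h1 : g.length ≤ L ∧ G.Turn i g ∧ G.Follows a i g
    · obtain ⟨hl, htn, hfo⟩ := h1
      cases g with
      | nil => exact htn.elim
      | cons u ρ =>
        have hTg := hT.parent ht
        cases e : a (u :: ρ) with
        | none =>
          exact absurd (isPlay_cons.1 (hT.isPlay ht)).1 (notMem_edges_of_mem_strategies
            ((hP i).1 a ha).1 (hT.isPlay hTg) htn e t)
        | some t' =>
          exact ⟨t', ((hP i).1 a ha).2 u ρ t' hTg htn hfo e, fun _ _ _ => rfl,
            fun k _ _ hk => by omega⟩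
    · by_cases h2 : ∃ k u ρ, g.length = L + k + 1 ∧ g = u :: ρ ∧ G.owner u = i ∧ k + 1 ≤ n ∧
          u ∈ G.attr i (n - k) ∧ u ∉ G.target i
      · obtain ⟨k, u, ρ, hl, rfl, ho, hkn, hu, hut⟩ := h2
        have hTg := hT.parent ht
        rw [show n - k = (n - (k + 1)) + 1 by omega] at hu
        obtain ⟨t', he, ht'⟩ := (step_of_mem_attr hu hut).2.1 ho
        refine ⟨t', hfree i u ρ t' hTg ho (by omega) he,
          fun a b c => absurd ⟨a, b, c⟩ h1, fun k' _ _ hk' _ _ _ _ _ => ?_⟩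
        obtain rfl : k' = k := by omega
        exact ht'
      · exact ⟨t, ht, fun a b c => absurd ⟨a, b, c⟩ h1,
          fun k u ρ a b c d e f => absurd ⟨k, u, ρ, a, b, c, d, e, f⟩ h2⟩)
  obtain ⟨a', ha', hae⟩ := (hP i).2 f (hf i)
  refine ⟨a', ha', fun b hb => ?_⟩
  by_contra hcon
  have hc := hP.conform ha' hb
  have hL := legal_of_conform hc
  set σ := pair i a' b with hσ
  have noT : ∀ k ≤ L + n, ¬ G.AtTarget i σ k := by
    intro k hk ht
    refine hcon (utility_le_iff.2 ⟨k, ht, (pathWeight_le (isPlay_outcome hL k)).trans ?_⟩)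
    have := length_outcome_le (G := G) σ k
    exact Nat.mul_le_mul_right _ (by omega)
  have noMem : ∀ k ≤ L + n, ∀ x ∈ G.outcome σ k, x ∉ G.target i := by
    intro k hk x hx hxt
    obtain ⟨l₁, l₂, e⟩ := List.append_of_mem hx
    obtain ⟨m, hm, e'⟩ := exists_eq_outcome_of_suffix (G := G) (σ := σ) (k := k) (g := x :: l₂)
      ⟨l₁, e.symm⟩ (by simp)
    exact noT m (hm.trans hk) ⟨x, hxt, by rw [← e']; rfl⟩
  -- up to the `L`-th move, the strategy agrees with `a`
  have follow : ∀ g, T g → g.length ≤ L + 1 → G.Follows a' i g → G.Follows a i g := by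
    intro g
    induction g with
    | nil => intro hg; exact absurd rfl (hT.isPlay hg).ne_nil
    | cons t g ih =>
      intro hg hl hfo
      cases g with
      | nil => exact follows_singleton _ _
      | cons u ρ =>
        obtain ⟨h1, h2⟩ := follows_cons.1 hfo
        have h3 := ih (hT.parent hg) (by simp only [List.length_cons] at *; omega) h1
        refine follows_cons.2 ⟨h3, fun ho => ?_⟩
        obtain ⟨t', e, -, h4, -⟩ := hf1 _ _ hg
        have h5 := h2 ho
        rw [hae _ (hT.parent hg), e] at h5
        cases h5
        exact h4 (by simp only [List.length_cons] at *; omega) ho h3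
  obtain ⟨hO1, hO2⟩ := outcome_mem hT hc L
  have hOa := hO2 i
  have hOb := hO2 i.other
  rw [hσ, pair_same, ← hσ] at hOa
  rw [hσ, pair_other, ← hσ] at hOb
  have hOa' := follow _ hO1 (length_outcome_le σ L) hOa
  have hlenL : (G.outcome σ L).length = L + 1 := by
    refine (length_outcome_or_stalled (G := G) σ L).resolve_right fun hst => ?_
    -- otherwise the outcome against `a` is a dead end, too
    obtain ⟨k, hk⟩ := exists_atTarget (hfin b hb)
    obtain ⟨x, hx, hxt⟩ := hk.exists_mem
    have ho := outcome_mem hT (hP.conform ha hb) k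
    have hmem : x ∈ G.outcome σ L := by
      rcases suffix_or_suffix_of_follows (hT.isPlay hO1) (hT.isPlay ho.1)
        (forall_pair (p := fun j f => G.Follows f j _) hOa' hOb) ho.2 with ⟨l, h6⟩ | h6
      · rcases List.eq_nil_or_concat l with rfl | ⟨l, t, rfl⟩
        · rw [← h6] at hx; simpa using hx
        · exfalso
          have h7 : T (t :: G.outcome σ L) := hT.of_suffix ho.1 ⟨l, by rw [← h6]; simp⟩ (by simp)
          cases hO : G.outcome σ L with
          | nil => rw [hO] at hO1; exact (hT.isPlay hO1).ne_nil rfl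
          | cons u ρ =>
            rw [hO] at h7
            exact notMem_edges_of_stalled hL hst hO t (isPlay_cons.1 (hT.isPlay h7)).1
      · exact h6.subset hx
    exact noMem L (by omega) x hmem hxt
  -- from the `L`-th move on, the strategy descends through the attractor
  have key : ∀ m ≤ n, ∃ u ρ, G.outcome σ (L + m) = u :: ρ ∧ (u :: ρ).length = L + m + 1 ∧
      u ∈ G.attr i (n - m) := by
    intro m
    induction m with
    | zero =>
      intro _
      cases hO : G.outcome σ L with
      | nil => rw [hO] at hlenL; simp at hlenL
      | cons u ρ =>
        have hno := noMem L (by omega)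
        rw [hO] at hlenL hO1 hOa' hno
        exact ⟨u, ρ, rfl, hlenL,
          mem_attr_of_winning hT hP (hfree _) ha hfin hO1 hlenL hOa' hno⟩
    | succ m ih =>
      intro hm
      obtain ⟨u, ρ, hO, hlen, hu⟩ := ih (by omega)
      have hut : u ∉ G.target i := noMem (L + m) (by omega) u (by rw [hO]; simp)
      have hu' := hu
      rw [show n - m = (n - (m + 1)) + 1 by omega] at hu'
      obtain ⟨⟨s', he⟩, h1, h2⟩ := step_of_mem_attr hu' hut
      have hOm := (outcome_mem hT hc (L + m)).1
      rw [hO] at hOm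
      cases hs : σ (G.owner u) (u :: ρ) with
      | none =>
        exact absurd he (notMem_edges_of_mem_strategies (hL _) (hT.isPlay hOm) rfl hs s')
      | some t =>
        have hO' := outcome_succ_of_some hO hs
        have hTt := (outcome_mem hT hc (L + m + 1)).1
        rw [hO'] at hTt
        refine ⟨t, u :: ρ, hO', by simp only [List.length_cons] at *; omega, ?_⟩
        by_cases ho : G.owner u = i
        · obtain ⟨t', e, -, -, h4⟩ := hf1 _ _ hTt
          rw [ho, hσ, pair_same, hae _ hOm, e] at hs
          cases hs
          exact h4 m u ρ (by omega) rfl ho hm hu hut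
        · exact h2 ho t (isPlay_cons.1 (hT.isPlay hTt)).1
  obtain ⟨u, ρ, hO, -, hu⟩ := key n le_rfl
  rw [Nat.sub_self, attr] at hu
  exact noMem (L + n) le_rfl u (by rw [hO]; simp) hu

omit [Fintype S] in
/-- An optimal strategy has regret at most `V`, and loses at most that much against a best response,
which has utility at most `V`, too. -/
theorem utility_le_two_mul {V : ℕ} {a a' b : Strat S} (ha' : a' ∈ P i)
    (hV : ∀ b ∈ P i.other, G.utility i (pair i a' b) ≤ V) (hr : G.regret P i = G.regretOf P i a)
    (hb : b ∈ P i.other) : G.utility i (pair i a b) ≤ (2 * V : ℕ) := by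
  have h1 : G.regretOf P i a ≤ V := by
    rw [← hr]; exact (iInf₂_le a' ha').trans (regretOf_le_of_utility_le hV)
  have h2 := regretOf_le_iff.1 h1 b hb
  rw [regretAgainst] at h2
  split_ifs at h2 with h3
  · exact absurd h2 (by simp)
  · rw [tsub_le_iff_right] at h2
    refine h2.trans ?_
    have h4 : G.bestResponse P i b ≤ V := (iInf₂_le a' ha').trans (hV b hb)
    calc (V : ℕ∞) + G.bestResponse P i b ≤ V + V := by gcongr
      _ = (2 * V : ℕ) := by push_cast; ring

/-- If the tree is unpruned after `L` moves, optimal strategies of finite regret have utilities that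
are bounded in terms of `L`. -/
theorem utility_le_of_optimal (hT : G.IsTree D T) (hP : G.Describes T P) {L : ℕ}
    (hfree : ∀ j, G.FreeFor T j L) (hne : G.regret P i ≠ ⊤) {a b : Strat S} (ha : a ∈ P i)
    (hr : G.regret P i = G.regretOf P i a) (hb : b ∈ P i.other) :
    G.utility i (pair i a b) ≤ (2 * ((L + Fintype.card S) * G.maxWeight) : ℕ) := by
  have hfin : ∀ b ∈ P i.other, G.utility i (pair i a b) ≠ ⊤ := by
    intro b hb hu
    have h2 := regretOf_le_iff.1 hr.ge b hb
    rw [regretAgainst, if_pos hu] at h2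
    exact hne (top_le_iff.1 h2)
  obtain ⟨a', ha', hV⟩ := exists_utility_le hT hP hfree ha hfin
  exact utility_le_two_mul ha' hV hr hb

end Arena
end RegretGame

namespace RegretGame
namespace Arena

variable {S : Type} [Fintype S] {G : Arena S} {i : Player} {σ : Player → Strat S}
variable {D : ℕ} {T : List S → Prop} {h : List S} {P : Player → Set (Strat S)}

/-! ### Where pruning happens -/

/-- Player `i` has reached her target in all histories of more than `B` positions, and in all
histories that end in a dead end. -/
def ReachedBy (G : Arena S) (T : List S → Prop) (D : ℕ) (i : Player) (B : ℕ) : Prop :=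
  ∀ s π, T (s :: π) → (B < (s :: π).length ∨ ∀ s', (s, s') ∉ G.edges) →
    G.util (D + 1) i (s :: π) ≤ D

/-- After she has reached her target, no move of Player `i` is pruned. -/
def FreeAfter (G : Arena S) (T : List S → Prop) (D : ℕ) (i : Player) : Prop :=
  ∀ s π s', T (s :: π) → G.owner s = i → G.util (D + 1) i (s :: π) ≤ D → (s, s') ∈ G.edges →
    T (s' :: s :: π)

omit [Fintype S] in
theorem FreeFor.mono {L L' : ℕ} (hf : G.FreeFor T i L) (hL : L ≤ L') : G.FreeFor T i L' :=
  fun s π s' hh ho hl he => hf s π s' hh ho (by omega) he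

omit [Fintype S] in
theorem ReachedBy.freeFor {B : ℕ} (hr : G.ReachedBy T D i B) (hf : G.FreeAfter T D i) :
    G.FreeFor T i B :=
  fun s π s' hh ho hl he => hf s π s' hh ho (hr s π hh (Or.inl hl)) he

theorem ReachedBy.prune {B : ℕ} (hr : G.ReachedBy T D i B) : G.ReachedBy (G.prune D T) D i B :=
  fun s π hh hl => hr s π (prune_le hh) hl

omit [Fintype S] in
theorem ReachedBy.mono {B B' : ℕ} (hr : G.ReachedBy T D i B) (hB : B ≤ B') :
    G.ReachedBy T D i B' :=
  fun s π hh hl => hr s π hh (hl.imp_left fun h => by omega)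

theorem IsLeaf.length_or_deadEnd (hT : G.IsTree D T) {s : S} {π : List S}
    (hh : IsLeaf T D (s :: π)) : D < (s :: π).length ∨ ∀ s', (s, s') ∉ G.edges := by
  by_contra hcon
  push Not at hcon
  obtain ⟨h1, s', h2⟩ := hcon
  obtain ⟨t, ht⟩ := hT.child hh.1 h2
  have : t ∈ kids T D (s :: π) := mem_kids.2 ⟨ht, h1⟩
  rw [hh.2.2] at this
  simp at this

theorem ReachedBy.bounded (hpos : G.Positive) (hT : G.IsTree D T) (hP : G.Describes T P)
    (hr : G.ReachedBy T D i D) : G.Bounded P D i := by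
  intro _ a ha _ b hb
  have hc := hP.conform ha hb
  rw [utility_le_iff_util hpos (legal_of_conform hc) le_rfl]
  have hl := isLeaf_outcome hT hc
  cases hO : G.outcome (pair i a b) D with
  | nil => rw [hO] at hl; exact absurd rfl (hT.isPlay hl.1).ne_nil
  | cons s π =>
    rw [hO] at hl
    exact hr s π hl.1 (hl.length_or_deadEnd hT)

/-- Backward induction from a constant gives that constant. -/
theorem backup_eq_of_forall_isLeaf {q : List S → Prop} {leaf : List S → ℕ} {c : ℕ}
    (hc : c ≤ D + 1) (hh : T h) (hl : h.length ≤ D + 1)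
    (H : ∀ g, h <:+ g → IsLeaf T D g → leaf g = c) : backup T D q leaf h = c := by
  classical
  induction hk : D + 1 - h.length generalizing h with
  | zero =>
    have he : kids T D h = ∅ := by
      rw [Finset.eq_empty_iff_forall_notMem]
      intro s hs
      have := (mem_kids.1 hs).2
      omega
    rw [backup_of_empty he]
    exact H h (List.suffix_refl _) ⟨hh, hl, he⟩
  | succ k ih =>
    rcases Finset.eq_empty_or_nonempty (kids T D h) with he | hne
    · rw [backup_of_empty he]
      exact H h (List.suffix_refl _) ⟨hh, hl, he⟩
    · have h1 : ∀ s ∈ kids T D h, backup T D q leaf (s :: h) = c := by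
        intro s hs
        obtain ⟨h2, h3⟩ := mem_kids.1 hs
        exact ih h2 (by simp only [List.length_cons]; omega)
          (fun g hg => H g ((List.suffix_cons _ _).trans hg))
          (by simp only [List.length_cons]; omega)
      rw [backup_of_nonempty hne]
      obtain ⟨s, hs⟩ := hne
      split_ifs
      · refine le_antisymm ((Finset.fold_min_le _).2 (Or.inr ⟨s, hs, (h1 s hs).le⟩)) ?_
        exact (Finset.le_fold_min _).2 ⟨hc, fun t ht => (h1 t ht).ge⟩
      · refine le_antisymm (Finset.sup_le fun t ht => (h1 t ht).le) ?_
        rw [← h1 s hs]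
        exact Finset.le_sup (f := fun t => backup T D q leaf (t :: h)) hs

/-- After the target has been reached, deviations can only lead to the same utility again. -/
theorem min_dev_util_le {l : List S} (hT : G.IsTree D T) (hu : G.util (D + 1) i h ≤ D)
    (hne : h ≠ []) (hg : T (l ++ h)) (hl : (l ++ h).length ≤ D + 1) :
    min (G.dev T D i h) (G.util (D + 1) i h) ≤ G.dev T D i (l ++ h) ∧
      G.dev T D i (l ++ h) ≤ G.dev T D i h := by
  classical
  induction l with
  | nil => exact ⟨min_le_left _ _, le_rfl⟩
  | cons t l ih =>
    have hg' := hT.of_suffix hg (List.suffix_cons _ _) (by simp [hne])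
    have hl' : (l ++ h).length ≤ D := by
      simp only [List.cons_append, List.length_cons] at hl; omega
    obtain ⟨h1, h2⟩ := ih hg' (by omega)
    have hs : h <:+ l ++ h := List.suffix_append _ _
    rw [List.cons_append]
    cases e : l ++ h with
    | nil => simp [hne] at e
    | cons u ρ =>
      rw [e] at h1 h2 hs hl'
      rw [dev]
      refine ⟨le_min h1 ?_, (min_le_left _ _).trans h2⟩
      split_ifs
      · rw [Finset.le_fold_min]
        refine ⟨(min_le_right _ _).trans (by omega), fun s'' hs'' => (min_le_right _ _).trans ?_⟩
        simp only [Finset.mem_filter, Finset.mem_univ, true_and] at hs''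
        refine (backup_eq_of_forall_isLeaf (by omega) hs''.1
          (by simp only [List.length_cons] at *; omega) fun g hg _ => ?_).ge
        exact util_eq_of_suffix (by omega) (hs.trans ((List.suffix_cons _ _).trans hg))
      · exact (min_le_right _ _).trans (by omega)

/-- Once the target has been reached, the regret is settled. -/
theorem val_eq_of_util_le (hT : G.IsTree D T) (hu : G.util (D + 1) i h ≤ D) (hh : T h)
    (hl : h.length ≤ D + 1) : G.val T D i h = G.util (D + 1) i h - G.dev T D i h := by
  refine backup_eq_of_forall_isLeaf (by omega) hh hl ?_
  rintro g ⟨l, rfl⟩ hg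
  have h1 := util_eq_of_suffix (G := G) (i := i) (K := D + 1) (g := h) (h := l ++ h) (by omega)
    (List.suffix_append _ _)
  obtain ⟨h2, h3⟩ := min_dev_util_le hT hu (hT.isPlay hh).ne_nil hg.1 hg.2.1
  rw [leafVal, h1, if_pos hu]
  rcases min_le_iff.1 h2 with h4 | h4 <;> omega

/-- After her visit to the target, all moves of Player `i` lead to the same value for her.  The value
of her opponent does not increase with a move of hers, as the opponent maximizes there. -/
theorem FreeAfter.prune (hT : G.IsTree D T) (hf : G.FreeAfter T D i) :
    G.FreeAfter (G.prune D T) D i := by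
  intro s π s' hh ho hu he
  have hTs := hf s π s' (prune_le hh) ho hu he
  refine prune_cons.2 ⟨hTs, hh, fun hl j => ?_⟩
  have hl' : (s :: π).length ≤ D := by simp only [List.length_cons] at *; omega
  have hv := val_le_of_prune hT hh (by omega) j
  refine le_trans ?_ hv
  by_cases hj : G.owner s = j
  · obtain rfl : i = j := ho.symm.trans hj
    have e : G.util (D + 1) i (s' :: s :: π) = G.util (D + 1) i (s :: π) :=
      util_cons_of_lt (by omega)
    obtain ⟨h2, h3⟩ := min_dev_util_le (l := [s']) hT hu (by simp) hTs hl
    rw [val_eq_of_util_le hT (by rw [e]; exact hu) hTs hl,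
      val_eq_of_util_le hT hu (prune_le hh) (by omega), e]
    simp only [List.cons_append, List.nil_append] at h2 h3
    rcases min_le_iff.1 h2 with h4 | h4 <;> omega
  · exact val_cons_le hTs hl' hj

/-- As long as the regret of Player `i` is infinite, none of her moves can make it worse. -/
theorem FreeFor.prune {L : ℕ} (hT : G.IsTree D T) (hf : G.FreeFor T i L)
    (hv : D < G.val T D i [G.init]) : G.FreeFor (G.prune D T) i L := by
  intro s π s' hh ho hl he
  have hTs := hf s π s' (prune_le hh) ho hl he
  refine prune_cons.2 ⟨hTs, hh, fun hl' j => ?_⟩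
  by_cases hj : G.owner s = j
  · obtain rfl : i = j := ho.symm.trans hj
    exact (val_le _).trans hv
  · have hl'' : (s :: π).length ≤ D := by simp only [List.length_cons] at *; omega
    exact (val_cons_le hTs hl'' hj).trans (val_le_of_prune hT hh (by omega) j)

/-- The depth `D` is large enough for a tree that is unpruned after `L` moves. -/
theorem bounded_of_freeFor {L : ℕ} (hT : G.IsTree D T) (hP : G.Describes T P)
    (hfree : ∀ j, G.FreeFor T j L) (hL : 2 * ((L + Fintype.card S) * G.maxWeight) ≤ D) :
    G.Bounded P D i :=
  fun hne _ ha hr _ hb => (utility_le_of_optimal hT hP hfree hne ha hr hb).trans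
    (by exact_mod_cast hL)

/-- When a player first obtains a finite regret, she reaches her target within a bounded number of
moves from then on. -/
theorem reachedBy_of_freeFor {L : ℕ} (hpos : G.Positive) (hT : G.IsTree D T)
    (hP : G.Describes T P) (hfree : ∀ j, G.FreeFor T j L)
    (hB : ∀ j, G.Bounded P D j) (hL : 2 * ((L + Fintype.card S) * G.maxWeight) ≤ D)
    (hne : G.regret P i ≠ ⊤) :
    G.ReachedBy (G.prune D T) D i (2 * ((L + Fintype.card S) * G.maxWeight)) := by
  intro s π hh hl
  have hT' := isTree_prune hT
  have hP' := hP.delete hpos hT hB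
  set B := 2 * ((L + Fintype.card S) * G.maxWeight) with hBdef
  obtain ⟨f, hf, hf1, -⟩ := exists_toward hT' i hh
  obtain ⟨a, ha, hae⟩ := (hP' i).2 f (hf i)
  obtain ⟨b, hb, hbe⟩ := (hP' i.other).2 f (hf _)
  have hc := hP'.conform ha hb
  have hfa : G.Follows a i (s :: π) := fun t' t ρ ht _ => by
    rw [hae _ (hT'.of_suffix hh ((List.suffix_cons _ _).trans ht) (by simp))]
    exact hf1 _ _ _ ht
  have hfb : G.Follows b i.other (s :: π) := fun t' t ρ ht _ => by
    rw [hbe _ (hT'.of_suffix hh ((List.suffix_cons _ _).trans ht) (by simp))]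
    exact hf1 _ _ _ ht
  have ho := outcome_mem hT' hc B
  have hu := utility_le_of_optimal hT hP hfree hne ha.1 ha.2 hb.1
  rw [utility_le_iff_util hpos (legal_of_conform hc) le_rfl, util_le_iff (by omega)] at hu
  rw [util_le_iff (by omega)]
  obtain ⟨t, ρ, h1, h2, h3⟩ := hu
  refine ⟨t, ρ, h1.trans ?_, h2, by omega⟩
  rcases suffix_or_suffix_of_follows (hT'.isPlay hh) (hT'.isPlay ho.1)
    (forall_pair (p := fun j f => G.Follows f j _) hfa hfb) ho.2 with h4 | h4
  · have hlen := length_outcome_le (G := G) (pair i a b) B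
    have hlen' := h4.length_le
    rcases hl with hl | hl
    · rw [h4.eq_of_length (by omega)]
    · obtain ⟨l, h5⟩ := h4
      rcases List.eq_nil_or_concat l with rfl | ⟨l, u, rfl⟩
      · rw [← h5]; simp
      · have h6 : G.prune D T (u :: s :: π) :=
          hT'.of_suffix ho.1 ⟨l, by rw [← h5]; simp⟩ (by simp)
        exact absurd (isPlay_cons.1 (hT'.isPlay h6)).1 (hl u)
  · exact h4

/-- The situations that may occur during the iteration: no player has obtained a finite regret so
far, or one, or both. -/
def Status (G : Arena S) (T : List S → Prop) (D : ℕ) : Prop :=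
  (∀ i, G.FreeFor T i 0) ∨
    (∃ i, G.FreeFor T i 0 ∧
      G.ReachedBy T D i.other (2 * ((0 + Fintype.card S) * G.maxWeight))) ∨
    ∀ i, G.ReachedBy T D i D

/-- A player whose regret has been infinite so far has free moves, and a player whose regret is finite
reaches her target within a bounded number of moves and is free afterwards.  So the moves that matter
lie at a bounded depth as long as some regret is infinite.  Once both regrets are finite, all
plays that remain reach both targets. -/
theorem Status.step (hpos : G.Positive) (hT : G.IsTree D T) (hP : G.Describes T P)
    (hD : 2 * ((2 * ((0 + Fintype.card S) * G.maxWeight) + Fintype.card S) * G.maxWeight) ≤ D)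
    (hf : ∀ i, G.FreeAfter T D i) (hs : G.Status T D) :
    (∀ i, G.Bounded P D i) ∧ G.Status (G.prune D T) D := by
  have hD0 : 2 * ((0 + Fintype.card S) * G.maxWeight) ≤ D := by nlinarith
  have free : ∀ i, G.regret P i = ⊤ → G.Bounded P D i → D < G.val T D i [G.init] := by
    intro i hr hB
    rw [regret_eq_uncap hpos hT hP hB, uncap] at hr
    split_ifs at hr with h1
    · exact absurd hr (ENat.natCast_ne_top _)
    · omega
  rcases hs with h0 | ⟨i, h1, h2⟩ | h3
  · have hB : ∀ i, G.Bounded P D i := fun i => bounded_of_freeFor hT hP h0 hD0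
    refine ⟨hB, ?_⟩
    have hR : ∀ i, G.regret P i ≠ ⊤ → _ :=
      fun i hne => reachedBy_of_freeFor hpos hT hP h0 hB hD0 hne
    have hF : ∀ i, G.regret P i = ⊤ → G.FreeFor (G.prune D T) i 0 :=
      fun i hr => (h0 i).prune hT (free i hr (hB i))
    by_cases ha : G.regret P .one = ⊤ <;> by_cases hb : G.regret P .two = ⊤
    · left; intro i; cases i
      · exact hF _ ha
      · exact hF _ hb
    · exact Or.inr (Or.inl ⟨.one, hF _ ha, hR _ hb⟩)
    · exact Or.inr (Or.inl ⟨.two, hF _ hb, hR _ ha⟩)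
    · right; right; intro i; cases i
      · exact (hR _ ha).mono hD0
      · exact (hR _ hb).mono hD0
  · have hfree : ∀ j, G.FreeFor T j (2 * ((0 + Fintype.card S) * G.maxWeight)) := by
      intro j
      rcases eq_or_eq_other i j with rfl | rfl
      · exact h1.mono (Nat.zero_le _)
      · exact h2.freeFor (hf _)
    have hB : ∀ j, G.Bounded P D j := fun j => bounded_of_freeFor hT hP hfree hD
    refine ⟨hB, ?_⟩
    by_cases hr : G.regret P i = ⊤
    · exact Or.inr (Or.inl ⟨i, h1.prune hT (free i hr (hB i)), h2.prune⟩)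
    · right; right; intro j
      rcases eq_or_eq_other i j with rfl | rfl
      · exact (reachedBy_of_freeFor hpos hT hP hfree hB hD hr).mono hD
      · exact h2.prune.mono hD0
  · exact ⟨fun i => (h3 i).bounded hpos hT hP, Or.inr (Or.inr fun i => (h3 i).prune)⟩

/-- The histories that remain after `j` steps of the iteration. -/
def tree (G : Arena S) (D : ℕ) (j : ℕ) : List S → Prop := (G.prune D)^[j] G.IsPlay

theorem tree_succ (j : ℕ) : G.tree D (j + 1) = G.prune D (G.tree D j) :=
  Function.iterate_succ_apply' _ _ _

omit [Fintype S] in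
theorem isTree_isPlay : G.IsTree D G.IsPlay where
  isPlay h := h
  init := isPlay_singleton.2 rfl
  parent h := (isPlay_cons.1 h).2
  child := fun hh he => ⟨_, isPlay_cons.2 ⟨he, hh⟩⟩
  free := fun hh _ he => isPlay_cons.2 ⟨he, hh⟩

theorem isTree_tree (j : ℕ) : G.IsTree D (G.tree D j) := by
  induction j with
  | zero => exact isTree_isPlay
  | succ j ih => rw [tree_succ]; exact isTree_prune ih

theorem describes_tree (hpos : G.Positive)
    (hD : 2 * ((2 * ((0 + Fintype.card S) * G.maxWeight) + Fintype.card S) * G.maxWeight) ≤ D)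
    (j : ℕ) : G.Describes (G.tree D j) (G.rank j) ∧ (∀ i, G.FreeAfter (G.tree D j) D i) ∧
      G.Status (G.tree D j) D := by
  induction j with
  | zero =>
    have free : ∀ s π s', G.IsPlay (s :: π) → (s, s') ∈ G.edges → G.IsPlay (s' :: s :: π) :=
      fun s π s' h he => isPlay_cons.2 ⟨he, h⟩
    refine ⟨fun i => ⟨fun f hf => ⟨hf, ?_⟩, fun f hf => ⟨f, hf.1, fun _ _ => rfl⟩⟩,
      fun i s π s' hh _ _ he => free s π s' hh he, Or.inl fun i s π s' hh _ _ he =>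
        free s π s' hh he⟩
    intro s π s' hh ho _ e
    exact free s π s' hh (mem_edges_of_mem_strategies hf hh ho e)
  | succ j ih =>
    obtain ⟨h1, h2, h3⟩ := ih
    obtain ⟨h4, h5⟩ := h3.step hpos (isTree_tree j) h1 hD h2
    rw [tree_succ, rank, Function.iterate_succ_apply']
    exact ⟨h1.delete hpos (isTree_tree j) h4, fun i => (h2 i).prune (isTree_tree j), h5⟩

/-- The regrets of the iteration are the values of backward induction on finite trees. -/
theorem regretSucc_eq (hpos : G.Positive)
    (hD : 2 * ((2 * ((0 + Fintype.card S) * G.maxWeight) + Fintype.card S) * G.maxWeight) ≤ D)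
    (i : Player) (j : ℕ) :
    G.regretSucc i j = uncap D (G.val (G.tree D j) D i [G.init]) := by
  obtain ⟨h1, h2, h3⟩ := describes_tree (D := D) hpos hD j
  exact regret_eq_uncap hpos (isTree_tree j) h1 ((h3.step hpos (isTree_tree j) h1 hD h2).1 i)

end Arena
end RegretGame

namespace RegretGame

/-! ### A language of bounded loops over arrays -/

/-- Expressions over a family of arrays of natural numbers, named by the elements of `A`. -/
inductive Ex (A : Type) where
  | const (n : ℕ)
  | get (a : A) (idx : Ex A)
  | add (x y : Ex A)
  | sub (x y : Ex A)

/-- Programs over a family of arrays.  The only loop, `rep a c`, runs `c` as many times as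
is said by the cell `0` of the array `a` when the loop is entered, so that every program halts. -/
inductive Cmd (A : Type) where
  | skip
  | set (a : A) (idx val : Ex A)
  | seq (c d : Cmd A)
  | ite (guard : Ex A) (c d : Cmd A)
  | rep (a : A) (c : Cmd A)

/-- The contents of all arrays. -/
abbrev St (A : Type) := A → ℕ → ℕ

section Language

variable {A : Type} [DecidableEq A]

/-- Writing one cell of one array. -/
def St.upd (σ : St A) (a : A) (k v : ℕ) : St A := Function.update σ a (Function.update (σ a) k v)

theorem St.upd_same (σ : St A) (a : A) (k v : ℕ) : σ.upd a k v a = Function.update (σ a) k v :=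
  Function.update_self ..

theorem St.upd_of_ne (σ : St A) {a b : A} (h : b ≠ a) (k v : ℕ) : σ.upd a k v b = σ b :=
  Function.update_of_ne h ..

theorem St.upd_apply (σ : St A) (a b : A) (k v : ℕ) :
    σ.upd a k v b = if b = a then Function.update (σ a) k v else σ b := by
  split_ifs with h
  · rw [h, St.upd_same]
  · rw [St.upd_of_ne _ h]

theorem St.upd_of_ne_idx (σ : St A) {a b : A} {k l : ℕ} (v : ℕ) (h : l ≠ k) :
    σ.upd a k v b l = σ b l := by
  rw [St.upd_apply]
  split_ifs with hb
  · rw [Function.update_of_ne h, hb]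
  · rfl

theorem St.upd_eq_self {σ : St A} {a : A} {k v : ℕ} (h : σ a k = v) : σ.upd a k v = σ := by
  subst h; rw [St.upd, Function.update_eq_self, Function.update_eq_self]

/-- The value of an expression. -/
def Ex.eval (σ : St A) : Ex A → ℕ
  | .const n => n
  | .get a i => σ a (i.eval σ)
  | .add x y => x.eval σ + y.eval σ
  | .sub x y => x.eval σ - y.eval σ

namespace Cmd

/-- The state after the execution of a program. -/
def run : Cmd A → St A → St A
  | .skip, σ => σ
  | .set a i v, σ => σ.upd a (i.eval σ) (v.eval σ)
  | .seq c d, σ => d.run (c.run σ)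
  | .ite g c d, σ => if g.eval σ = 0 then d.run σ else c.run σ
  | .rep a c, σ => c.run^[σ a 0] σ

/-- The arrays to which a program writes. -/
def mods : Cmd A → List A
  | .skip => []
  | .set a _ _ => [a]
  | .seq c d => c.mods ++ d.mods
  | .ite _ c d => c.mods ++ d.mods
  | .rep _ c => c.mods

/-- The registers that hold the lengths of the loops of a program. -/
def loopRegs : Cmd A → List A
  | .skip => []
  | .set _ _ _ => []
  | .seq c d => c.loopRegs ++ d.loopRegs
  | .ite _ c d => c.loopRegs ++ d.loopRegs
  | .rep a c => a :: c.loopRegs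

theorem run_of_notMem {c : Cmd A} {a : A} (h : a ∉ c.mods) (σ : St A) : c.run σ a = σ a := by
  induction c generalizing σ with
  | skip => rfl
  | set b i v =>
    rw [run, St.upd_of_ne]
    simpa [mods] using h
  | seq c d ihc ihd =>
    simp only [mods, List.mem_append, not_or] at h
    rw [run, ihd h.2, ihc h.1]
  | ite g c d ihc ihd =>
    simp only [mods, List.mem_append, not_or] at h
    rw [run]
    split_ifs
    · exact ihd h.2 σ
    · exact ihc h.1 σ
  | rep b c ih =>
    rw [run]
    generalize σ b 0 = k
    induction k generalizing σ with
    | zero => rfl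
    | succ k ihk => rw [Function.iterate_succ_apply, ihk, ih h]

/-- Loop invariants.  What the body does not write to need not be part of the invariant. -/
theorem run_rep {c : Cmd A} {a : A} {σ₀ : St A} {k : ℕ} (hk : σ₀ a 0 = k)
    (J : ℕ → St A → Prop) (h0 : J 0 σ₀)
    (hs : ∀ j σ, j < k → (∀ b, b ∉ c.mods → σ b = σ₀ b) → J j σ → J (j + 1) (c.run σ)) :
    J k ((Cmd.rep a c).run σ₀) := by
  rw [run, hk]
  suffices H : ∀ j ≤ k, J j (c.run^[j] σ₀) ∧ ∀ b, b ∉ c.mods → c.run^[j] σ₀ b = σ₀ b from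
    (H k le_rfl).1
  intro j
  induction j with
  | zero => exact fun _ => ⟨h0, fun _ _ => rfl⟩
  | succ j ih =>
    intro hj
    obtain ⟨h1, h2⟩ := ih (by omega)
    rw [Function.iterate_succ_apply']
    exact ⟨hs j _ (by omega) h2 h1, fun b hb => by rw [run_of_notMem hb, h2 b hb]⟩

end Cmd

/-! ### Compilation to the random access machine -/

/-- The expression `64 * e`. -/
def mulStride (e : Expr) : Expr := (fun x => .add x x)^[6] e

theorem eval_mulStride (m : Memory) (e : Expr) : (mulStride e).eval m = 64 * e.eval m := by
  simp only [mulStride, Function.iterate_succ, Function.iterate_zero, Function.comp_apply, id_eq,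
    Expr.eval]
  omega

/-- The arrays are interleaved, in memory, above the address that the cell `3` holds: `a` is
the `num a`-th of `64` arrays, the last of which is kept for the loop counters. -/
def cellAddr (a : ℕ) (idx : Expr) : Expr :=
  .add (.read (.const 3)) (.add (.const a) (mulStride idx))

variable (num : A → ℕ)

/-- The compilation of an expression. -/
def Ex.compile : Ex A → Expr
  | .const n => .const n
  | .get a i => .read (cellAddr (num a) i.compile)
  | .add x y => .add x.compile y.compile
  | .sub x y => .sub x.compile y.compile

/-- The counter of the loops at nesting depth `d`. -/
def counter (d : ℕ) : Expr := cellAddr 63 (.const d)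

/-- The compilation of a program that occurs inside of `d` loops. -/
def Cmd.compile : ℕ → Cmd A → Program
  | _, .skip => .skip
  | _, .set a i v => .assign (cellAddr (num a) (i.compile num)) (v.compile num)
  | d, .seq c c' => .seq (c.compile d) (c'.compile d)
  | d, .ite g c c' => .cond (g.compile num) (c.compile d) (c'.compile d)
  | d, .rep a c =>
    .seq (.assign (counter d) (.read (cellAddr (num a) (.const 0))))
      (.loop (.read (counter d))
        (.seq (c.compile (d + 1)) (.assign (counter d) (.sub (.read (counter d)) (.const 1)))))

/-- The memory `m` holds the arrays `σ`, above the address `base`. -/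
structure Represents (base : ℕ) (m : Memory) (σ : St A) : Prop where
  lt : 3 < base
  base_eq : m 3 = base
  cell : ∀ a k, m (base + (num a + 64 * k)) = σ a k

variable {num} {base : ℕ} {m : Memory} {σ : St A}

theorem eval_cellAddr (hm : m 3 = base) (a : ℕ) (e : Expr) :
    (cellAddr a e).eval m = base + (a + 64 * e.eval m) := by
  simp [cellAddr, Expr.eval, eval_mulStride, hm]

omit [DecidableEq A] in
theorem Represents.eval (h : Represents num base m σ) (e : Ex A) :
    (e.compile num).eval m = e.eval σ := by
  induction e with
  | const n => rfl
  | get a i ih => rw [Ex.compile, Expr.eval, eval_cellAddr h.base_eq, ih, Ex.eval, h.cell]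
  | add x y ihx ihy => rw [Ex.compile, Expr.eval, ihx, ihy, Ex.eval]
  | sub x y ihx ihy => rw [Ex.compile, Expr.eval, ihx, ihy, Ex.eval]

omit [DecidableEq A] in
theorem Represents.update_of_ne (h : Represents num base m σ) {x v : ℕ} (hx : x ≠ 3)
    (hx' : ∀ a k, base + (num a + 64 * k) ≠ x) :
    Represents num base (Function.update m x v) σ where
  lt := h.lt
  base_eq := by rw [Function.update_of_ne hx.symm, h.base_eq]
  cell a k := by rw [Function.update_of_ne (hx' a k), h.cell]

theorem Represents.upd (hinj : Function.Injective num) (hlt : ∀ a, num a < 63)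
    (h : Represents num base m σ) (a : A) (k v : ℕ) :
    Represents num base (Function.update m (base + (num a + 64 * k)) v) (σ.upd a k v) where
  lt := h.lt
  base_eq := by
    have := h.lt
    rw [Function.update_of_ne (by omega), h.base_eq]
  cell b j := by
    have h1 := hlt a
    have h2 := hlt b
    by_cases hb : b = a
    · subst hb
      rw [St.upd_same]
      by_cases hj : j = k
      · subst hj; rw [Function.update_self, Function.update_self]
      · rw [Function.update_of_ne (by omega), Function.update_of_ne hj, h.cell]
    · have h3 : num b ≠ num a := fun e => hb (hinj e)
      rw [St.upd_of_ne _ hb, Function.update_of_ne (by omega), h.cell]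

/-- Compiled programs are correct, and run in time polynomial in the lengths of the loops, provided
that these are not modified by the program. -/
theorem Cmd.exec_compile (hinj : Function.Injective num) (hlt : ∀ a, num a < 63) (c : Cmd A)
    (hmod : ∀ a ∈ c.loopRegs, a ∉ c.mods) :
    ∃ p : ℕ, ∀ (X d base : ℕ) (m : Memory) (σ : St A), Represents num base m σ →
      (∀ a ∈ c.loopRegs, σ a 0 ≤ X) →
      ∃ t m', Exec (c.compile num d) m t m' ∧ t ≤ (X + 2) ^ p ∧
        Represents num base m' (c.run σ) ∧
        ∀ e < d, m' (base + (63 + 64 * e)) = m (base + (63 + 64 * e)) := by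
  have pow_add_le : ∀ X a b : ℕ, (X + 2) ^ a + (X + 2) ^ b ≤ (X + 2) ^ (a + b + 1) := by
    intro X a b
    have h1 : (X + 2) ^ a ≤ (X + 2) ^ (a + b) := Nat.pow_le_pow_right (by omega) (by omega)
    have h2 : (X + 2) ^ b ≤ (X + 2) ^ (a + b) := Nat.pow_le_pow_right (by omega) (by omega)
    rw [pow_succ]
    have := Nat.mul_le_mul_left ((X + 2) ^ (a + b)) (show 2 ≤ X + 2 by omega)
    omega
  have le_pow : ∀ X a : ℕ, a ≤ (X + 2) ^ a := by
    intro X a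
    exact (Nat.lt_pow_self (by omega)).le
  induction c with
  | skip =>
    refine ⟨1, fun X d base m σ h _ => ⟨1, m, .skip m, ?_, h, fun _ _ => rfl⟩⟩
    rw [pow_one]; omega
  | set a i v =>
    refine ⟨(cellAddr (num a) (i.compile num)).cost + (v.compile num).cost + 1,
      fun X d base m σ h _ => ⟨_, _, .assign _ _ m, le_pow _ _, ?_, fun e _ => ?_⟩⟩
    · rw [eval_cellAddr h.base_eq, h.eval, h.eval]
      exact h.upd hinj hlt a _ _
    · rw [eval_cellAddr h.base_eq, Function.update_of_ne]
      have := hlt a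
      omega
  | seq c c' ih ih' =>
    simp only [loopRegs, mods, List.mem_append] at hmod
    obtain ⟨p, hp⟩ := ih fun a ha h => hmod a (Or.inl ha) (Or.inl h)
    obtain ⟨p', hp'⟩ := ih' fun a ha h => hmod a (Or.inr ha) (Or.inr h)
    refine ⟨p + p' + 1, fun X d base m σ h hX => ?_⟩
    simp only [loopRegs, List.mem_append] at hX
    obtain ⟨t, m₁, h1, h2, h3, h4⟩ := hp X d base m σ h fun a ha => hX a (Or.inl ha)
    obtain ⟨t', m₂, h1', h2', h3', h4'⟩ := hp' X d base m₁ _ h3 fun a ha => by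
      rw [run_of_notMem fun hm => hmod a (Or.inr ha) (Or.inl hm)]
      exact hX a (Or.inr ha)
    exact ⟨_, m₂, .seq h1 h1', (by have := pow_add_le X p p'; omega), h3',
      fun e he => (h4' e he).trans (h4 e he)⟩
  | ite g c c' ih ih' =>
    simp only [loopRegs, mods, List.mem_append] at hmod
    obtain ⟨p, hp⟩ := ih fun a ha h => hmod a (Or.inl ha) (Or.inl h)
    obtain ⟨p', hp'⟩ := ih' fun a ha h => hmod a (Or.inr ha) (Or.inr h)
    refine ⟨((g.compile num).cost + 1) + (p + p' + 1) + 1, fun X d base m σ h hX => ?_⟩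
    simp only [loopRegs, List.mem_append] at hX
    have h5 := pow_add_le X ((g.compile num).cost + 1) (p + p' + 1)
    have h6 := pow_add_le X p p'
    have h7 := le_pow X ((g.compile num).cost + 1)
    by_cases hg : g.eval σ = 0
    · obtain ⟨t', m₂, h1', h2', h3', h4'⟩ := hp' X d base m σ h fun a ha => hX a (Or.inr ha)
      refine ⟨_, m₂, .condFalse (by rw [h.eval, hg]) h1', by omega, ?_, h4'⟩
      rw [run, if_pos hg]; exact h3'
    · obtain ⟨t', m₂, h1', h2', h3', h4'⟩ := hp X d base m σ h fun a ha => hX a (Or.inl ha)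
      refine ⟨_, m₂, .condTrue (by rw [h.eval]; exact hg) h1', by omega, ?_, h4'⟩
      rw [run, if_neg hg]; exact h3'
  | rep a c ih =>
    simp only [loopRegs, mods, List.mem_cons] at hmod
    obtain ⟨p, hp⟩ := ih fun b hb => hmod b (Or.inr hb)
    have ha := hmod a (Or.inl rfl)
    -- the constant costs of entering, testing and continuing the loop
    set κ : ℕ := ((counter 0).cost + (Expr.read (cellAddr (num a) (.const 0))).cost + 1) +
      ((Expr.read (counter 0)).cost + 1) +
      ((counter 0).cost + (Expr.sub (.read (counter 0)) (.const 1)).cost + 1) with hκ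
    refine ⟨(p + κ + 1) + 1 + κ + 1, fun X d base m σ h hX => ?_⟩
    simp only [loopRegs, List.mem_cons] at hX
    have haddr : ∀ m' : Memory, m' 3 = base → (counter d).eval m' = base + (63 + 64 * d) := by
      intro m' hm'; rw [counter, eval_cellAddr hm', Expr.eval]
    have hcost : (counter d).cost = (counter 0).cost := by
      simp [counter, cellAddr, mulStride, Expr.cost]
    have loop : ∀ (r : ℕ) (σ' : St A) (m' : Memory), Represents num base m' σ' →
        m' (base + (63 + 64 * d)) = r → (∀ b ∈ c.loopRegs, σ' b 0 ≤ X) →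
        ∃ t m'', Exec (.loop (.read (counter d)) (.seq (c.compile num (d + 1))
          (.assign (counter d) (.sub (.read (counter d)) (.const 1))))) m' t m'' ∧
          t ≤ r * ((X + 2) ^ p + κ) + ((Expr.read (counter 0)).cost + 1) ∧
          Represents num base m'' (c.run^[r] σ') ∧
          ∀ e < d, m'' (base + (63 + 64 * e)) = m' (base + (63 + 64 * e)) := by
      intro r
      induction r with
      | zero =>
        intro σ' m' h' hr _
        refine ⟨_, m', .loopStop (by rw [Expr.eval, haddr m' h'.base_eq, hr]), ?_, h',
          fun _ _ => rfl⟩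
        simp only [Expr.cost, hcost]; omega
      | succ r ihr =>
        intro σ' m' h' hr hX'
        obtain ⟨t₁, m₁, e1, e2, e3, e4⟩ := hp X (d + 1) base m' σ' h' hX'
        have e5 : Represents num base (Function.update m₁ (base + (63 + 64 * d)) r) (c.run σ') := by
          refine e3.update_of_ne ?_ fun b k => ?_
          · have := h'.lt; omega
          · have := hlt b; omega
        obtain ⟨t₂, m₂, f1, f2, f3, f4⟩ := ihr _ _ e5 (Function.update_self ..) fun b hb => by
          rw [run_of_notMem (hmod b (Or.inr hb))]; exact hX' b hb
        have e6 : Exec (.assign (counter d) (.sub (.read (counter d)) (.const 1))) m₁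
            ((counter d).cost + (Expr.sub (.read (counter d)) (.const 1)).cost + 1)
            (Function.update m₁ (base + (63 + 64 * d)) r) := by
          have e7 := Exec.assign (counter d) (.sub (.read (counter d)) (.const 1)) m₁
          rw [haddr m₁ e3.base_eq] at e7
          have e8 : (Expr.sub (.read (counter d)) (.const 1)).eval m₁ = r := by
            simp only [Expr.eval]
            rw [haddr m₁ e3.base_eq, e4 d (by omega), hr]; rfl
          rwa [e8] at e7
        refine ⟨_, m₂, .loopStep ?_ (.seq e1 e6) f1, ?_, ?_, fun e he => ?_⟩
        · rw [Expr.eval, haddr m' h'.base_eq, hr]; omega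
        · simp only [Expr.cost, hcost] at hκ f2 ⊢
          rw [Nat.succ_mul]; omega
        · rw [Function.iterate_succ_apply]; exact f3
        · rw [f4 e he, Function.update_of_ne (by omega), e4 e (by omega)]
    have h0 : Represents num base (Function.update m (base + (63 + 64 * d)) (σ a 0)) σ := by
      refine h.update_of_ne ?_ fun b k => ?_
      · have := h.lt; omega
      · have := hlt b; omega
    obtain ⟨t, m', g1, g2, g3, g4⟩ := loop (σ a 0) σ _ h0 (Function.update_self ..)
      fun b hb => hX b (Or.inr hb)
    have e6 : Exec (.assign (counter d) (.read (cellAddr (num a) (.const 0)))) m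
        ((counter d).cost + (Expr.read (cellAddr (num a) (.const 0))).cost + 1)
        (Function.update m (base + (63 + 64 * d)) (σ a 0)) := by
      have e7 := Exec.assign (counter d) (.read (cellAddr (num a) (.const 0))) m
      rw [haddr m h.base_eq] at e7
      have e8 : (Expr.read (cellAddr (num a) (.const 0))).eval m = σ a 0 := by
        rw [Expr.eval, eval_cellAddr h.base_eq, Expr.eval, h.cell]
      rwa [e8] at e7
    refine ⟨_, m', .seq e6 g1, ?_, ?_, fun e he => ?_⟩
    · have h5 := pow_add_le X p κ
      have h6 := pow_add_le X ((p + κ + 1) + 1) κ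
      have h7 := le_pow X κ
      have h8 : σ a 0 * ((X + 2) ^ p + κ) ≤ (X + 2) ^ ((p + κ + 1) + 1) := by
        rw [pow_succ, mul_comm]
        exact Nat.mul_le_mul (by omega) (by have := hX a (Or.inl rfl); omega)
      rw [hcost]
      omega
    · rw [run]; exact g3
    · rw [g4 e he, Function.update_of_ne (by omega)]

end Language

end RegretGame

namespace RegretGame

/-! ### The algorithm -/

namespace Ex

variable {A : Type}

instance : Add (Ex A) := ⟨.add⟩
instance : Sub (Ex A) := ⟨.sub⟩
instance (k : ℕ) : OfNat (Ex A) k := ⟨.const k⟩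

/-- The contents of a register, which is the cell `0` of an array. -/
def reg (a : A) : Ex A := .get a 0

/-- The minimum, by truncated subtraction. -/
def min (x y : Ex A) : Ex A := x - (x - y)
/-- The maximum, by truncated subtraction. -/
def max (x y : Ex A) : Ex A := x + (y - x)

variable (σ : St A)

@[simp] theorem eval_add (x y : Ex A) : (x + y).eval σ = x.eval σ + y.eval σ := rfl
@[simp] theorem eval_sub (x y : Ex A) : (x - y).eval σ = x.eval σ - y.eval σ := rfl
@[simp] theorem eval_ofNat (k : ℕ) : (no_index (OfNat.ofNat k : Ex A)).eval σ = k := rfl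
@[simp] theorem eval_reg (a : A) : (reg a).eval σ = σ a 0 := rfl
@[simp] theorem eval_get (a : A) (i : Ex A) : (Ex.get a i).eval σ = σ a (i.eval σ) := rfl
@[simp] theorem eval_min (x y : Ex A) : (x.min y).eval σ = Min.min (x.eval σ) (y.eval σ) := by
  simp only [min, eval_sub]; omega
@[simp] theorem eval_max (x y : Ex A) : (x.max y).eval σ = Max.max (x.eval σ) (y.eval σ) := by
  simp only [max, eval_add, eval_sub]; omega

end Ex

namespace Cmd

variable {A : Type}

/-- Assigning to a register. -/
def assign (a : A) (v : Ex A) : Cmd A := .set a 0 v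

/-- Sequential composition. -/
def block : List (Cmd A) → Cmd A
  | [] => .skip
  | c :: l => .seq c (block l)

@[simp] theorem mods_assign (a : A) (v : Ex A) : (assign a v).mods = [a] := rfl
@[simp] theorem mods_block_nil : (block ([] : List (Cmd A))).mods = [] := rfl
@[simp] theorem mods_block_cons (c : Cmd A) (l : List (Cmd A)) :
    (block (c :: l)).mods = c.mods ++ (block l).mods := rfl
@[simp] theorem loopRegs_assign (a : A) (v : Ex A) : (assign a v).loopRegs = [] := rfl
@[simp] theorem loopRegs_block_nil : (block ([] : List (Cmd A))).loopRegs = [] := rfl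
@[simp] theorem loopRegs_block_cons (c : Cmd A) (l : List (Cmd A)) :
    (block (c :: l)).loopRegs = c.loopRegs ++ (block l).loopRegs := rfl

attribute [simp] mods loopRegs

variable [DecidableEq A] (σ : St A)

@[simp] theorem run_skip : (skip : Cmd A).run σ = σ := rfl
@[simp] theorem run_set (a : A) (i v : Ex A) :
    (set a i v).run σ = σ.upd a (i.eval σ) (v.eval σ) := rfl
@[simp] theorem run_assign (a : A) (v : Ex A) : (assign a v).run σ = σ.upd a 0 (v.eval σ) := rfl
@[simp] theorem run_block_nil : (block ([] : List (Cmd A))).run σ = σ := rfl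
@[simp] theorem run_block_cons (c : Cmd A) (l : List (Cmd A)) :
    (block (c :: l)).run σ = (block l).run (c.run σ) := rfl
@[simp] theorem run_ite (g : Ex A) (c d : Cmd A) :
    (ite g c d).run σ = if g.eval σ = 0 then d.run σ else c.run σ := rfl

end Cmd

/-- The arrays of the algorithm.  The nodes of the unfolding of the arena are numbered like those of
a heap: the root is `0`, and the children of the node `k` are `n * k + 1, …, n * k + n`.
* `inp` is the input; `own`, `row`, `alive`, `wt`, `ut`, `best`, `dev`, `lv`, `val` are indexed by
  nodes: the owner of the position, the address of its row of the adjacency matrix, whether the node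
  is in the current tree, the weight of the history, and its capped utility, best extension, best
  deviation, regret if it is maximal, and value;
* all others are registers: `dep` is the depth of the tree, and `cap` the number that represents
  `+∞`; `inner`, `total` and `lim` are the numbers of nodes of less than `dep`, `dep + 1` and
  `dep + 2` levels; `cur` is the current node, `cb` its first child, `c` the child under
  consideration and `s` its position, and `cc` and `t` are the same in an inner loop. -/
inductive Arr where
  | inp | own | row | alive
  | len | n | start | q | q2 | q3 | dep | cap | inner | total | lim | tmp
  | cur | cb | c | s | cc | t | agg | agg2 | has | ro
  | out (i : Player) | wt (i : Player) | ut (i : Player) | best (i : Player) | dev (i : Player)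
  | lv (i : Player) | val (i : Player)
  deriving DecidableEq

/-- The place of an array in the interleaving of the arrays. -/
def Arr.num : Arr → ℕ
  | .inp => 0 | .own => 1 | .row => 2 | .alive => 3
  | .len => 4 | .n => 5 | .start => 6 | .q => 7 | .q2 => 8 | .q3 => 9 | .dep => 10 | .cap => 11
  | .inner => 12 | .total => 13 | .lim => 14 | .tmp => 15
  | .cur => 16 | .cb => 17 | .c => 18 | .s => 19 | .cc => 20 | .t => 21 | .agg => 22 | .agg2 => 23
  | .has => 24 | .ro => 25
  | .out i => 26 + i.code | .wt i => 28 + i.code | .ut i => 30 + i.code | .best i => 32 + i.code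
  | .dev i => 34 + i.code | .lv i => 36 + i.code | .val i => 38 + i.code

theorem Player.code_le (i : Player) : i.code ≤ 1 := by cases i <;> simp [Player.code]

theorem Arr.num_lt (a : Arr) : a.num < 63 := by
  cases a <;> simp only [Arr.num] <;> first
    | omega
    | (rename_i i; have := i.code_le; omega)

/-- A left inverse of the numbering. -/
def Arr.ofNum (k : ℕ) : Arr :=
  let i : Player := if k % 2 = 0 then .one else .two
  match k with
  | 0 => .inp | 1 => .own | 2 => .row | 3 => .alive
  | 4 => .len | 5 => .n | 6 => .start | 7 => .q | 8 => .q2 | 9 => .q3 | 10 => .dep | 11 => .cap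
  | 12 => .inner | 13 => .total | 14 => .lim | 15 => .tmp
  | 16 => .cur | 17 => .cb | 18 => .c | 19 => .s | 20 => .cc | 21 => .t | 22 => .agg | 23 => .agg2
  | 24 => .has | 25 => .ro
  | 26 | 27 => .out i | 28 | 29 => .wt i | 30 | 31 => .ut i | 32 | 33 => .best i
  | 34 | 35 => .dev i | 36 | 37 => .lv i | _ => .val i

theorem Arr.num_injective : Function.Injective Arr.num :=
  Function.LeftInverse.injective (g := Arr.ofNum) fun a => by
    cases a <;> first | rfl | (rename_i i; cases i <;> rfl)

open Arr Cmd

/-- Adding to a register. -/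
def inc (a : Arr) (v : Ex Arr) : Cmd Arr := assign a (.reg a + v)

/-- Running `body` for all children `c` of the current node, at the positions `s`. -/
def children (body : Cmd Arr) : Cmd Arr :=
  block [assign c (.reg cb), assign s 0, .rep n (block [body, inc s 1, inc c 1])]

/-- Running `node` for the first `r` nodes, parents before their children. -/
def topDown (r : Arr) (node : Cmd Arr) : Cmd Arr :=
  block [assign cur 0, assign cb 1, .rep r (block [node, inc cur 1, inc cb (.reg n)])]

/-- Running `node` for all nodes, children before their parents. -/
def bottomUp (node : Cmd Arr) : Cmd Arr :=
  block [assign cur (.reg total), assign cb (.reg lim), .rep total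
    (block [assign cur (.reg cur - 1), assign cb (.reg cb - .reg n), node])]

/-- Whether the position of the current node belongs to Player `i`. -/
def isOwn : Player → Ex Arr
  | .one => 1 - .get own (.reg cur)
  | .two => .get own (.reg cur)

/-- One step of backward induction: minimum or maximum over the children in the tree, or the value
`lf` if there is none. -/
def backupNode (isMin : Ex Arr) (lf res : Arr) : Cmd Arr :=
  block [assign agg (.reg cap), assign agg2 0, assign has 0,
    children (.ite (.get alive (.reg c))
      (block [assign agg (.min (.reg agg) (.get res (.reg c))),
        assign agg2 (.max (.reg agg2) (.get res (.reg c))), assign has 1])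
      .skip),
    .ite (.reg has)
      (.ite isMin (.set res (.reg cur) (.reg agg)) (.set res (.reg cur) (.reg agg2)))
      (.set res (.reg cur) (.get lf (.reg cur)))]

/-- The least value of a sibling of `c` in the tree. -/
def siblings (i : Player) : Cmd Arr :=
  block [assign agg (.reg cap), assign t 0, assign cc (.reg cb),
    .rep n (block [
      .ite (.get alive (.reg cc))
        (.ite ((.reg t - .reg s) + (.reg s - .reg t))
          (assign agg (.min (.reg agg) (.get (best i) (.reg cc)))) .skip) .skip,
      inc t 1, inc cc 1])]

/-- The regret of the node `x` if it is maximal. -/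
def leafCmd (i : Player) (x : Ex Arr) : Cmd Arr :=
  .ite (.reg cap - .get (ut i) x) (.set (lv i) x (.get (ut i) x - .get (dev i) x))
    (.set (lv i) x (.reg cap))

/-- Computing, for all children of the current node, the best deviation and the regret. -/
def devNode (i : Player) : Cmd Arr :=
  children (block [siblings i,
    .ite (isOwn i) (.set (dev i) (.reg c) (.min (.get (dev i) (.reg cur)) (.reg agg)))
      (.set (dev i) (.reg c) (.get (dev i) (.reg cur))),
    leafCmd i (.reg c)])

/-- The value of the current tree for Player `i`. -/
def evalPass (i : Player) : Cmd Arr :=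
  block [bottomUp (backupNode 1 (ut i) (best i)),
    .set (dev i) 0 (.reg cap), leafCmd i 0, topDown total (devNode i),
    bottomUp (backupNode (isOwn i) (lv i) (val i))]

/-- Removing from the tree all children of the current node whose parent has been removed or whose
value, for one of the players, is larger than that of the root. -/
def pruneNode : Cmd Arr :=
  children (.ite (.get alive (.reg c))
    (.ite (.get alive (.reg cur))
      (.ite ((.get (val .one) (.reg c) - .get (val .one) 0) +
          (.get (val .two) (.reg c) - .get (val .two) 0))
        (.set alive (.reg c) 0) .skip)
      (.set alive (.reg c) 0))
    .skip)

/-- Three times the value of an expression. -/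
def triple (x : Ex Arr) : Ex Arr := x + x + x

/-- The number by which the entries for Player `i` of the input are shifted. -/
def shift : Player → Ex Arr
  | .one => 1
  | .two => 2

/-- Initializing the weight and the utility of the child `c` of the current node. -/
def setupPlayer (i : Player) : Cmd Arr :=
  block [
    .set (wt i) (.reg c) (.get (wt i) (.reg cur) +
      .get inp (.get row (.reg cur) + triple (.reg s) + shift i)),
    .ite (.get inp (2 + triple (.reg s) + shift i))
      (.set (ut i) (.reg c) (.min (.get (ut i) (.reg cur)) (.get (wt i) (.reg c))))
      (.set (ut i) (.reg c) (.get (ut i) (.reg cur)))]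

/-- Initializing the arrays for the child `c` of the current node. -/
def setupChild : Cmd Arr :=
  block [
    .set own (.reg c) (.get inp (2 + triple (.reg s))),
    .set row (.reg c) (.reg ro), inc ro (triple (.reg n)),
    .ite (.get alive (.reg cur))
      (.ite (.get inp (.get row (.reg cur) + triple (.reg s))) (.set alive (.reg c) 1) .skip)
      .skip,
    setupPlayer .one, setupPlayer .two]

/-- Initializing the arrays for all children of the current node. -/
def setupNode : Cmd Arr :=
  block [assign ro (2 + triple (.reg n)), children setupChild]

/-- Initializing the utility of the root. -/
def setupRoot (i : Player) : Cmd Arr :=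
  .ite (.get inp (2 + triple (.reg start) + shift i)) (.set (ut i) 0 0) (.set (ut i) 0 (.reg cap))

/-- Decoding the cells `2`, `3` and `4` of the input, which are stored, in binary, in the cell
`2`. -/
def unpackCmd : Cmd Arr :=
  block [
    assign tmp (.get inp 2),
    .ite (.reg tmp - 3) (block [.set inp 4 1, assign tmp (.reg tmp - 4)]) (.set inp 4 0),
    .ite (.reg tmp - 1) (block [.set inp 3 1, assign tmp (.reg tmp - 2)]) (.set inp 3 0),
    .set inp 2 (.reg tmp),
    assign n (.get inp 0), assign start (.get inp 1), assign q 0, assign t 0]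

/-- The sum of all numbers in the input. -/
def sumCmd : Cmd Arr := .rep len (block [inc q (.get inp (.reg t)), inc t 1])

/-- The depth `6 * q ^ 3` of the unfolding. -/
def depthCmd : Cmd Arr :=
  block [assign q2 0, assign q3 0, .rep q (inc q2 (.reg q)), .rep q (inc q3 (.reg q2)),
    assign dep (triple (.reg q3) + triple (.reg q3)), assign cap (.reg dep + 1), assign inner 0]

/-- `x := n * y + 1`. -/
def levelCmd (x y : Arr) : Cmd Arr :=
  block [assign tmp 0, .rep n (inc tmp (.reg y)), assign x (.reg tmp + 1)]

/-- The numbers of nodes of the tree, and the row of the adjacency matrix for the root. -/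
def sizeCmd : Cmd Arr :=
  block [.rep dep (levelCmd inner inner), levelCmd total inner, levelCmd lim total,
    .set row 0 (2 + triple (.reg n)),
    .rep start (.set row 0 (.get row 0 + triple (.reg n)))]

/-- Initializing the tree to the unfolding of the arena. -/
def setupCmd : Cmd Arr :=
  block [.set own 0 0, .set alive 0 1, .set (wt .one) 0 0, .set (wt .two) 0 0,
    setupRoot .one, setupRoot .two, topDown inner setupNode]

/-- One step of the iteration. -/
def roundCmd : Cmd Arr := block [evalPass .one, evalPass .two, topDown total pruneNode]

/-- Encoding the value of the root. -/
def outCmd (i : Player) : Cmd Arr :=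
  .ite (.reg cap - .get (val i) 0) (assign (out i) (.get (val i) 0 + 1)) (assign (out i) 0)

/-- There are at most as many steps that change the tree as there are nodes. -/
def iterCmd : Cmd Arr :=
  block [.rep total roundCmd, evalPass .one, evalPass .two, outCmd .one, outCmd .two]

/-! ### Loop rules -/

@[simp] theorem loopRegs_inc (a : Arr) (v : Ex Arr) : (inc a v).loopRegs = [] := rfl
@[simp] theorem mods_inc (a : Arr) (v : Ex Arr) : (inc a v).mods = [a] := rfl
@[simp] theorem run_inc (a : Arr) (v : Ex Arr) (σ : St Arr) :
    (inc a v).run σ = σ.upd a 0 (σ a 0 + v.eval σ) := rfl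

@[simp] theorem mods_children (body : Cmd Arr) :
    (children body).mods = [c, s] ++ (body.mods ++ [s, c]) := by
  simp [children]
@[simp] theorem mods_topDown (r : Arr) (node : Cmd Arr) :
    (topDown r node).mods = [cur, cb] ++ (node.mods ++ [cur, cb]) := by
  simp [topDown]
@[simp] theorem mods_bottomUp (node : Cmd Arr) :
    (bottomUp node).mods = [cur, cb, cur, cb] ++ node.mods := by
  simp [bottomUp]

theorem run_children {body : Cmd Arr} (hb : ∀ a ∈ [c, s, cb, n], a ∉ body.mods) {σ₀ : St Arr} {k : ℕ}
    (hk : σ₀ n 0 = k) (J : ℕ → St Arr → Prop) (h0 : J 0 σ₀)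
    (hJ : ∀ j σ σ', (∀ a, a ≠ c → a ≠ s → σ' a = σ a) → J j σ → J j σ')
    (hs : ∀ j σ, j < k → (∀ a, a ∉ body.mods → a ≠ c → a ≠ s → σ a = σ₀ a) → σ s 0 = j →
      σ c 0 = σ₀ cb 0 + j → J j σ → J (j + 1) (body.run σ)) :
    J k ((children body).run σ₀) := by
  simp only [List.mem_cons, List.not_mem_nil, or_false, forall_eq_or_imp, forall_eq] at hb
  obtain ⟨hc, hs', hcb, hn⟩ := hb
  set σ₁ := (σ₀.upd c 0 (σ₀ cb 0)).upd s 0 0 with hσ₁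
  have e : (children body).run σ₀ = (Cmd.rep n (block [body, inc s 1, inc c 1])).run σ₁ := rfl
  have h1 : ∀ a, a ≠ c → a ≠ s → σ₁ a = σ₀ a := fun a h2 h3 => by
    rw [hσ₁, St.upd_of_ne _ h3, St.upd_of_ne _ h2]
  rw [e]
  refine (Cmd.run_rep (k := k) (J := fun j σ => J j σ ∧ σ s 0 = j ∧ σ c 0 = σ₀ cb 0 + j)
    (by rw [h1 n (by simp) (by simp), hk]) ?_ ?_).1
  · refine ⟨hJ 0 σ₀ _ h1 h0, ?_, ?_⟩
    · simp [hσ₁, St.upd_apply]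
    · simp [hσ₁, St.upd_apply]
  · rintro j σ hj hf ⟨h2, h3, h4⟩
    have h5 := hs j σ hj (fun a ha hac has => by
      rw [hf a (by simp [ha, hac, has]), h1 a hac has]) h3 h4 h2
    refine ⟨hJ _ _ _ (fun a hac has => ?_) h5, ?_, ?_⟩
    · simp [St.upd_apply, hac, has]
    · simp [St.upd_apply, run_of_notMem hs', h3]
    · simp [St.upd_apply, run_of_notMem hc, h4, add_assoc]

theorem run_topDown {r : Arr} {node : Cmd Arr} (hb : ∀ a ∈ [cur, cb, n], a ∉ node.mods) {σ₀ : St Arr}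
    {k : ℕ} (hk : σ₀ r 0 = k) (hr : r ≠ cur) (hr' : r ≠ cb) (J : ℕ → St Arr → Prop) (h0 : J 0 σ₀)
    (hJ : ∀ j σ σ', (∀ a, a ≠ cur → a ≠ cb → σ' a = σ a) → J j σ → J j σ')
    (hs : ∀ j σ, j < k → (∀ a, a ∉ node.mods → a ≠ cur → a ≠ cb → σ a = σ₀ a) → σ cur 0 = j →
      σ cb 0 = σ₀ n 0 * j + 1 → J j σ → J (j + 1) (node.run σ)) :
    J k ((topDown r node).run σ₀) := by
  simp only [List.mem_cons, List.not_mem_nil, or_false, forall_eq_or_imp, forall_eq] at hb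
  obtain ⟨hid, hcb, hn⟩ := hb
  set σ₁ := (σ₀.upd cur 0 0).upd cb 0 1 with hσ₁
  have e : (topDown r node).run σ₀ =
    (Cmd.rep r (block [node, inc cur 1, inc cb (.reg n)])).run σ₁ := rfl
  have h1 : ∀ a, a ≠ cur → a ≠ cb → σ₁ a = σ₀ a := fun a h2 h3 => by
    rw [hσ₁, St.upd_of_ne _ h3, St.upd_of_ne _ h2]
  rw [e]
  refine (Cmd.run_rep (k := k) (J := fun j σ => J j σ ∧ σ cur 0 = j ∧ σ cb 0 = σ₀ n 0 * j + 1)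
    (by rw [h1 r hr hr', hk]) ?_ ?_).1
  · refine ⟨hJ 0 σ₀ _ h1 h0, ?_, ?_⟩
    · simp [hσ₁, St.upd_apply]
    · simp [hσ₁, St.upd_apply]
  · rintro j σ hj hf ⟨h2, h3, h4⟩
    have h5 := hs j σ hj (fun a ha hac has => by
      rw [hf a (by simp [ha, hac, has]), h1 a hac has]) h3 h4 h2
    have h6 : σ n 0 = σ₀ n 0 := by rw [hf n (by simp [hn]), h1 n (by simp) (by simp)]
    refine ⟨hJ _ _ _ (fun a hac has => ?_) h5, ?_, ?_⟩
    · simp [St.upd_apply, hac, has]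
    · simp [St.upd_apply, run_of_notMem hid, h3]
    · simp [St.upd_apply, run_of_notMem hcb, run_of_notMem hn, h4, h6]; ring

theorem run_bottomUp {node : Cmd Arr} (hb : ∀ a ∈ [cur, cb, n], a ∉ node.mods) {σ₀ : St Arr}
    {k : ℕ} (hk : σ₀ total 0 = k) (hl : σ₀ lim 0 = σ₀ n 0 * k + 1)
    (J : ℕ → St Arr → Prop) (h0 : J k σ₀)
    (hJ : ∀ j σ σ', (∀ a, a ≠ cur → a ≠ cb → σ' a = σ a) → J j σ → J j σ')
    (hs : ∀ j σ, j < k → (∀ a, a ∉ node.mods → a ≠ cur → a ≠ cb → σ a = σ₀ a) → σ cur 0 = j →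
      σ cb 0 = σ₀ n 0 * j + 1 → J (j + 1) σ → J j (node.run σ)) :
    J 0 ((bottomUp node).run σ₀) := by
  simp only [List.mem_cons, List.not_mem_nil, or_false, forall_eq_or_imp, forall_eq] at hb
  obtain ⟨hid, hcb, hn⟩ := hb
  set σ₁ := (σ₀.upd cur 0 (σ₀ total 0)).upd cb 0 (σ₀ lim 0) with hσ₁
  have e : (bottomUp node).run σ₀ = (Cmd.rep total (block [assign cur (.reg cur - 1),
      assign cb (.reg cb - .reg n), node])).run σ₁ := by
    simp [bottomUp, hσ₁, St.upd_apply]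
  have h1 : ∀ a, a ≠ cur → a ≠ cb → σ₁ a = σ₀ a := fun a h2 h3 => by
    rw [hσ₁, St.upd_of_ne _ h3, St.upd_of_ne _ h2]
  rw [e]
  have key := (Cmd.run_rep (k := k)
    (J := fun j σ => J (k - j) σ ∧ σ cur 0 = k - j ∧ σ cb 0 = σ₀ n 0 * (k - j) + 1)
    (c := block [assign cur (.reg cur - 1), assign cb (.reg cb - .reg n), node])
    (a := total) (σ₀ := σ₁)
    (by rw [h1 total (by simp) (by simp), hk]) ?_ ?_).1
  · rwa [Nat.sub_self] at key
  · refine ⟨hJ k σ₀ _ h1 h0, ?_, ?_⟩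
    · simp [hσ₁, St.upd_apply, hk]
    · simp [hσ₁, St.upd_apply, hl]
  · rintro j σ hj hf ⟨h2, h3, h4⟩
    have hn' : σ n 0 = σ₀ n 0 := by rw [hf n (by simp [hn]), h1 n (by simp) (by simp)]
    have ej : k - j = (k - (j + 1)) + 1 := by omega
    set σ₂ := (σ.upd cur 0 (σ cur 0 - 1)).upd cb 0 (σ cb 0 - σ n 0) with hσ₂
    have e2 : (block [assign cur (.reg cur - 1), assign cb (.reg cb - .reg n), node]).run σ =
        node.run σ₂ := by
      simp [hσ₂, St.upd_apply]
    have h7 : ∀ a, a ≠ cur → a ≠ cb → σ₂ a = σ a := fun a h2 h3 => by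
      rw [hσ₂, St.upd_of_ne _ h3, St.upd_of_ne _ h2]
    have hid2 : σ₂ cur 0 = k - (j + 1) := by simp [hσ₂, St.upd_apply, h3]; omega
    have hcb2 : σ₂ cb 0 = σ₀ n 0 * (k - (j + 1)) + 1 := by
      simp only [hσ₂, St.upd_apply, if_true, Function.update_self, h4, hn']
      rw [ej, Nat.mul_succ]; omega
    rw [e2]
    refine ⟨hs _ σ₂ (by omega) (fun a ha hac has => ?_) hid2 hcb2 ?_, ?_, ?_⟩
    · rw [h7 a hac has, hf a (by simp [ha, hac, has]), h1 a hac has]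
    · rw [← ej]; exact hJ _ _ _ h7 h2
    · rw [run_of_notMem hid, hid2]
    · rw [run_of_notMem hcb, hcb2]

end RegretGame

namespace RegretGame

/-! ### Numbering the histories, and reading the input -/

/-- The number of nodes of the first `d` levels of the `n`-ary tree. -/
def levels (n : ℕ) : ℕ → ℕ
  | 0 => 0
  | d + 1 => n * levels n d + 1

namespace Arena

variable {S : Type} (G : Arena S) {n : ℕ} (e : S ≃ Fin n)

/-- The history at a node of the `n`-ary tree. -/
def path : ℕ → List S
  | 0 => [G.init]
  | k + 1 => e.symm ⟨k % n, Nat.mod_lt _ (e G.init).pos⟩ :: path (k / n)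
  termination_by k => k
  decreasing_by exact Nat.lt_succ_of_le (Nat.div_le_self _ _)

theorem path_zero : G.path e 0 = [G.init] := by rw [path]

theorem path_child (k : ℕ) (s : Fin n) :
    G.path e (n * k + 1 + s) = e.symm s :: G.path e k := by
  have hn : 0 < n := s.pos
  have h1 : n * k + 1 + s = (n * k + s) + 1 := by omega
  rw [h1, path]
  congr
  · rw [Nat.mul_add_mod, Nat.mod_eq_of_lt s.2]
  · rw [Nat.mul_add_div hn, Nat.div_eq_of_lt s.2, Nat.add_zero]

theorem path_ne_nil (k : ℕ) : G.path e k ≠ [] := by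
  cases k <;> rw [path] <;> simp

theorem exists_eq_child (hn : 0 < n) {k : ℕ} (hk : k ≠ 0) :
    ∃ (j : ℕ) (s : Fin n), k = n * j + 1 + s := by
  obtain ⟨k, rfl⟩ := Nat.exists_eq_succ_of_ne_zero hk
  exact ⟨k / n, ⟨k % n, Nat.mod_lt _ hn⟩, by have := Nat.div_add_mod k n; simp only; omega⟩

theorem length_path_le_iff (k d : ℕ) : (G.path e k).length ≤ d ↔ k < levels n d := by
  have hn : 0 < n := (e G.init).pos
  induction d generalizing k with
  | zero =>
    have := List.length_pos_of_ne_nil (G.path_ne_nil e k)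
    simp only [levels]; omega
  | succ d ih =>
    rcases Nat.eq_zero_or_pos k with rfl | hk
    · rw [path]; simp [levels]
    · obtain ⟨j, s, rfl⟩ := exists_eq_child hn (Nat.pos_iff_ne_zero.1 hk)
      rw [path_child, List.length_cons, Nat.add_le_add_iff_right]
      refine (ih j).trans ?_
      rw [levels]
      constructor
      · intro h
        have := Nat.mul_le_mul_left n (show j + 1 ≤ levels n d by omega)
        rw [Nat.mul_succ] at this
        have := s.2
        omega
      · intro h
        by_contra hcon
        have := Nat.mul_le_mul_left n (show levels n d ≤ j by omega)
        omega

/-- The node of a play. -/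
theorem exists_path_eq {h : List S} (hh : G.IsPlay h) : ∃ k, G.path e k = h := by
  induction h with
  | nil => exact hh.elim
  | cons s' h ih =>
    cases h with
    | nil => exact ⟨0, by rw [path_zero, isPlay_singleton.1 hh]⟩
    | cons s π =>
      obtain ⟨k, hk⟩ := ih (isPlay_cons.1 hh).2
      exact ⟨n * k + 1 + e s', by rw [path_child, hk, Equiv.symm_apply_apply]⟩

end Arena

theorem levels_mono (n : ℕ) {d d' : ℕ} (h : d ≤ d') (hn : 0 < n) : levels n d ≤ levels n d' := by
  induction d', h using Nat.le_induction with
  | base => exact le_rfl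
  | succ d' _ ih =>
    rw [levels]
    have := Nat.le_mul_of_pos_left (levels n d') hn
    omega

theorem levels_le (n d : ℕ) : levels n d ≤ (n + 1) ^ d := by
  induction d with
  | zero => simp [levels]
  | succ d ih =>
    have h1 : 0 < (n + 1) ^ d := by positivity
    rw [levels, pow_succ]
    nlinarith

theorem getD_flatMap {α : Type} {l : List α} {f : α → List ℕ} {m : ℕ} (hf : ∀ x, (f x).length = m)
    {k r : ℕ} (hk : k < l.length) (hr : r < m) :
    (l.flatMap f).getD (m * k + r) 0 = (f l[k]).getD r 0 := by
  induction l generalizing k with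
  | nil => simp at hk
  | cons x l ih =>
    rw [List.flatMap_cons]
    cases k with
    | zero =>
      rw [Nat.mul_zero, Nat.zero_add, List.getD_append _ _ _ _ (by rw [hf]; exact hr)]
      rfl
    | succ k =>
      rw [List.getD_append_right _ _ _ _ (by rw [hf, Nat.mul_succ]; omega), hf,
        show m * (k + 1) + r - m = m * k + r by rw [Nat.mul_succ]; omega,
        ih (by simpa using hk)]
      rfl

theorem length_flatMap_const {α : Type} {l : List α} {f : α → List ℕ} {m : ℕ}
    (hf : ∀ x, (f x).length = m) : (l.flatMap f).length = m * l.length := by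
  induction l with
  | nil => simp
  | cons x l ih => rw [List.flatMap_cons, List.length_append, ih, hf, List.length_cons]; ring

namespace Arena

variable {S : Type} [DecidableEq S] (G : Arena S) {n : ℕ} (e : S ≃ Fin n)

theorem encode_zero : (G.encode e).getD 0 0 = n := rfl

theorem encode_one : (G.encode e).getD 1 0 = e G.init := rfl

theorem length_encode : (G.encode e).length = 2 + 3 * n + 3 * n * n := by
  rw [encode, List.length_append, List.length_append, length_flatMap_const (m := 3),
    length_flatMap_const (m := 3 * n)]
  · simp
  · intro k
    rw [length_flatMap_const (m := 3)]
    · simp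
    · intro l; split_ifs <;> rfl
  · intro k; rfl

theorem encode_node (k : Fin n) {r : ℕ} (hr : r < 3) :
    (G.encode e).getD (2 + 3 * k + r) 0 =
      [(G.owner (e.symm k)).code, if e.symm k ∈ G.target .one then 1 else 0,
        if e.symm k ∈ G.target .two then 1 else 0].getD r 0 := by
  have hk := k.2
  rw [encode, List.getD_append, List.getD_append_right]
  · rw [show 2 + 3 * (k : ℕ) + r - [n, (e G.init : ℕ)].length = 3 * k + r by simp; omega,
      getD_flatMap (m := 3) (fun _ => rfl) (by simp) hr]
    simp
  · simp; omega
  · rw [List.length_append, length_flatMap_const (m := 3) (fun _ => rfl)]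
    simp; omega

theorem encode_edge (k l : Fin n) {r : ℕ} (hr : r < 3) :
    (G.encode e).getD (2 + 3 * n + 3 * n * k + 3 * l + r) 0 =
      (if (e.symm k, e.symm l) ∈ G.edges then
        [1, G.weight .one (e.symm k) (e.symm l), G.weight .two (e.symm k) (e.symm l)]
      else [0, 0, 0]).getD r 0 := by
  have hk := k.2
  have hl := l.2
  have h3 : ∀ x : Fin n, (if (e.symm k, e.symm x) ∈ G.edges then
      [1, G.weight .one (e.symm k) (e.symm x), G.weight .two (e.symm k) (e.symm x)]
      else [0, 0, 0]).length = 3 := by intro x; split_ifs <;> rfl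
  rw [encode, List.getD_append_right]
  · rw [List.length_append, length_flatMap_const (m := 3) (fun _ => rfl),
      show 2 + 3 * n + 3 * n * (k : ℕ) + 3 * l + r - ([n, (e G.init : ℕ)].length +
        3 * (List.finRange n).length) = 3 * n * k + (3 * l + r) by simp; omega,
      getD_flatMap (m := 3 * n) ?_ (by simp) (by omega), getD_flatMap (m := 3) ?_ (by simp) hr]
    · simp
    · intro x; simpa using h3 x
    · intro k
      rw [length_flatMap_const (m := 3)]
      · simp
      · intro l; split_ifs <;> rfl
  · rw [List.length_append, length_flatMap_const (m := 3) (fun _ => rfl)]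
    simp; omega

theorem encode_owner (k : Fin n) :
    (G.encode e).getD (2 + 3 * k) 0 = (G.owner (e.symm k)).code :=
  G.encode_node e k (r := 0) (by omega)

theorem encode_target (k : Fin n) (i : Player) :
    (G.encode e).getD (2 + 3 * k + (i.code + 1)) 0 = if e.symm k ∈ G.target i then 1 else 0 := by
  rw [G.encode_node e k (by have := i.code_le; omega)]
  cases i <;> rfl

theorem encode_isEdge (k l : Fin n) :
    (G.encode e).getD (2 + 3 * n + 3 * n * k + 3 * l) 0 =
      if (e.symm k, e.symm l) ∈ G.edges then 1 else 0 := by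
  have := G.encode_edge e k l (r := 0) (by omega)
  rw [Nat.add_zero] at this
  rw [this]; split_ifs <;> rfl

theorem encode_weight {k l : Fin n} (h : (e.symm k, e.symm l) ∈ G.edges) (i : Player) :
    (G.encode e).getD (2 + 3 * n + 3 * n * k + 3 * l + (i.code + 1)) 0 =
      G.weight i (e.symm k) (e.symm l) := by
  rw [G.encode_edge e k l (by have := i.code_le; omega), if_pos h]
  cases i <;> rfl

theorem le_of_mem_encode {x : ℕ} (hx : x ∈ G.encode e) : x ≤ n + G.maxWeight + 1 := by
  simp only [encode, List.mem_append, List.mem_flatMap, List.mem_cons, List.not_mem_nil,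
    or_false] at hx
  rcases hx with ((rfl | rfl) | ⟨k, -, rfl | rfl | rfl⟩) | ⟨k, -, l, -, hx⟩
  · omega
  · have := (e G.init).2; omega
  · have := (G.owner (e.symm k)).code_le; omega
  · split_ifs <;> omega
  · split_ifs <;> omega
  · split_ifs at hx with h
    · simp only [List.mem_cons, List.not_mem_nil, or_false] at hx
      have h1 := weight_le_maxWeight (i := .one) h
      have h2 := weight_le_maxWeight (i := .two) h
      rcases hx with rfl | rfl | rfl <;> omega
    · simp only [List.mem_cons, List.not_mem_nil, or_false, or_self] at hx
      omega

theorem maxWeight_le {b : ℕ} (hb : ∀ x ∈ G.encode e, x ≤ b) : G.maxWeight ≤ b := by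
  refine Finset.sup_le fun p hp => ?_
  have h1 : ∀ i, G.weight i p.1 p.2 ≤ b := by
    intro i
    obtain ⟨s, s'⟩ := p
    have h2 := G.encode_weight e (k := e s) (l := e s') (by simpa using hp) i
    simp only [Equiv.symm_apply_apply] at h2
    rw [← h2, List.getD_eq_getElem?_getD]
    cases h3 : (G.encode e)[2 + 3 * n + 3 * n * (e s : ℕ) + 3 * (e s' : ℕ) + (i.code + 1)]? with
    | none => simp
    | some x => exact hb x (List.mem_of_getElem? h3)
  exact max_le (h1 _) (h1 _)

end Arena

end RegretGame

namespace RegretGame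

open Arr Cmd Arena

/-! ### Correctness of backward induction -/

variable {S : Type} [Fintype S] {G : Arena S} {n : ℕ} {e : S ≃ Fin n} {D : ℕ} {T : List S → Prop}

/-- The registers that describe the shape of the tree. -/
structure Shape (n D : ℕ) (σ : St Arr) : Prop where
  n_eq : σ Arr.n 0 = n
  cap_eq : σ cap 0 = D + 1
  inner_eq : σ inner 0 = levels n D
  total_eq : σ total 0 = levels n (D + 1)
  lim_eq : σ lim 0 = levels n (D + 2)

theorem Shape.congr {σ σ' : St Arr} (h : Shape n D σ)
    (hσ : ∀ a ∈ [Arr.n, cap, inner, total, lim], σ' a = σ a) : Shape n D σ' := by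
  simp only [List.mem_cons, List.not_mem_nil, or_false, forall_eq_or_imp, forall_eq] at hσ
  obtain ⟨h1, h2, h3, h4, h5⟩ := hσ
  exact ⟨by rw [h1, h.n_eq], by rw [h2, h.cap_eq], by rw [h3, h.inner_eq], by rw [h4, h.total_eq],
    by rw [h5, h.lim_eq]⟩

open Classical in
/-- The array `alive` describes the tree `T`. -/
def IsAlive (G : Arena S) (e : S ≃ Fin n) (D : ℕ) (T : List S → Prop) (σ : St Arr) : Prop :=
  ∀ k, σ alive k = if T (G.path e k) ∧ (G.path e k).length ≤ D + 1 then 1 else 0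

/-- The array `a` holds the values of `f` on the tree `T`. -/
def Holds (G : Arena S) (e : S ≃ Fin n) (D : ℕ) (T : List S → Prop) (f : List S → ℕ) (a : Arr)
    (σ : St Arr) : Prop :=
  ∀ k, T (G.path e k) → (G.path e k).length ≤ D + 1 → σ a k = f (G.path e k)

theorem forall_lt_succ_iff {t : ℕ} (ht : t < n) {p : Fin n → Prop} :
    (∀ s : Fin n, s.1 < t + 1 → p s) ↔ (∀ s : Fin n, s.1 < t → p s) ∧ p ⟨t, ht⟩ := by
  constructor
  · exact fun h => ⟨fun s hs => h s (by omega), h _ (Nat.lt_succ_self t)⟩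
  · rintro ⟨h1, h2⟩ s hs
    rcases Nat.lt_succ_iff_lt_or_eq.1 hs with h | h
    · exact h1 s h
    · obtain rfl : s = ⟨t, ht⟩ := Fin.ext h
      exact h2

omit [Fintype S] in
theorem forall_fin_iff (e : S ≃ Fin n) {p : S → Prop} :
    (∀ s : Fin n, s.1 < n → p (e.symm s)) ↔ ∀ s, p s :=
  ⟨fun h s => by simpa using h (e s) (e s).2, fun h s _ => h _⟩

theorem mem_kids_path (k : ℕ) (s : Fin n) :
    e.symm s ∈ kids T D (G.path e k) ↔
      T (G.path e (n * k + 1 + s)) ∧ (G.path e (n * k + 1 + s)).length ≤ D + 1 := by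
  rw [mem_kids, path_child, List.length_cons, Nat.add_le_add_iff_right]

open Classical in
theorem IsAlive.child {σ : St Arr} (h : IsAlive G e D T σ) (k : ℕ) (s : Fin n) :
    σ alive (n * k + 1 + s) = if e.symm s ∈ kids T D (G.path e k) then 1 else 0 := by
  rw [h]
  simp only [mem_kids_path]

/-- Correctness of backward induction on the tree `T`. -/
theorem run_backup {isMin : Ex Arr} {lf res : Arr} {q : List S → Prop} {leaf : List S → ℕ}
    {σ₀ : St Arr} (hsh : Shape n D σ₀) (hal : IsAlive G e D T σ₀) (hlf : Holds G e D T leaf lf σ₀)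
    (hres : ∀ a ∈ [lf, alive, Arr.n, cap, total, lim, cur, cb, c, s, agg, agg2, has], res ≠ a)
    (hlf' : ∀ a ∈ [agg, agg2, has, c, s, cur, cb], lf ≠ a)
    (hq : ∀ k σ, T (G.path e k) → (G.path e k).length ≤ D + 1 → σ own = σ₀ own → σ cur 0 = k →
      (isMin.eval σ ≠ 0 ↔ q (G.path e k)))
    (hres' : own ≠ res) :
    Holds G e D T (backup T D q leaf) res ((bottomUp (backupNode isMin lf res)).run σ₀) := by
  classical
  simp only [List.mem_cons, List.not_mem_nil, or_false, forall_eq_or_imp, forall_eq] at hres hlf'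
  obtain ⟨r1, r2, r3, r4, r5, r6, r7, r8, r9, r10, r11, r12, r13⟩ := hres
  obtain ⟨l1, l2, l3, l4, l5, l6, l7⟩ := hlf'
  have hmods : ∀ a, a ∉ (backupNode isMin lf res).mods ↔
      (a ≠ agg ∧ a ≠ agg2 ∧ a ≠ has ∧ a ≠ c ∧ a ≠ s ∧ a ≠ res) := by
    intro a
    simp [backupNode]
    tauto
  have key := run_bottomUp (node := backupNode isMin lf res) (σ₀ := σ₀) (k := levels n (D + 1))
    (by
      intro a ha
      rw [hmods]
      simp only [List.mem_cons, List.not_mem_nil, or_false] at ha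
      rcases ha with rfl | rfl | rfl <;> simp [r7.symm, r8.symm, r3.symm])
    hsh.total_eq (by rw [hsh.lim_eq, hsh.n_eq, levels])
    (fun j σ => ∀ k, j ≤ k → T (G.path e k) → (G.path e k).length ≤ D + 1 →
      σ res k = backup T D q leaf (G.path e k)) ?_ ?_ ?_
  · exact fun k => key k (Nat.zero_le k)
  · intro k hk _ hl
    rw [length_path_le_iff] at hl
    omega
  · intro j σ σ' h1 h2 k hk hT hl
    rw [h1 res r7 r8]
    exact h2 k hk hT hl
  · intro j σ hj hf hcur hcb hJ
    have hal' : σ alive = σ₀ alive := hf _ (by rw [hmods]; simp [r2.symm]) (by simp) (by simp)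
    have hn' : σ Arr.n 0 = n := by
      rw [hf _ (by rw [hmods]; simp [r3.symm]) (by simp) (by simp), hsh.n_eq]
    have hcap : σ cap 0 = D + 1 := by
      rw [hf _ (by rw [hmods]; simp [r4.symm]) (by simp) (by simp), hsh.cap_eq]
    have hown : σ own = σ₀ own := hf _ (by rw [hmods]; simp [hres']) (by simp) (by simp)
    rw [hsh.n_eq] at hcb
    have hlf2 : σ lf = σ₀ lf := hf _ (by rw [hmods]; exact ⟨l1, l2, l3, l4, l5, r1.symm⟩) l6 l7
    set body : Cmd Arr := .ite (.get alive (.reg c))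
      (block [assign agg (.min (.reg agg) (.get res (.reg c))),
        assign agg2 (.max (.reg agg2) (.get res (.reg c))), assign has 1])
      .skip with hbody
    have hbmods : ∀ a, a ∉ body.mods ↔ (a ≠ agg ∧ a ≠ agg2 ∧ a ≠ has) := by
      intro a; simp [hbody]
    set σ₁ := ((σ.upd agg 0 (D + 1)).upd agg2 0 0).upd has 0 0 with hσ₁
    have h1 : ∀ a, a ≠ agg → a ≠ agg2 → a ≠ has → σ₁ a = σ a := fun a h1 h2 h3 => by
      rw [hσ₁, St.upd_of_ne _ h3, St.upd_of_ne _ h2, St.upd_of_ne _ h1]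
    set B := backup T D q leaf with hB
    have inner := run_children (body := body) (σ₀ := σ₁) (k := n)
      (by
        intro a ha
        rw [hbmods]
        simp only [List.mem_cons, List.not_mem_nil, or_false] at ha
        rcases ha with rfl | rfl | rfl | rfl <;> simp)
      (by rw [h1 _ (by simp) (by simp) (by simp), hn'])
      (fun t τ =>
        (∀ x, x ≤ τ agg 0 ↔ x ≤ D + 1 ∧ ∀ s : Fin n, s.1 < t →
          e.symm s ∈ kids T D (G.path e j) → x ≤ B (e.symm s :: G.path e j)) ∧
        (∀ x, τ agg2 0 ≤ x ↔ ∀ s : Fin n, s.1 < t →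
          e.symm s ∈ kids T D (G.path e j) → B (e.symm s :: G.path e j) ≤ x) ∧
        (τ has 0 = 0 ↔ ∀ s : Fin n, s.1 < t → e.symm s ∉ kids T D (G.path e j))) ?_ ?_ ?_
    · set τ := (children body).run σ₁ with hτ
      obtain ⟨g1, g2, g3⟩ := inner
      have hτf : ∀ a, a ≠ agg → a ≠ agg2 → a ≠ has → a ≠ c → a ≠ s → τ a = σ a := by
        intro a a1 a2 a3 a4 a5
        rw [hτ, Cmd.run_of_notMem (by simp [hbmods, a1, a2, a3, a4, a5]), h1 a a1 a2 a3]
      have hrun : (backupNode isMin lf res).run σ =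
          (Cmd.ite (.reg has)
            (.ite isMin (.set res (.reg cur) (.reg agg)) (.set res (.reg cur) (.reg agg2)))
            (.set res (.reg cur) (.get lf (.reg cur)))).run τ := by
        simp [backupNode, hτ, hσ₁, hcap, hbody]
      have hcurτ : τ cur 0 = j := by
        rw [hτf _ (by simp) (by simp) (by simp) (by simp) (by simp), hcur]
      have hresτ : τ res = σ res := hτf _ r11 r12 r13 r9 r10
      have hlfτ : τ lf = σ lf := hτf _ l1 l2 l3 l4 l5
      have hownτ : τ own = σ₀ own := by
        rw [hτf _ (by simp) (by simp) (by simp) (by simp) (by simp), hown]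
      replace g3 := g3.trans (forall_fin_iff e (p := fun s => s ∉ kids T D (G.path e j)))
      replace g1 := fun x => (g1 x).trans (and_congr_right fun _ => forall_fin_iff e
        (p := fun s => s ∈ kids T D (G.path e j) → x ≤ B (s :: G.path e j)))
      replace g2 := fun x => (g2 x).trans (forall_fin_iff e
        (p := fun s => s ∈ kids T D (G.path e j) → B (s :: G.path e j) ≤ x))
      have upd_case : ∀ v, (T (G.path e j) → (G.path e j).length ≤ D + 1 → v = B (G.path e j)) →
          ∀ k, j ≤ k → T (G.path e k) → (G.path e k).length ≤ D + 1 →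
            (τ.upd res j v) res k = B (G.path e k) := by
        intro v hv k hk hT hl
        rw [St.upd_same]
        rcases Nat.eq_or_lt_of_le hk with rfl | hk
        · rw [Function.update_self]; exact hv hT hl
        · rw [Function.update_of_ne (by omega), hresτ]
          exact hJ k hk hT hl
      rw [hrun]
      intro k hk hT hl
      by_cases c1 : τ has 0 = 0
      · rw [Cmd.run_ite, if_pos (by simpa using c1)]
        simp only [Cmd.run_set, Ex.eval_reg, Ex.eval_get, hcurτ]
        refine upd_case _ (fun hT hl => ?_) k hk hT hl
        rw [hB, backup_of_empty (Finset.eq_empty_iff_forall_notMem.2 (g3.1 c1)), hlfτ, hlf2,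
          hlf j hT hl]
      · have hne : (kids T D (G.path e j)).Nonempty := by
          by_contra hcon
          rw [Finset.not_nonempty_iff_eq_empty] at hcon
          exact c1 (g3.2 (by simp [hcon]))
        rw [Cmd.run_ite, if_neg (by simpa using c1), Cmd.run_ite]
        by_cases c2 : isMin.eval τ = 0
        · rw [if_pos c2]
          simp only [Cmd.run_set, Ex.eval_reg, hcurτ]
          refine upd_case _ (fun hT hl => ?_) k hk hT hl
          have hnq : ¬ q (G.path e j) := by
            rw [← hq j τ hT hl hownτ hcurτ]; simpa using c2
          rw [hB, backup_of_nonempty hne, if_neg hnq]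
          refine eq_of_forall_ge_iff fun x => ?_
          rw [g2, Finset.sup_le_iff]
        · rw [if_neg c2]
          simp only [Cmd.run_set, Ex.eval_reg, hcurτ]
          refine upd_case _ (fun hT hl => ?_) k hk hT hl
          have hyq : q (G.path e j) := (hq j τ hT hl hownτ hcurτ).1 c2
          rw [hB, backup_of_nonempty hne, if_pos hyq]
          refine eq_of_forall_le_iff fun x => ?_
          rw [g1, Finset.le_fold_min]
    · refine ⟨fun x => ?_, fun x => ?_, ?_⟩
      · simp [hσ₁, St.upd_apply]
      · simp [hσ₁, St.upd_apply]
      · simp [hσ₁, St.upd_apply]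
    · rintro t τ τ' hτ ⟨g1, g2, g3⟩
      rw [hτ agg (by simp) (by simp), hτ agg2 (by simp) (by simp), hτ has (by simp) (by simp)]
      exact ⟨g1, g2, g3⟩
    · rintro t τ ht hτf hτs hτc ⟨g1, g2, g3⟩
      have hcb1 : σ₁ cb 0 = n * j + 1 := by rw [h1 _ (by simp) (by simp) (by simp), hcb]
      rw [hcb1] at hτc
      have hal2 : τ alive = σ₀ alive := by
        rw [hτf _ (by rw [hbmods]; simp) (by simp) (by simp), h1 _ (by simp) (by simp) (by simp),
          hal']
      have hres2 : τ res = σ res := by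
        rw [hτf _ (by rw [hbmods]; exact ⟨r11, r12, r13⟩) r9 r10, h1 _ r11 r12 r13]
      have halive := hal.child j ⟨t, ht⟩
      simp only [forall_lt_succ_iff ht]
      by_cases hk : e.symm ⟨t, ht⟩ ∈ kids T D (G.path e j)
      · rw [if_pos hk] at halive
        have hval : σ res (n * j + 1 + t) = B (e.symm ⟨t, ht⟩ :: G.path e j) := by
          have h2 := (mem_kids_path (G := G) j ⟨t, ht⟩).1 hk
          rw [← path_child]
          refine hJ _ ?_ h2.1 h2.2
          have : j ≤ n * j := Nat.le_mul_of_pos_left j (by omega)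
          omega
        have hrun : body.run τ = ((τ.upd agg 0 (min (τ agg 0) (B (e.symm ⟨t, ht⟩ :: G.path e j)))).upd
            agg2 0 (max (τ agg2 0) (B (e.symm ⟨t, ht⟩ :: G.path e j)))).upd has 0 1 := by
          simp [hbody, hτc, hal2, halive, St.upd_apply, hres2, hval, r11]
        rw [hrun]
        refine ⟨fun x => ?_, fun x => ?_, ?_⟩
        · simp only [St.upd_apply]
          simp [g1, hk]
          tauto
        · simp only [St.upd_apply]
          simp [g2, hk]
        · simp [St.upd_apply, hk]
      · rw [if_neg hk] at halive
        have hrun : body.run τ = τ := by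
          simp [hbody, hτc, hal2, halive]
        rw [hrun]
        refine ⟨fun x => ?_, fun x => ?_, ?_⟩
        · simp [g1, hk]
        · simp [g2, hk]
        · simp [g3, hk]

end RegretGame

namespace RegretGame

/-! ### Correctness of the computation of deviations -/

open Arr Cmd Arena

variable {S : Type} [Fintype S] {G : Arena S} {n : ℕ} {e : S ≃ Fin n} {D : ℕ} {T : List S → Prop}
  {i : Player}

/-- The array `own` holds the owners of the positions. -/
def IsOwner (G : Arena S) (e : S ≃ Fin n) (D : ℕ) (σ : St Arr) : Prop :=
  ∀ k, (G.path e k).length ≤ D + 1 → ∀ s π, G.path e k = s :: π → σ own k = (G.owner s).code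

omit [Fintype S] in
theorem IsOwner.eval_isOwn {σ : St Arr} (h : IsOwner G e D σ) {k : ℕ}
    (hl : (G.path e k).length ≤ D + 1) (hk : σ cur 0 = k) :
    (isOwn i).eval σ ≠ 0 ↔ G.Turn i (G.path e k) := by
  cases hp : G.path e k with
  | nil => exact absurd hp (G.path_ne_nil e k)
  | cons s π =>
    have h1 := h k hl s π hp
    rw [← hk] at h1
    rw [Turn]
    cases i <;> cases ho : G.owner s <;> rw [ho] at h1 <;>
      simp [isOwn, h1, Player.code]

open Classical in
theorem run_siblings {σ : St Arr} {j : ℕ} {s₀ : Fin n} (hn : σ Arr.n 0 = n)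
    (hcap : σ cap 0 = D + 1) (hcb : σ cb 0 = n * j + 1) (hs : σ s 0 = s₀)
    (hal : IsAlive G e D T σ) (hbest : Holds G e D T (G.best T D i) (.best i) σ)
    (hl : (G.path e j).length ≤ D) :
    (siblings i).run σ agg 0 =
      (Finset.univ.filter fun s'' => T (s'' :: G.path e j) ∧ s'' ≠ e.symm s₀).fold min (D + 1)
        fun s'' => G.best T D i (s'' :: G.path e j) := by
  set body : Cmd Arr := block [
      .ite (.get alive (.reg cc))
        (.ite ((.reg t - .reg s) + (.reg s - .reg t))
          (assign agg (.min (.reg agg) (.get (.best i) (.reg cc)))) .skip) .skip,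
      inc t 1, inc cc 1] with hbody
  set σ₁ := ((σ.upd agg 0 (D + 1)).upd t 0 0).upd cc 0 (n * j + 1) with hσ₁
  have hrun : (siblings i).run σ = (Cmd.rep Arr.n body).run σ₁ := by
    simp [siblings, hσ₁, hcap, hcb, St.upd_apply, hbody]
  have h1 : ∀ a, a ≠ agg → a ≠ t → a ≠ cc → σ₁ a = σ a := fun a h1 h2 h3 => by
    rw [hσ₁, St.upd_of_ne _ h3, St.upd_of_ne _ h2, St.upd_of_ne _ h1]
  rw [hrun]
  have key := Cmd.run_rep (a := Arr.n) (c := body) (σ₀ := σ₁) (k := n)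
    (by rw [h1 _ (by simp) (by simp) (by simp), hn])
    (fun u τ => τ t 0 = u ∧ τ cc 0 = n * j + 1 + u ∧
      ∀ x, x ≤ τ agg 0 ↔ x ≤ D + 1 ∧ ∀ s : Fin n, s.1 < u →
        T (e.symm s :: G.path e j) ∧ e.symm s ≠ e.symm s₀ →
          x ≤ G.best T D i (e.symm s :: G.path e j)) ?_ ?_
  · obtain ⟨-, -, g⟩ := key
    replace g := fun x => (g x).trans (and_congr_right fun _ => forall_fin_iff e
        (p := fun s => T (s :: G.path e j) ∧ s ≠ e.symm s₀ →
          x ≤ G.best T D i (s :: G.path e j)))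
    refine eq_of_forall_le_iff fun x => ?_
    rw [g, Finset.le_fold_min]
    simp
  · refine ⟨?_, ?_, fun x => ?_⟩ <;> simp [hσ₁, St.upd_apply]
  · rintro u τ hu hf ⟨g1, g2, g3⟩
    have hf' : ∀ a, a ≠ agg → a ≠ t → a ≠ cc → τ a = σ a := fun a a1 a2 a3 => by
      rw [hf a (by simp [hbody, a1, a2, a3]), h1 a a1 a2 a3]
    have hal' := hal.child j ⟨u, hu⟩
    simp only [mem_kids, hl, and_true] at hal'
    have hal2 : τ alive = σ alive := hf' _ (by simp) (by simp) (by simp)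
    have hb2 : τ (.best i) = σ (.best i) := hf' _ (by simp) (by simp) (by simp)
    have hs2 : τ s 0 = s₀ := by rw [hf' _ (by simp) (by simp) (by simp), hs]
    simp only [forall_lt_succ_iff hu]
    have hg : (u - (s₀ : ℕ)) + ((s₀ : ℕ) - u) = 0 ↔ e.symm ⟨u, hu⟩ = e.symm s₀ := by
      rw [e.symm.injective.eq_iff, Fin.ext_iff]; simp only; omega
    by_cases c1 : T (e.symm ⟨u, hu⟩ :: G.path e j)
    · rw [if_pos c1] at hal'
      by_cases c2 : e.symm ⟨u, hu⟩ = e.symm s₀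
      · have hb : body.run τ = (τ.upd t 0 (u + 1)).upd cc 0 (n * j + 1 + u + 1) := by
          simp only [hbody, run_block_cons, run_block_nil, run_ite, Ex.eval_get, Ex.eval_reg, g2,
            hal2, hal', Ex.eval_add, Ex.eval_sub, g1, hs2]
          rw [if_neg (by simp), if_pos (hg.2 c2)]
          simp [g2, g1, St.upd_apply]
        rw [hb]
        refine ⟨by simp [St.upd_apply], by simp [St.upd_apply, add_assoc], fun x => ?_⟩
        simp [St.upd_apply, g3, c2]
      · have hv : σ (.best i) (n * j + 1 + u) = G.best T D i (e.symm ⟨u, hu⟩ :: G.path e j) := by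
          have hp := G.path_child e j ⟨u, hu⟩
          rw [hbest _ (by rw [hp]; exact c1) (by rw [hp, List.length_cons]; omega), hp]
        have hg' := mt hg.1 c2
        have hb : body.run τ = ((τ.upd agg 0 (min (τ agg 0)
            (G.best T D i (e.symm ⟨u, hu⟩ :: G.path e j)))).upd t 0 (u + 1)).upd cc 0
              (n * j + 1 + u + 1) := by
          simp only [hbody, run_block_cons, run_block_nil, run_ite, Ex.eval_get, Ex.eval_reg, g2,
            hal2, hal', Ex.eval_add, Ex.eval_sub, g1, hs2]
          rw [if_neg (by simp), if_neg hg']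
          simp [g2, hb2, hv, g1, St.upd_apply]
        rw [hb]
        refine ⟨by simp [St.upd_apply], by simp [St.upd_apply, add_assoc], fun x => ?_⟩
        simp [St.upd_apply, g3, c2, c1]
        tauto
    · rw [if_neg c1] at hal'
      have hb : body.run τ = (τ.upd t 0 (u + 1)).upd cc 0 (n * j + 1 + u + 1) := by
        simp [hbody, g2, hal2, hal', g1, St.upd_apply]
      rw [hb]
      refine ⟨by simp [St.upd_apply], by simp [St.upd_apply, add_assoc], fun x => ?_⟩
      simp [St.upd_apply, g3, c1]

@[simp] theorem mods_siblings (i : Player) : (siblings i).mods = [agg, t, cc, agg, t, cc] := rfl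
@[simp] theorem mods_leafCmd (i : Player) (x : Ex Arr) : (leafCmd i x).mods = [lv i, lv i] := rfl

theorem run_leafCmd {σ : St Arr} {x : Ex Arr} {k : ℕ} (hx : x.eval σ = k)
    (hcap : σ cap 0 = D + 1) (hut : σ (ut i) k = G.util (D + 1) i (G.path e k))
    (hdev : σ (.dev i) k = G.dev T D i (G.path e k)) :
    (leafCmd i x).run σ = σ.upd (lv i) k (G.leafVal T D i (G.path e k)) := by
  rw [leafVal]
  simp only [leafCmd, run_ite, Ex.eval_sub, Ex.eval_reg, Ex.eval_get, hx, hcap, hut, run_set, hdev]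
  by_cases h : G.util (D + 1) i (G.path e k) ≤ D
  · rw [if_neg (by omega), if_pos h]
  · rw [if_pos (by omega), if_neg h]

/-- Correctness of the computation of the regrets of the histories: since parents come before their
children, the best deviation of a child is obtained from that of its parent. -/
theorem run_devPass {σ₀ : St Arr} (hsh : Shape n D σ₀) (hT : G.IsTree D T)
    (hal : IsAlive G e D T σ₀) (hown : IsOwner G e D σ₀)
    (hut : Holds G e D T (G.util (D + 1) i) (ut i) σ₀)
    (hbest : Holds G e D T (G.best T D i) (.best i) σ₀) :
    Holds G e D T (G.leafVal T D i) (lv i)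
      ((block [.set (.dev i) 0 (.reg cap), leafCmd i 0, topDown total (devNode i)]).run σ₀) := by
  classical
  have hn : 0 < n := (e G.init).pos
  set σ₁ := (σ₀.upd (.dev i) 0 (D + 1)).upd (lv i) 0 (G.leafVal T D i (G.path e 0)) with hσ₁
  have hrun : (block [.set (.dev i) 0 (.reg cap), leafCmd i 0, topDown total (devNode i)]).run σ₀ =
      (topDown total (devNode i)).run σ₁ := by
    simp only [run_block_cons, run_block_nil, run_set, Ex.eval_reg, hsh.cap_eq]
    rw [run_leafCmd (G := G) (e := e) (T := T) (D := D) (k := 0) rfl]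
    · rfl
    · rw [St.upd_of_ne _ (by simp), hsh.cap_eq]
    · rw [St.upd_of_ne _ (by simp)]
      exact hut 0 (by rw [path_zero]; exact hT.init) (by rw [path_zero]; simp)
    · rw [path_zero, dev_singleton]; simp [St.upd_apply]
  rw [hrun]
  have h1 : ∀ a, a ≠ .dev i → a ≠ lv i → σ₁ a = σ₀ a := fun a h1 h2 => by
    rw [hσ₁, St.upd_of_ne _ h2, St.upd_of_ne _ h1]
  have hmods : ∀ a, a ∉ (devNode i).mods ↔
      (a ≠ c ∧ a ≠ s ∧ a ≠ agg ∧ a ≠ t ∧ a ≠ cc ∧ a ≠ .dev i ∧ a ≠ lv i) := by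
    intro a
    simp [devNode]
    tauto
  have key := run_topDown (r := total) (node := devNode i) (σ₀ := σ₁) (k := levels n (D + 1))
    (by
      intro a ha
      rw [hmods]
      simp only [List.mem_cons, List.not_mem_nil, or_false] at ha
      rcases ha with rfl | rfl | rfl <;> simp)
    (by rw [h1 _ (by simp) (by simp), hsh.total_eq]) (by simp) (by simp)
    (fun j σ => ∀ k < n * j + 1, T (G.path e k) → (G.path e k).length ≤ D + 1 →
      σ (.dev i) k = G.dev T D i (G.path e k) ∧ σ (lv i) k = G.leafVal T D i (G.path e k)) ?_ ?_ ?_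
  · intro k hk hl
    refine (key k ?_ hk hl).2
    rw [length_path_le_iff] at hl
    have := Nat.le_mul_of_pos_left (levels n (D + 1)) hn
    omega
  · intro k hk _ _
    obtain rfl : k = 0 := by omega
    rw [path_zero, dev_singleton]
    simp [hσ₁, St.upd_apply, path_zero]
  · intro j σ σ' hf hJ
    rw [hf _ (by simp) (by simp), hf _ (by simp) (by simp)]
    exact hJ
  · intro j σ hj hf hcur hcb hJ
    have hn1 : σ₁ Arr.n 0 = n := by rw [h1 _ (by simp) (by simp), hsh.n_eq]
    rw [hn1] at hcb
    have hf' : ∀ a, a ≠ c → a ≠ s → a ≠ agg → a ≠ t → a ≠ cc → a ≠ .dev i → a ≠ lv i → a ≠ cur →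
        a ≠ cb → σ a = σ₀ a := by
      intro a a1 a2 a3 a4 a5 a6 a7 a8 a9
      rw [hf a ((hmods a).2 ⟨a1, a2, a3, a4, a5, a6, a7⟩) a8 a9, h1 a a6 a7]
    set body : Cmd Arr := block [siblings i,
      .ite (isOwn i) (.set (.dev i) (.reg c) (.min (.get (.dev i) (.reg cur)) (.reg agg)))
        (.set (.dev i) (.reg c) (.get (.dev i) (.reg cur))),
      leafCmd i (.reg c)] with hbody
    have hbmods : ∀ a, a ∉ body.mods ↔ (a ≠ agg ∧ a ≠ t ∧ a ≠ cc ∧ a ≠ .dev i ∧ a ≠ lv i) := by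
      intro a; simp [hbody]; tauto
    have key2 := run_children (body := body) (σ₀ := σ) (k := n)
      (by
        intro a ha
        rw [hbmods]
        simp only [List.mem_cons, List.not_mem_nil, or_false] at ha
        rcases ha with rfl | rfl | rfl | rfl <;> simp)
      (by rw [hf' _ (by simp) (by simp) (by simp) (by simp) (by simp) (by simp) (by simp) (by simp)
        (by simp), hsh.n_eq])
      (fun u τ => ∀ k < n * j + 1 + u, T (G.path e k) → (G.path e k).length ≤ D + 1 →
        τ (.dev i) k = G.dev T D i (G.path e k) ∧ τ (lv i) k = G.leafVal T D i (G.path e k))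
      ?_ ?_ ?_
    · intro k hk
      exact key2 k (by rw [Nat.mul_succ] at hk; omega)
    · simpa using hJ
    · intro u τ τ' hττ hJ'
      rw [hττ _ (by simp) (by simp), hττ _ (by simp) (by simp)]
      exact hJ'
    · intro u τ hu hτf hτs hτc hJ'
      rw [hcb] at hτc
      have hτ0 : ∀ a, a ≠ c → a ≠ s → a ≠ agg → a ≠ t → a ≠ cc → a ≠ .dev i → a ≠ lv i → a ≠ cur →
          a ≠ cb → τ a = σ₀ a := by
        intro a a1 a2 a3 a4 a5 a6 a7 a8 a9
        rw [hτf a ((hbmods a).2 ⟨a3, a4, a5, a6, a7⟩) a1 a2, hf' a a1 a2 a3 a4 a5 a6 a7 a8 a9]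
      have hτcur : τ cur 0 = j := by
        rw [hτf _ ((hbmods _).2 (by simp)) (by simp) (by simp), hcur]
      have hτcb : τ cb 0 = n * j + 1 := by
        rw [hτf _ ((hbmods _).2 (by simp)) (by simp) (by simp), hcb]
      have hτn : τ Arr.n 0 = n := by
        rw [hτ0 _ (by simp) (by simp) (by simp) (by simp) (by simp) (by simp) (by simp) (by simp)
          (by simp), hsh.n_eq]
      have hτcap : τ cap 0 = D + 1 := by
        rw [hτ0 _ (by simp) (by simp) (by simp) (by simp) (by simp) (by simp) (by simp) (by simp)
          (by simp), hsh.cap_eq]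
      have hτal : τ alive = σ₀ alive := hτ0 _ (by simp) (by simp) (by simp) (by simp) (by simp)
        (by simp) (by simp) (by simp) (by simp)
      have hτown : τ own = σ₀ own := hτ0 _ (by simp) (by simp) (by simp) (by simp) (by simp)
        (by simp) (by simp) (by simp) (by simp)
      have hτut : τ (ut i) = σ₀ (ut i) := hτ0 _ (by simp) (by simp) (by simp) (by simp) (by simp)
        (by simp) (by simp) (by simp) (by simp)
      have hτbest : τ (.best i) = σ₀ (.best i) := hτ0 _ (by simp) (by simp) (by simp) (by simp)
        (by simp) (by simp) (by simp) (by simp) (by simp)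
      have hp := G.path_child e j ⟨u, hu⟩
      simp only at hp
      -- the state after the computation of the best sibling
      set τ₁ := (siblings i).run τ with hτ₁
      have hτ1 : ∀ a, a ≠ agg → a ≠ t → a ≠ cc → τ₁ a = τ a := fun a a1 a2 a3 => by
        rw [hτ₁, run_of_notMem (by simp [a1, a2, a3])]
      have hτ1c : τ₁ c 0 = n * j + 1 + u := by rw [hτ1 _ (by simp) (by simp) (by simp), hτc]
      have hτ1cur : τ₁ cur 0 = j := by rw [hτ1 _ (by simp) (by simp) (by simp), hτcur]
      obtain ⟨v, hv, hvT⟩ : ∃ v, ((Cmd.ite (isOwn i)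
          (.set (.dev i) (.reg c) (.min (.get (.dev i) (.reg cur)) (.reg agg)))
          (.set (.dev i) (.reg c) (.get (.dev i) (.reg cur)))).run τ₁ =
            τ₁.upd (.dev i) (n * j + 1 + u) v) ∧ (T (G.path e (n * j + 1 + u)) →
              (G.path e (n * j + 1 + u)).length ≤ D + 1 →
                v = G.dev T D i (G.path e (n * j + 1 + u))) := by
        have hpar : T (G.path e (n * j + 1 + u)) → (G.path e (n * j + 1 + u)).length ≤ D + 1 →
            (G.path e j).length ≤ D ∧ T (G.path e j) ∧
              τ₁ (.dev i) j = G.dev T D i (G.path e j) := by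
          intro hTp hl
          rw [hp, List.length_cons] at hl
          have hTj : T (G.path e j) := by
            rw [hp] at hTp
            exact hT.of_suffix hTp (List.suffix_cons _ _) (G.path_ne_nil e j)
          refine ⟨by omega, hTj, ?_⟩
          rw [hτ1 _ (by simp) (by simp) (by simp)]
          have : j ≤ n * j := Nat.le_mul_of_pos_left j hn
          exact (hJ' j (by omega) hTj (by omega)).1
        have hdev : ∀ s π, G.path e j = s :: π → G.dev T D i (G.path e (n * j + 1 + u)) =
            min (G.dev T D i (G.path e j)) (if G.owner s = i then
              (Finset.univ.filter fun s'' => T (s'' :: G.path e j) ∧ s'' ≠ e.symm ⟨u, hu⟩).fold min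
                (D + 1) fun s'' => G.best T D i (s'' :: G.path e j) else D + 1) := by
          intro s π hs
          rw [hp, hs, Arena.dev]
        obtain ⟨s', π, hs'⟩ : ∃ s' π, G.path e j = s' :: π := by
          cases h : G.path e j with
          | nil => exact absurd h (G.path_ne_nil e j)
          | cons s' π => exact ⟨s', π, rfl⟩
        have hownj : (G.path e j).length ≤ D + 1 → ((isOwn i).eval τ₁ ≠ 0 ↔ G.owner s' = i) := by
          intro hl
          have h2 : IsOwner G e D τ₁ := by
            intro k hk; rw [hτ1 _ (by simp) (by simp) (by simp), hτown]; exact hown k hk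
          rw [h2.eval_isOwn hl hτ1cur, hs', Turn]
        by_cases c1 : (isOwn i).eval τ₁ = 0
        · refine ⟨τ₁ (.dev i) j, by simp [c1, hτ1c, hτ1cur], fun hTp hl => ?_⟩
          obtain ⟨h2, h3, h4⟩ := hpar hTp hl
          rw [hdev s' π hs', if_neg (fun h => (hownj (by omega)).2 h c1), h4,
            min_eq_left (dev_le_succ _)]
        · refine ⟨min (τ₁ (.dev i) j) (τ₁ agg 0), by simp [c1, hτ1c, hτ1cur], fun hTp hl => ?_⟩
          obtain ⟨h2, h3, h4⟩ := hpar hTp hl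
          rw [hdev s' π hs', if_pos ((hownj (by omega)).1 c1), h4, hτ₁,
            run_siblings (G := G) (e := e) (T := T) (D := D) (j := j) (s₀ := ⟨u, hu⟩) hτn hτcap
              hτcb hτs (by intro k; rw [hτal]; exact hal k)
              (by intro k hk hl; rw [hτbest]; exact hbest k hk hl) h2]
      have hbr : body.run τ = (leafCmd i (.reg c)).run (τ₁.upd (.dev i) (n * j + 1 + u) v) := by
        rw [← hv]; rfl
      intro k hk hTk hlk
      rcases Nat.lt_or_ge k (n * j + 1 + u) with hlt | hge
      · -- the values of other nodes are not affected
        have h2 : ∀ a, (a = .dev i ∨ a = lv i) → body.run τ a k = τ a k := by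
          intro a ha
          have ha' : a ≠ agg ∧ a ≠ t ∧ a ≠ cc := by rcases ha with rfl | rfl <;> simp
          have hx : (Ex.reg c).eval (τ₁.upd (.dev i) (n * j + 1 + u) v) = n * j + 1 + u := by
            rw [Ex.eval_reg, St.upd_of_ne _ (by simp), hτ1c]
          have h4 : τ₁.upd (.dev i) (n * j + 1 + u) v a k = τ a k := by
            rw [St.upd_apply, ← hτ1 a ha'.1 ha'.2.1 ha'.2.2]
            split_ifs with h5
            · subst h5; rw [Function.update_of_ne (by omega)]
            · rfl
          rw [hbr, leafCmd, run_ite]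
          split_ifs
          all_goals
            rw [run_set, hx, St.upd_apply]
            split_ifs with h3
            · subst h3; rw [Function.update_of_ne (by omega)]; exact h4
            · exact h4
        rw [h2 _ (Or.inl rfl), h2 _ (Or.inr rfl)]
        exact hJ' k hlt hTk hlk
      · obtain rfl : k = n * j + 1 + u := by omega
        rw [hbr, run_leafCmd (G := G) (e := e) (T := T) (D := D) (k := n * j + 1 + u)]
        · refine ⟨?_, ?_⟩
          · rw [St.upd_of_ne _ (by simp), St.upd_same, Function.update_self]; exact hvT hTk hlk
          · rw [St.upd_same, Function.update_self]
        · rw [Ex.eval_reg, St.upd_of_ne _ (by simp), hτ1c]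
        · rw [St.upd_of_ne _ (by simp), hτ1 _ (by simp) (by simp) (by simp), hτcap]
        · rw [St.upd_of_ne _ (by simp), hτ1 _ (by simp) (by simp) (by simp), hτut]
          exact hut _ hTk hlk
        · rw [St.upd_same, Function.update_self]; exact hvT hTk hlk

end RegretGame

namespace RegretGame

/-! ### Correctness of a round -/

open Arr Cmd Arena

variable {S : Type} [Fintype S] {G : Arena S} {n : ℕ} {e : S ≃ Fin n} {D : ℕ} {T : List S → Prop}
  {i : Player}

/-- What the rounds of the iteration use: the current tree, and the data that do not depend on
it. -/
structure Ready (G : Arena S) (e : S ≃ Fin n) (D : ℕ) (T : List S → Prop) (σ : St Arr) : Prop where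
  shape : Shape n D σ
  alive : IsAlive G e D T σ
  owner : IsOwner G e D σ
  util : ∀ i, Holds G e D G.IsPlay (G.util (D + 1) i) (ut i) σ

omit [Fintype S] in
theorem Ready.congr {σ σ' : St Arr} (h : Ready G e D T σ)
    (h1 : ∀ a ∈ [Arr.n, cap, inner, total, lim], σ' a = σ a) (h2 : σ' Arr.alive = σ Arr.alive)
    (h3 : σ' own = σ own) (h4 : ∀ i, σ' (ut i) = σ (ut i)) : Ready G e D T σ' where
  shape := h.shape.congr h1
  alive k := by rw [h2]; exact h.alive k
  owner k := by rw [h3]; exact h.owner k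
  util i k := by rw [h4]; exact h.util i k

theorem notMem_mods_evalPass {a : Arr} (h : ∀ j, a ≠ best j ∧ a ≠ .dev j ∧ a ≠ lv j)
    (hv : a ≠ val i) (ha : a ∉ [cur, cb, c, s, cc, t, agg, agg2, has]) :
    a ∉ (evalPass i).mods := by
  obtain ⟨h1, h2, h3⟩ := h i
  simp only [List.mem_cons, List.not_mem_nil, or_false, not_or] at ha
  obtain ⟨a1, a2, a3, a4, a5, a6, a7, a8, a9⟩ := ha
  simp [evalPass, backupNode, devNode, h1, h2, h3, hv, a1, a2, a3, a4, a5, a6, a7, a8, a9]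

omit [Fintype S] in
theorem Ready.evalPass {σ : St Arr} (h : Ready G e D T σ) (i : Player) :
    Ready G e D T ((evalPass i).run σ) := by
  refine h.congr (fun a ha => ?_) ?_ ?_ fun j => ?_
  · simp only [List.mem_cons, List.not_mem_nil, or_false] at ha
    rcases ha with rfl | rfl | rfl | rfl | rfl <;>
      exact run_of_notMem (notMem_mods_evalPass (by simp) (by simp) (by simp)) σ
  all_goals exact run_of_notMem (notMem_mods_evalPass (by simp) (by simp) (by simp)) σ

theorem run_evalPass {σ : St Arr} (hT : G.IsTree D T) (h : Ready G e D T σ) (i : Player) :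
    Holds G e D T (G.val T D i) (val i) ((evalPass i).run σ) := by
  have hut : Holds G e D T (G.util (D + 1) i) (ut i) σ := fun k hk => h.util i k (hT.isPlay hk)
  set p₁ := bottomUp (backupNode 1 (ut i) (best i)) with hp₁
  set p₂ := block [.set (.dev i) 0 (.reg cap), leafCmd i 0, topDown total (devNode i)] with hp₂
  set p₃ := bottomUp (backupNode (isOwn i) (lv i) (val i)) with hp₃
  have hrun : (evalPass i).run σ = p₃.run (p₂.run (p₁.run σ)) := rfl
  have hbest : Holds G e D T (G.best T D i) (best i) (p₁.run σ) :=
    run_backup h.shape h.alive hut (by simp) (by simp) (by simp) (by simp)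
  have h1 : Ready G e D T (p₁.run σ) := by
    refine h.congr (fun a ha => ?_) ?_ ?_ fun j => ?_
    · simp only [List.mem_cons, List.not_mem_nil, or_false] at ha
      rcases ha with rfl | rfl | rfl | rfl | rfl <;>
        exact run_of_notMem (by simp [hp₁, backupNode]) σ
    all_goals exact run_of_notMem (by simp [hp₁, backupNode]) σ
  have hlv : Holds G e D T (G.leafVal T D i) (lv i) (p₂.run (p₁.run σ)) :=
    run_devPass h1.shape hT h1.alive h1.owner (fun k hk => h1.util i k (hT.isPlay hk)) hbest
  have h2 : Ready G e D T (p₂.run (p₁.run σ)) := by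
    refine h1.congr (fun a ha => ?_) ?_ ?_ fun j => ?_
    · simp only [List.mem_cons, List.not_mem_nil, or_false] at ha
      rcases ha with rfl | rfl | rfl | rfl | rfl <;>
        exact run_of_notMem (by simp [hp₂, devNode]) _
    all_goals exact run_of_notMem (by simp [hp₂, devNode]) _
  rw [hrun]
  refine run_backup h2.shape h2.alive hlv (by simp) (by simp) (fun k τ _ hl hown hcur => ?_)
    (by simp)
  have h3 : IsOwner G e D τ := by intro k; rw [hown]; exact h2.owner k
  exact h3.eval_isOwn hl hcur

@[simp] theorem mods_pruneNode : pruneNode.mods = [c, s, alive, alive, s, c] := rfl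

/-- Correctness of pruning.  Parents come before their children, so that the entry of `alive` for the
parent is already that of the pruned tree. -/
theorem run_prune {σ₀ : St Arr} (hT : G.IsTree D T) (hsh : Shape n D σ₀)
    (hal : IsAlive G e D T σ₀) (hval : ∀ i, Holds G e D T (G.val T D i) (val i) σ₀) :
    IsAlive G e D (G.prune D T) ((topDown total pruneNode).run σ₀) := by
  classical
  have hn : 0 < n := (e G.init).pos
  have key := run_topDown (r := total) (node := pruneNode) (σ₀ := σ₀) (k := levels n (D + 1))
    (by simp) hsh.total_eq (by simp) (by simp)
    (fun j σ => ∀ k, σ alive k = if (if k < n * j + 1 then G.prune D T (G.path e k)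
      else T (G.path e k)) ∧ (G.path e k).length ≤ D + 1 then 1 else 0) ?_ ?_ ?_
  · intro k
    rw [key]
    congr 1
    refine propext (and_congr_left fun hl => ?_)
    rw [if_pos]
    rw [length_path_le_iff] at hl
    have := Nat.le_mul_of_pos_left (levels n (D + 1)) hn
    omega
  · intro k
    rw [hal k]
    congr 1
    refine propext (and_congr_left fun hl => ?_)
    split_ifs with h0
    · obtain rfl : k = 0 := by omega
      rw [path_zero]
      exact iff_of_true hT.init (isTree_prune hT).init
    · rfl
  · intro j σ σ' hf hJ k
    rw [hf _ (by simp) (by simp)]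
    exact hJ k
  · intro j σ hj hf hcur hcb hJ
    rw [hsh.n_eq] at hcb
    set body : Cmd Arr := .ite (.get alive (.reg c))
      (.ite (.get alive (.reg cur))
        (.ite ((.get (val .one) (.reg c) - .get (val .one) 0) +
            (.get (val .two) (.reg c) - .get (val .two) 0))
          (.set alive (.reg c) 0) .skip)
        (.set alive (.reg c) 0))
      .skip with hbody
    have hbmods : body.mods = [alive, alive] := rfl
    have key2 := run_children (body := body) (σ₀ := σ) (k := n) (by simp [hbmods])
      (by rw [hf _ (by simp) (by simp) (by simp), hsh.n_eq])
      (fun u τ => ∀ k, τ alive k = if (if k < n * j + 1 + u then G.prune D T (G.path e k)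
        else T (G.path e k)) ∧ (G.path e k).length ≤ D + 1 then 1 else 0) hJ ?_ ?_
    · intro k
      have e1 : n * (j + 1) + 1 = n * j + 1 + n := by rw [Nat.mul_succ]; omega
      rw [e1]
      exact key2 k
    · intro u τ τ' hττ hJ' k
      rw [hττ _ (by simp) (by simp)]
      exact hJ' k
    · intro u τ hu hτf hτs hτc hJ'
      rw [hcb] at hτc
      have hτcur : τ cur 0 = j := by rw [hτf _ (by simp [hbmods]) (by simp) (by simp), hcur]
      have hτv : ∀ i, τ (val i) = σ₀ (val i) := fun i => by
        rw [hτf _ (by simp [hbmods]) (by simp) (by simp), hf _ (by simp) (by simp) (by simp)]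
      have hroot : ∀ i, σ₀ (val i) 0 = G.val T D i [G.init] := fun i => by
        rw [hval i 0 (by rw [path_zero]; exact hT.init) (by rw [path_zero]; simp), path_zero]
      have hj : j ≤ n * j := Nat.le_mul_of_pos_left j hn
      have hp := G.path_child e j ⟨u, hu⟩
      simp only at hp
      have hc := hJ' (n * j + 1 + u)
      simp only [lt_irrefl, if_false] at hc
      have hpar := hJ' j
      simp only [show j < n * j + 1 + u by omega, if_true] at hpar
      obtain ⟨s', π, hs'⟩ : ∃ s' π, G.path e j = s' :: π := by
        cases h : G.path e j with
        | nil => exact absurd h (G.path_ne_nil e j)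
        | cons s' π => exact ⟨s', π, rfl⟩
      have hpr := prune_cons (G := G) (D := D) (T := T) (s' := e.symm ⟨u, hu⟩) (s := s') (π := π)
      rw [← hs', ← hp] at hpr
      -- only the cell of the child changes
      suffices H : body.run τ alive = Function.update (τ alive) (n * j + 1 + u)
          (if G.prune D T (G.path e (n * j + 1 + u)) ∧
            (G.path e (n * j + 1 + u)).length ≤ D + 1 then 1 else 0) by
        intro k
        rw [H]
        by_cases hk : k = n * j + 1 + u
        · subst hk
          simp only [Function.update_self, show n * j + 1 + u < n * j + 1 + (u + 1) by omega, if_true]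
        · rw [Function.update_of_ne hk, hJ' k]
          simp only [show k < n * j + 1 + (u + 1) ↔ k < n * j + 1 + u by omega]
      by_cases c1 : T (G.path e (n * j + 1 + u)) ∧ (G.path e (n * j + 1 + u)).length ≤ D + 1
      · rw [if_pos c1] at hc
        have hl : (G.path e j).length ≤ D + 1 := by
          have := c1.2; rw [hp, List.length_cons] at this; omega
        by_cases c2 : G.prune D T (G.path e j)
        · rw [if_pos ⟨c2, hl⟩] at hpar
          have hv : ∀ i, τ (val i) (n * j + 1 + u) - τ (val i) 0 = 0 ↔
              G.val T D i (G.path e (n * j + 1 + u)) ≤ G.val T D i [G.init] := fun i => by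
            rw [hτv, hval i _ c1.1 c1.2, hroot, Nat.sub_eq_zero_iff_le]
          have hg : (τ (val .one) (n * j + 1 + u) - τ (val .one) 0) +
              (τ (val .two) (n * j + 1 + u) - τ (val .two) 0) = 0 ↔
                G.prune D T (G.path e (n * j + 1 + u)) := by
            rw [Nat.add_eq_zero_iff, hv, hv, hpr]
            constructor
            · rintro ⟨h1, h2⟩
              exact ⟨c1.1, c2, fun _ i => by cases i <;> assumption⟩
            · rintro ⟨-, -, h⟩
              have := h (by have := c1.2; rw [hp, List.length_cons] at this; omega)
              exact ⟨this .one, this .two⟩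
          have hb : body.run τ = if G.prune D T (G.path e (n * j + 1 + u)) then τ
              else τ.upd alive (n * j + 1 + u) 0 := by
            simp only [hbody, run_ite, Ex.eval_get, Ex.eval_reg, Ex.eval_add, Ex.eval_sub, hτc,
              hτcur, hc, hpar, Ex.eval_ofNat, hg, run_skip, run_set]
            simp
          rw [hb]
          split_ifs with h1 h2 h2
          · exact (Function.update_eq_self_iff.2 hc.symm).symm
          · exact absurd ⟨h1, c1.2⟩ h2
          · exact absurd h2.1 h1
          · rw [St.upd_same]
        · rw [if_neg fun h => c2 h.1] at hpar
          rw [if_neg fun h => c2 (hpr.1 h.1).2.1]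
          simp [hbody, hτc, hτcur, hc, hpar, St.upd_apply]
      · rw [if_neg c1] at hc
        rw [if_neg fun h => c1 ⟨prune_le h.1, h.2⟩]
        have hb : body.run τ = τ := by simp [hbody, hτc, hc]
        rw [hb]
        exact (Function.update_eq_self_iff.2 hc.symm).symm

theorem run_roundCmd {σ : St Arr} (hT : G.IsTree D T) (h : Ready G e D T σ) :
    Ready G e D (G.prune D T) (roundCmd.run σ) := by
  have hrun : roundCmd.run σ =
      (topDown total pruneNode).run ((evalPass .two).run ((evalPass .one).run σ)) := rfl
  have h1 := run_evalPass hT h .one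
  have h2 := run_evalPass hT (h.evalPass .one) .two
  have h3 := (h.evalPass .one).evalPass .two
  set τ := (evalPass .two).run ((evalPass .one).run σ) with hτ
  have hv : ∀ i, Holds G e D T (G.val T D i) (val i) τ := by
    intro i
    cases i with
    | one =>
      intro k
      rw [hτ, run_of_notMem (notMem_mods_evalPass (by simp) (by simp) (by simp))]
      exact h1 k
    | two => exact h2
  rw [hrun]
  refine ⟨h3.shape.congr fun a ha => ?_, run_prune hT h3.shape h3.alive hv, fun k => ?_,
    fun i k => ?_⟩
  · simp only [List.mem_cons, List.not_mem_nil, or_false] at ha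
    rcases ha with rfl | rfl | rfl | rfl | rfl <;> exact run_of_notMem (by simp) _
  · rw [run_of_notMem (by simp)]; exact h3.owner k
  · rw [run_of_notMem (by simp)]; exact h3.util i k

end RegretGame

namespace RegretGame

open Arr Cmd Arena

/-! ### The initial tree -/

@[simp] theorem eval_triple (x : Ex Arr) (σ : St Arr) : (triple x).eval σ = 3 * x.eval σ := by
  simp only [triple, Ex.eval_add]; omega

@[simp] theorem eval_shift (i : Player) (σ : St Arr) : (shift i).eval σ = i.code + 1 := by
  cases i <;> rfl

variable {S : Type} [Fintype S] [DecidableEq S] {G : Arena S} {n : ℕ} {e : S ≃ Fin n} {D : ℕ}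
  {i : Player}

/-- The array `inp` holds the description of the arena. -/
def IsInput (G : Arena S) (e : S ≃ Fin n) (σ : St Arr) : Prop :=
  ∀ k, σ inp k = (G.encode e).getD k 0

open Classical in
/-- The arrays have been initialized for the node `k`. -/
structure NodeReady (G : Arena S) (e : S ≃ Fin n) (D : ℕ) (k : ℕ) (σ : St Arr) : Prop where
  alive : σ alive k = if G.IsPlay (G.path e k) then 1 else 0
  owner : ∀ s π, G.path e k = s :: π → σ own k = (G.owner s).code
  row : ∀ s π, G.path e k = s :: π → σ row k = 2 + 3 * n + 3 * n * (e s : ℕ)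
  weight : G.IsPlay (G.path e k) → ∀ i, σ (wt i) k = G.pathWeight i (G.path e k)
  util : G.IsPlay (G.path e k) → ∀ i, σ (ut i) k = G.util (D + 1) i (G.path e k)

omit [Fintype S] [DecidableEq S] in
theorem NodeReady.congr {k : ℕ} {σ σ' : St Arr} (h : NodeReady G e D k σ)
    (h1 : σ' Arr.alive k = σ Arr.alive k) (h2 : σ' own k = σ own k) (h3 : σ' Arr.row k = σ Arr.row k)
    (h4 : ∀ i, σ' (wt i) k = σ (wt i) k) (h5 : ∀ i, σ' (ut i) k = σ (ut i) k) :
    NodeReady G e D k σ' where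
  alive := by rw [h1, h.alive]
  owner := by rw [h2]; exact h.owner
  row := by rw [h3]; exact h.row
  weight hp i := by rw [h4, h.weight hp]
  util hp i := by rw [h5, h.util hp]

@[simp] theorem mods_setupPlayer (i : Player) : (setupPlayer i).mods = [wt i, ut i, ut i] := rfl

theorem run_setupPlayer {σ : St Arr} {k j u r : ℕ} {t : Prop} [Decidable t] (hc : σ c 0 = k)
    (hcur : σ cur 0 = j) (hs : σ s 0 = u) (hrow : σ row j = r)
    (ht : σ inp (2 + 3 * u + (i.code + 1)) = if t then 1 else 0) :
    (setupPlayer i).run σ =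
      (σ.upd (wt i) k (σ (wt i) j + σ inp (r + 3 * u + (i.code + 1)))).upd (ut i) k
        (if t then min (σ (ut i) j) (σ (wt i) j + σ inp (r + 3 * u + (i.code + 1)))
          else σ (ut i) j) := by
  by_cases h : t
  · rw [if_pos h] at ht
    simp [setupPlayer, hc, hcur, hs, hrow, ht, h, St.upd_apply]
  · rw [if_neg h] at ht
    simp [setupPlayer, hc, hcur, hs, hrow, ht, h, St.upd_apply]

@[simp] theorem mods_setupChild : setupChild.mods = [own, row, ro, alive, wt .one, ut .one, ut .one,
    wt .two, ut .two, ut .two] := rfl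

omit [Fintype S] in
theorem run_setupChild {σ : St Arr} {j : ℕ} {u : Fin n} (hinp : IsInput G e σ)
    (hn : σ Arr.n 0 = n) (hcur : σ cur 0 = j)
    (hs : σ s 0 = u) (hc : σ c 0 = n * j + 1 + u) (hro : σ ro 0 = 2 + 3 * n + 3 * n * (u : ℕ))
    (hj : NodeReady G e D j σ) (hal : σ alive (n * j + 1 + u) = 0) :
    NodeReady G e D (n * j + 1 + u) (setupChild.run σ) ∧
      (∀ k, k ≠ n * j + 1 + u → ∀ a, a ≠ ro → setupChild.run σ a k = σ a k) ∧
      setupChild.run σ ro 0 = 2 + 3 * n + 3 * n * ((u : ℕ) + 1) := by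
  classical
  have hp := G.path_child e j u
  obtain ⟨s', π, hs'⟩ : ∃ s' π, G.path e j = s' :: π := by
    cases h : G.path e j with
    | nil => exact absurd h (G.path_ne_nil e j)
    | cons s' π => exact ⟨s', π, rfl⟩
  set k₀ := n * j + 1 + (u : ℕ) with hk₀
  have hne : j ≠ k₀ := by
    have := Nat.le_mul_of_pos_left j (Nat.zero_lt_of_lt u.2)
    omega
  have hrow := hj.row s' π hs'
  set r := 2 + 3 * n + 3 * n * (e s' : ℕ) with hr
  have hplay : G.IsPlay (G.path e k₀) ↔ (s', e.symm u) ∈ G.edges ∧ G.IsPlay (G.path e j) := by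
    rw [hp, hs']; exact isPlay_cons
  have hedge : σ inp (r + 3 * u) = if (s', e.symm u) ∈ G.edges then 1 else 0 := by
    rw [hinp, hr, encode_isEdge, Equiv.symm_apply_apply]
  set σ₁ := ((σ.upd own k₀ (σ inp (2 + 3 * u))).upd row k₀ (σ ro 0)).upd ro 0
    (σ ro 0 + 3 * n) with hσ₁
  set σ₂ := σ₁.upd alive k₀ (if G.IsPlay (G.path e k₀) then 1 else 0) with hσ₂
  have hrun : setupChild.run σ = (setupPlayer .two).run ((setupPlayer .one).run σ₂) := by
    have h1 : setupChild.run σ = (setupPlayer .two).run ((setupPlayer .one).run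
        ((Cmd.ite (.get alive (.reg cur))
          (.ite (.get inp (.get row (.reg cur) + triple (.reg s))) (.set alive (.reg c) 1) .skip)
          .skip).run σ₁)) := by
      have h0 : (block [.set own (.reg c) (.get inp (2 + triple (.reg s))),
          .set row (.reg c) (.reg ro), inc ro (triple (.reg Arr.n))]).run σ = σ₁ := by
        simp [hσ₁, hc, hs, hn, St.upd_apply]
      rw [← h0]; rfl
    rw [h1]
    congr 2
    have e1 : σ₁ alive = σ alive := by simp [hσ₁, St.upd_apply]
    have e2 : σ₁ inp = σ inp := by simp [hσ₁, St.upd_apply]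
    have e3 : σ₁ row j = r := by simp [hσ₁, St.upd_apply, hne, hrow]
    have e4 : σ₁ cur 0 = j := by simp [hσ₁, St.upd_apply, hcur]
    have e5 : σ₁ s 0 = u := by simp [hσ₁, St.upd_apply, hs]
    have e6 : σ₁ c 0 = k₀ := by simp [hσ₁, St.upd_apply, hc]
    have hskip : (¬ G.IsPlay (G.path e k₀)) → σ₁ = σ₂ := by
      intro h
      rw [hσ₂, if_neg h, St.upd_eq_self (by rw [e1, hal])]
    simp only [run_ite, Ex.eval_get, Ex.eval_reg, e1, e2, e4, hj.alive, Ex.eval_add, e3, eval_triple,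
      e5, hedge, run_set, e6, Ex.eval_ofNat, run_skip]
    by_cases h2 : G.IsPlay (G.path e j)
    · by_cases h3 : (s', e.symm u) ∈ G.edges
      · rw [if_neg (by simp [h2]), if_neg (by simp [h3]), hσ₂, if_pos (hplay.2 ⟨h3, h2⟩)]
      · rw [if_neg (by simp [h2]), if_pos (by simp [h3])]
        exact hskip fun h => h3 (hplay.1 h).1
    · rw [if_pos (by simp [h2])]
      exact hskip fun h => h2 (hplay.1 h).2
  have e2 : σ₂ inp = σ inp := by simp [hσ₂, hσ₁, St.upd_apply]
  have ew : ∀ i, σ₂ (wt i) = σ (wt i) := by simp [hσ₂, hσ₁, St.upd_apply]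
  have eu : ∀ i, σ₂ (ut i) = σ (ut i) := by simp [hσ₂, hσ₁, St.upd_apply]
  have etar : ∀ i : Player, σ inp (2 + 3 * u + (i.code + 1)) =
      if e.symm u ∈ G.target i then 1 else 0 := fun i => by rw [hinp, encode_target]
  set w : Player → ℕ := fun i => σ (wt i) j + σ inp (r + 3 * u + (i.code + 1)) with hw
  set x : Player → ℕ := fun i =>
    if e.symm u ∈ G.target i then min (σ (ut i) j) (w i) else σ (ut i) j with hx
  have hfin : setupChild.run σ = (((σ₂.upd (wt .one) k₀ (w .one)).upd (ut .one) k₀ (x .one)).upd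
      (wt .two) k₀ (w .two)).upd (ut .two) k₀ (x .two) := by
    rw [hrun]
    have e3 : σ₂ row j = r := by simp [hσ₂, hσ₁, St.upd_apply, hne, hrow]
    have e4 : σ₂ cur 0 = j := by simp [hσ₂, hσ₁, St.upd_apply, hcur]
    have e5 : σ₂ s 0 = u := by simp [hσ₂, hσ₁, St.upd_apply, hs]
    have e6 : σ₂ c 0 = k₀ := by simp [hσ₂, hσ₁, St.upd_apply, hc]
    rw [run_setupPlayer (i := .one) (t := e.symm u ∈ G.target .one) e6 e4 e5 e3
        (by rw [e2]; exact etar .one),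
      run_setupPlayer (i := .two) (t := e.symm u ∈ G.target .two) (k := k₀) (j := j) (u := u)
        (r := r)]
    · simp [St.upd_apply, e2, ew, eu, hw, hx]
    · simp [St.upd_apply, e6]
    · simp [St.upd_apply, e4]
    · simp [St.upd_apply, e5]
    · simp [St.upd_apply, e3]
    · simpa [St.upd_apply, e2] using etar .two
  have hW : ∀ i, setupChild.run σ (wt i) k₀ = w i := by
    intro i; rw [hfin]; cases i <;> simp [St.upd_apply]
  have hU : ∀ i, setupChild.run σ (ut i) k₀ = x i := by
    intro i; rw [hfin]; cases i <;> simp [St.upd_apply]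
  have hw' : G.IsPlay (G.path e k₀) → ∀ i, w i = G.pathWeight i (G.path e k₀) := by
    intro h i
    obtain ⟨h1, h2⟩ := hplay.1 h
    have h3 := G.encode_weight e (k := e s') (l := u) (by simpa using h1) i
    rw [hw, hp, hs', pathWeight_cons, ← hs', ← hj.weight h2]
    simp only
    rw [hinp, hr, h3, Equiv.symm_apply_apply]
  refine ⟨⟨?_, ?_, ?_, ?_, ?_⟩, ?_, ?_⟩
  · rw [hfin]; simp [St.upd_apply, hσ₂]
  · intro s π h
    rw [hp] at h
    obtain ⟨rfl, -⟩ := List.cons.inj h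
    rw [hfin]
    simpa [St.upd_apply, hσ₂, hσ₁, hinp _] using G.encode_owner e u
  · intro s π h
    rw [hp] at h
    obtain ⟨rfl, -⟩ := List.cons.inj h
    rw [hfin]
    simp [St.upd_apply, hσ₂, hσ₁, hro]
  · intro h i
    rw [hW, hw' h]
  · intro h i
    rw [hU, hp, Arena.util, ← hp, ← hw' h, ← hj.util (hplay.1 h).2]
    simp only [hx]
    split_ifs
    · rfl
    · rw [min_eq_left]
      rw [hj.util (hplay.1 h).2]
      exact util_le _ _
  · intro k hk a ha
    rw [hfin]
    rw [St.upd_of_ne_idx _ _ hk, St.upd_of_ne_idx _ _ hk, St.upd_of_ne_idx _ _ hk, St.upd_of_ne_idx _ _ hk,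
      hσ₂, St.upd_of_ne_idx _ _ hk, hσ₁, St.upd_of_ne _ ha, St.upd_of_ne_idx _ _ hk,
      St.upd_of_ne_idx _ _ hk]
  · rw [hfin]
    simp [hσ₂, hσ₁, St.upd_apply, hro]
    ring

end RegretGame

namespace RegretGame

open Arr Cmd Arena

variable {S : Type} [Fintype S] [DecidableEq S] {G : Arena S} {n : ℕ} {e : S ≃ Fin n} {D : ℕ}
  {i : Player}

/-- The arrays have been initialized for the first `K` nodes. -/
def ReadyBelow (G : Arena S) (e : S ≃ Fin n) (D : ℕ) (K : ℕ) (σ : St Arr) : Prop :=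
  (∀ k < K, NodeReady G e D k σ) ∧ ∀ k ≥ K, σ alive k = 0

omit [Fintype S] [DecidableEq S] in
theorem ReadyBelow.congr {K : ℕ} {σ σ' : St Arr} (h : ReadyBelow G e D K σ)
    (h1 : σ' Arr.alive = σ Arr.alive) (h2 : σ' own = σ own) (h3 : σ' Arr.row = σ Arr.row)
    (h4 : ∀ i, σ' (wt i) = σ (wt i)) (h5 : ∀ i, σ' (ut i) = σ (ut i)) :
    ReadyBelow G e D K σ' :=
  ⟨fun k hk => (h.1 k hk).congr (by rw [h1]) (by rw [h2]) (by rw [h3]) (fun i => by rw [h4])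
    (fun i => by rw [h5]), fun k hk => by rw [h1]; exact h.2 k hk⟩

@[simp] theorem mods_setupNode : setupNode.mods = [ro] ++ ([c, s] ++ (setupChild.mods ++ [s, c])) := by
  simp [setupNode]

theorem run_setupNode {σ : St Arr} {j : ℕ} (hinp : IsInput G e σ) (hn : σ Arr.n 0 = n)
    (hcur : σ cur 0 = j) (hcb : σ cb 0 = n * j + 1) (h : ReadyBelow G e D (n * j + 1) σ) :
    ReadyBelow G e D (n * (j + 1) + 1) (setupNode.run σ) := by
  have hn0 : 0 < n := (e G.init).pos
  set σ₁ := σ.upd ro 0 (2 + 3 * n) with hσ₁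
  have h1 : ∀ a, a ≠ ro → σ₁ a = σ a := fun a ha => by rw [hσ₁, St.upd_of_ne _ ha]
  have hrun : setupNode.run σ = (children setupChild).run σ₁ := by
    simp [setupNode, hσ₁, hn]
  have key := run_children (body := setupChild) (σ₀ := σ₁) (k := n) (by simp)
    (by rw [h1 _ (by simp), hn])
    (fun u τ => ReadyBelow G e D (n * j + 1 + u) τ ∧ τ ro 0 = 2 + 3 * n + 3 * n * u) ?_ ?_ ?_
  · rw [hrun, show n * (j + 1) + 1 = n * j + 1 + n by rw [Nat.mul_succ]; omega]
    exact key.1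
  · refine ⟨h.congr ?_ ?_ ?_ ?_ ?_, ?_⟩
    · exact h1 _ (by simp)
    · exact h1 _ (by simp)
    · exact h1 _ (by simp)
    · exact fun i => h1 _ (by simp)
    · exact fun i => h1 _ (by simp)
    · simp [hσ₁, St.upd_apply]
  · rintro u τ τ' hτ ⟨g1, g2⟩
    refine ⟨g1.congr ?_ ?_ ?_ ?_ ?_, ?_⟩
    · exact hτ _ (by simp) (by simp)
    · exact hτ _ (by simp) (by simp)
    · exact hτ _ (by simp) (by simp)
    · exact fun i => hτ _ (by simp) (by simp)
    · exact fun i => hτ _ (by simp) (by simp)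
    · rw [hτ _ (by simp) (by simp), g2]
  · rintro u τ hu hf hs hc ⟨g1, g2⟩
    rw [h1 _ (by simp), hcb] at hc
    have hj : j < n * j + 1 + u := by have := Nat.le_mul_of_pos_left j hn0; omega
    obtain ⟨k1, k2, k3⟩ := run_setupChild (u := ⟨u, hu⟩) (j := j) (D := D) (σ := τ) (e := e) (G := G)
      (by intro k; rw [hf _ (by simp) (by simp) (by simp), h1 _ (by simp)]; exact hinp k)
      (by rw [hf _ (by simp) (by simp) (by simp), h1 _ (by simp), hn])
      (by rw [hf _ (by simp) (by simp) (by simp), h1 _ (by simp), hcur]) hs hc g2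
      (g1.1 j hj) (g1.2 _ le_rfl)
    simp only at k1 k2 k3
    refine ⟨⟨fun k hk => ?_, fun k hk => ?_⟩, k3⟩
    · rcases Nat.eq_or_lt_of_le (Nat.lt_succ_iff.1 hk) with rfl | hk'
      · exact k1
      · have k2' := k2 k hk'.ne
        exact (g1.1 k hk').congr (k2' _ (by simp)) (k2' _ (by simp)) (k2' _ (by simp))
          (fun i => k2' _ (by simp)) (fun i => k2' _ (by simp))
    · rw [k2 k (by omega) _ (by simp)]
      exact g1.2 k (by omega)

@[simp] theorem mods_setupRoot (i : Player) : (setupRoot i).mods = [ut i, ut i] := rfl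

theorem run_setupRoot {σ : St Arr} {u : ℕ} {t : Prop} [Decidable t] (hs : σ start 0 = u)
    (ht : σ inp (2 + 3 * u + (i.code + 1)) = if t then 1 else 0) :
    (setupRoot i).run σ = σ.upd (ut i) 0 (if t then 0 else σ cap 0) := by
  by_cases h : t
  · rw [if_pos h] at ht
    simp [setupRoot, hs, ht, h]
  · rw [if_neg h] at ht
    simp [setupRoot, hs, ht, h]

theorem run_setupCmd {σ : St Arr} (hsh : Shape n D σ) (hinp : IsInput G e σ)
    (hstart : σ start 0 = e G.init) (hrow : σ row 0 = 2 + 3 * n + 3 * n * (e G.init : ℕ))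
    (hal : ∀ k, σ alive k = 0) : Ready G e D G.IsPlay (setupCmd.run σ) := by
  classical
  set σ₁ := ((((σ.upd own 0 0).upd alive 0 1).upd (wt .one) 0 0).upd (wt .two) 0 0) with hσ₁
  set x : Player → ℕ := fun i => if G.init ∈ G.target i then 0 else D + 1 with hx
  set σ₂ := (σ₁.upd (ut .one) 0 (x .one)).upd (ut .two) 0 (x .two) with hσ₂
  have htar : ∀ i : Player, σ inp (2 + 3 * (e G.init : ℕ) + (i.code + 1)) =
      if G.init ∈ G.target i then 1 else 0 := fun i => by
    rw [hinp, encode_target, Equiv.symm_apply_apply]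
  have hrun : setupCmd.run σ = (topDown inner setupNode).run σ₂ := by
    have h1 : setupCmd.run σ =
        (topDown inner setupNode).run ((setupRoot .two).run ((setupRoot .one).run σ₁)) := rfl
    rw [h1, run_setupRoot (i := .one) (u := e G.init) (t := G.init ∈ G.target .one),
      run_setupRoot (i := .two) (u := e G.init) (t := G.init ∈ G.target .two)]
    · simp [hσ₂, hσ₁, hx, St.upd_apply, hsh.cap_eq]
    · simp [hσ₁, St.upd_apply, hstart]
    · simpa [hσ₁, St.upd_apply] using htar .two
    · simp [hσ₁, St.upd_apply, hstart]
    · simpa [hσ₁, St.upd_apply] using htar .one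
  have h2 : ∀ a, a ≠ own → a ≠ alive → (∀ i, a ≠ wt i) → (∀ i, a ≠ ut i) → σ₂ a = σ a := by
    intro a a1 a2 a3 a4
    rw [hσ₂, St.upd_of_ne _ (a4 _), St.upd_of_ne _ (a4 _), hσ₁, St.upd_of_ne _ (a3 _),
      St.upd_of_ne _ (a3 _), St.upd_of_ne _ a2, St.upd_of_ne _ a1]
  have hn2 : σ₂ Arr.n 0 = n := by rw [h2 _ (by simp) (by simp) (by simp) (by simp), hsh.n_eq]
  have key := run_topDown (r := inner) (node := setupNode) (σ₀ := σ₂) (k := levels n D) (by simp)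
    (by rw [h2 _ (by simp) (by simp) (by simp) (by simp), hsh.inner_eq]) (by simp) (by simp)
    (fun j τ => ReadyBelow G e D (n * j + 1) τ) ?_ ?_ ?_
  · rw [hrun]
    set τ := (topDown inner setupNode).run σ₂ with hτ
    refine ⟨hsh.congr fun a ha => ?_, fun k => ?_, fun k hl => ?_, fun i k hp hl => ?_⟩
    · simp only [List.mem_cons, List.not_mem_nil, or_false] at ha
      rcases ha with rfl | rfl | rfl | rfl | rfl <;>
        rw [hτ, run_of_notMem (by simp), h2 _ (by simp) (by simp) (by simp) (by simp)]
    · by_cases hk : (G.path e k).length ≤ D + 1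
      · simp only [hk, and_true]
        exact (key.1 k ((length_path_le_iff G e k (D + 1)).1 hk)).alive
      · rw [if_neg fun h => hk h.2]
        rw [length_path_le_iff, levels] at hk
        exact key.2 k (by omega)
    · exact (key.1 k ((length_path_le_iff G e k (D + 1)).1 hl)).owner
    · exact (key.1 k ((length_path_le_iff G e k (D + 1)).1 hl)).util hp i
  · refine ⟨fun k hk => ?_, fun k hk => ?_⟩
    · obtain rfl : k = 0 := by omega
      have hp := G.path_zero e
      refine ⟨?_, ?_, ?_, ?_, ?_⟩
      · rw [hp, if_pos (isPlay_singleton.2 rfl)]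
        simp [hσ₂, hσ₁, St.upd_apply]
      · intro s π h
        rw [hp] at h
        obtain ⟨rfl, -⟩ := List.cons.inj h
        rw [G.owner_init]
        simp [hσ₂, hσ₁, St.upd_apply, Player.code]
      · intro s π h
        rw [hp] at h
        obtain ⟨rfl, -⟩ := List.cons.inj h
        rw [h2 _ (by simp) (by simp) (by simp) (by simp), hrow]
      · intro _ i
        rw [hp, pathWeight]
        cases i <;> simp [hσ₂, hσ₁, St.upd_apply]
      · intro _ i
        have hu : G.util (D + 1) i [G.init] = x i := by
          simp only [Arena.util, pathWeight, hx]
          split_ifs <;> simp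
        rw [hp, hu]
        cases i <;> simp [hσ₂, hσ₁, St.upd_apply]
    · have hk0 : k ≠ 0 := by omega
      rw [← hal k]
      simp [hσ₂, hσ₁, St.upd_apply, hk0]
  · intro j τ τ' hτ hJ
    refine hJ.congr ?_ ?_ ?_ ?_ ?_
    · exact hτ _ (by simp) (by simp)
    · exact hτ _ (by simp) (by simp)
    · exact hτ _ (by simp) (by simp)
    · exact fun i => hτ _ (by simp) (by simp)
    · exact fun i => hτ _ (by simp) (by simp)
  · intro j τ hj hf hcur hcb hJ
    rw [hn2] at hcb
    refine run_setupNode ?_ ?_ hcur hcb hJ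
    · intro k
      rw [hf _ (by simp) (by simp) (by simp), h2 _ (by simp) (by simp) (by simp) (by simp)]
      exact hinp k
    · rw [hf _ (by simp) (by simp) (by simp), hn2]

end RegretGame

namespace RegretGame

open Arr Cmd Arena

/-! ### The iteration -/

variable {S : Type} [Fintype S] {G : Arena S} {n : ℕ} {e : S ≃ Fin n} {D : ℕ} {T : List S → Prop}
  {i : Player}

/-- A step that prunes no node of the finite tree prunes nothing: beyond the horizon, a history is
pruned only together with one of its prefixes. -/
theorem prune_eq_self (hT : G.IsTree D T)
    (h : ∀ k < levels n (D + 1), T (G.path e k) → G.prune D T (G.path e k)) :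
    G.prune D T = T := by
  funext g
  refine propext ⟨prune_le, fun hg => ?_⟩
  induction g with
  | nil => exact (hT.isPlay hg).elim
  | cons s' g ih =>
    cases g with
    | nil => rwa [prune]
    | cons s π =>
      by_cases hl : (s' :: s :: π).length ≤ D + 1
      · obtain ⟨k, hk⟩ := G.exists_path_eq e (hT.isPlay hg)
        rw [← hk] at hl hg ⊢
        exact h k ((length_path_le_iff G e k (D + 1)).1 hl) hg
      · exact prune_cons.2 ⟨hg, ih (hT.parent hg), fun h => absurd h hl⟩

/-- Each step of the iteration before the last one prunes one of the nodes of the tree. -/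
theorem tree_eq_of_le (e : S ≃ Fin n) {j : ℕ} (hj : levels n (D + 1) ≤ j) :
    G.tree D j = G.tree D (levels n (D + 1)) := by
  classical
  set N := levels n (D + 1) with hN
  set A : ℕ → Finset ℕ := fun j => (Finset.range N).filter fun k => G.tree D j (G.path e k) with hA
  have hle : ∀ j, A (j + 1) ⊆ A j := by
    intro j k hk
    simp only [hA, Finset.mem_filter] at hk ⊢
    rw [tree_succ] at hk
    exact ⟨hk.1, prune_le hk.2⟩
  have step : ∀ j, G.tree D (j + 1) = G.tree D j ∨ (A (j + 1)).card + 1 ≤ (A j).card := by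
    intro j
    rcases (hle j).eq_or_ssubset with h | h
    · left
      rw [tree_succ]
      refine prune_eq_self (e := e) (isTree_tree j) fun k hk hTk => ?_
      have h1 : k ∈ A j := Finset.mem_filter.2 ⟨Finset.mem_range.2 hk, hTk⟩
      rw [← h, hA, Finset.mem_filter, tree_succ] at h1
      exact h1.2
    · exact Or.inr (Finset.card_lt_card h)
  have key : ∀ j, G.tree D (j + 1) = G.tree D j ∨ (A (j + 1)).card + (j + 1) ≤ N := by
    intro j
    induction j with
    | zero =>
      have h0 : (A 0).card ≤ N := (Finset.card_filter_le _ _).trans (Finset.card_range N).le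
      exact (step 0).imp id fun h => by omega
    | succ j ih =>
      rcases ih with h | h
      · left
        rw [tree_succ (j + 1), h, ← tree_succ, h]
      · exact (step (j + 1)).imp id fun h' => by omega
  have hstable : G.tree D (N + 1) = G.tree D N := (key N).resolve_right (by omega)
  induction j, hj using Nat.le_induction with
  | base => rfl
  | succ j _ ih => rw [tree_succ, ih, ← tree_succ, hstable]

theorem regretCode_uncap (D v : ℕ) : regretCode (uncap D v) = if v ≤ D then v + 1 else 0 := by
  rw [uncap]; split_ifs <;> rfl

theorem run_outCmd {σ : St Arr} (hcap : σ cap 0 = D + 1) :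
    (outCmd i).run σ = σ.upd (out i) 0 (regretCode (uncap D (σ (val i) 0))) := by
  rw [regretCode_uncap]
  by_cases h : σ (val i) 0 ≤ D
  · have h' : D + 1 - σ (val i) 0 ≠ 0 := by omega
    simp [outCmd, hcap, h, h']
  · have h' : D + 1 - σ (val i) 0 = 0 := by omega
    simp [outCmd, hcap, h, h']

@[simp] theorem mods_outCmd (i : Player) : (outCmd i).mods = [out i, out i] := rfl

theorem run_iterCmd {σ : St Arr} (h : Ready G e D G.IsPlay σ) (i : Player) :
    iterCmd.run σ (out i) 0 =
      regretCode (uncap D (G.val (G.tree D (levels n (D + 1))) D i [G.init])) := by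
  set N := levels n (D + 1) with hN
  set τ := (Cmd.rep total roundCmd).run σ with hτ
  have h1 : Ready G e D (G.tree D N) τ := by
    refine Cmd.run_rep h.shape.total_eq (fun j σ => Ready G e D (G.tree D j) σ) h ?_
    intro j σ' _ _ h'
    rw [tree_succ]
    exact run_roundCmd (isTree_tree j) h'
  have hT := isTree_tree (G := G) (D := D) N
  set τ₁ := (evalPass .one).run τ with hτ₁
  set τ₂ := (evalPass .two).run τ₁ with hτ₂
  have h2 : Ready G e D (G.tree D N) τ₁ := h1.evalPass .one
  have h3 : Ready G e D (G.tree D N) τ₂ := h2.evalPass .two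
  have hv : ∀ i, τ₂ (val i) 0 = G.val (G.tree D N) D i [G.init] := by
    have h0 : G.tree D N (G.path e 0) := by rw [path_zero]; exact hT.init
    have hl : (G.path e 0).length ≤ D + 1 := by rw [path_zero]; simp
    rintro (_ | _)
    · have h5 := run_evalPass hT h1 .one 0 h0 hl
      rw [path_zero] at h5
      rw [hτ₂, run_of_notMem (notMem_mods_evalPass (by simp) (by simp) (by simp)), hτ₁, h5]
    · have h5 := run_evalPass hT h2 .two 0 h0 hl
      rwa [path_zero] at h5
  have hrun : iterCmd.run σ = (outCmd .two).run ((outCmd .one).run τ₂) := rfl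
  have hcap := h3.shape.cap_eq
  rw [hrun, run_outCmd (D := D) (i := .one) hcap, run_outCmd (D := D) (i := .two)
    (by rw [St.upd_of_ne _ (by simp), hcap])]
  cases i <;> simp [St.upd_apply, hv]

theorem isIteratedRegret (e : S ≃ Fin n) (hpos : G.Positive)
    (hD : 2 * ((2 * ((0 + Fintype.card S) * G.maxWeight) + Fintype.card S) * G.maxWeight) ≤ D)
    (i : Player) :
    G.IsIteratedRegret i (uncap D (G.val (G.tree D (levels n (D + 1))) D i [G.init])) :=
  ⟨levels n (D + 1), fun j hj => by rw [regretSucc_eq hpos hD, tree_eq_of_le e hj]⟩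

end RegretGame

namespace RegretGame

open Arr Cmd Arena

/-! ### The preparation of the tree -/

theorem run_unpackCmd {σ : St Arr} {f : ℕ → ℕ} (h2 : σ inp 2 = f 2 + 2 * f 3 + 4 * f 4)
    (hf : ∀ k, k ≠ 2 → k ≠ 3 → k ≠ 4 → σ inp k = f k) (hf2 : f 2 ≤ 1) (hf3 : f 3 ≤ 1)
    (hf4 : f 4 ≤ 1) :
    unpackCmd.run σ inp = f ∧ unpackCmd.run σ Arr.n 0 = f 0 ∧ unpackCmd.run σ start 0 = f 1 ∧
      unpackCmd.run σ q 0 = 0 ∧ unpackCmd.run σ t 0 = 0 := by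
  set τ := (block [
      assign tmp (.get inp 2),
      .ite (.reg tmp - 3) (block [.set inp 4 1, assign tmp (.reg tmp - 4)]) (.set inp 4 0),
      .ite (.reg tmp - 1) (block [.set inp 3 1, assign tmp (.reg tmp - 2)]) (.set inp 3 0),
      .set inp 2 (.reg tmp)]).run σ with hτ
  have hrun : unpackCmd.run σ = (block [assign Arr.n (.get inp 0), assign start (.get inp 1),
      assign q 0, assign t 0]).run τ := rfl
  have h0 : ∀ x, x ≤ 1 → x = 0 ∨ x = 1 := by omega
  suffices H : τ inp = f by
    rw [hrun]
    simp [St.upd_apply, H]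
  rw [hτ]
  funext k
  have hk := hf k
  rcases h0 _ hf2 with a | a <;> rcases h0 _ hf3 with b | b <;> rcases h0 _ hf4 with c | c
  all_goals
    rw [a, b, c] at h2
    norm_num at h2
    by_cases k2 : k = 2
    · subst k2; simp [St.upd_apply, h2, a]
    by_cases k3 : k = 3
    · subst k3; simp [St.upd_apply, h2, b]
    by_cases k4 : k = 4
    · subst k4; simp [St.upd_apply, h2, c]
    simp [St.upd_apply, h2, k2, k3, k4, hk]

theorem run_sumCmd {σ : St Arr} {b : ℕ} (hlen : σ len 0 = b) (hq : σ q 0 = 0) (ht : σ t 0 = 0) :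
    sumCmd.run σ q 0 = ∑ k ∈ Finset.range b, σ inp k := by
  refine (Cmd.run_rep hlen (fun j τ => τ q 0 = (∑ k ∈ Finset.range j, σ inp k) ∧ τ t 0 = j)
    ⟨by simpa using hq, ht⟩ ?_).1
  rintro j τ _ hf ⟨h1, h2⟩
  have h3 : τ inp = σ inp := hf _ (by simp)
  rw [Finset.sum_range_succ]
  simp [St.upd_apply, h1, h2, h3]

theorem run_rep_inc {σ : St Arr} {a b r : Arr} {k v x : ℕ} (hr : σ r 0 = k) (ha : σ a 0 = x)
    (hb : σ b 0 = v) (hab : a ≠ b) :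
    (Cmd.rep r (inc a (.reg b))).run σ = σ.upd a 0 (x + k * v) := by
  have key : ∀ j, ((inc a (.reg b)).run)^[j] σ = σ.upd a 0 (x + j * v) := by
    intro j
    induction j with
    | zero => rw [Function.iterate_zero, id, St.upd_eq_self (by omega)]
    | succ j ih =>
      rw [Function.iterate_succ_apply', ih]
      simp [hab.symm, hb, Nat.succ_mul, add_assoc, St.upd]
  rw [Cmd.run, hr, key]

theorem run_depthCmd {σ : St Arr} {x : ℕ} (hq : σ q 0 = x) :
    depthCmd.run σ dep 0 = 6 * x ^ 3 ∧ depthCmd.run σ cap 0 = 6 * x ^ 3 + 1 ∧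
      depthCmd.run σ inner 0 = 0 := by
  have hrun : depthCmd.run σ = (block [assign dep (triple (.reg q3) + triple (.reg q3)),
      assign cap (.reg dep + 1), assign inner 0]).run ((Cmd.rep q (inc q3 (.reg q2))).run
        ((Cmd.rep q (inc q2 (.reg q))).run ((σ.upd q2 0 0).upd q3 0 0))) := rfl
  rw [hrun, run_rep_inc (a := q2) (b := q) (k := x) (v := x) (x := 0),
    run_rep_inc (a := q3) (b := q2) (k := x) (v := x * x) (x := 0)]
  · have e : 3 * (x * (x * x)) + 3 * (x * (x * x)) = 6 * x ^ 3 := by ring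
    simp [St.upd_apply, e]
  all_goals simp [St.upd_apply, hq]

theorem run_levelCmd {σ : St Arr} {x y : Arr} {n v : ℕ} (hn : σ Arr.n 0 = n) (hy : σ y 0 = v)
    (hy' : y ≠ tmp) :
    (levelCmd x y).run σ = (σ.upd tmp 0 (n * v)).upd x 0 (n * v + 1) := by
  have hrun : (levelCmd x y).run σ =
      (assign x (.reg tmp + 1)).run ((Cmd.rep Arr.n (inc tmp (.reg y))).run (σ.upd tmp 0 0)) := rfl
  rw [hrun, run_rep_inc (k := n) (v := v) (x := 0)]
  · simp [St.upd]
  · rw [St.upd_of_ne _ (by simp), hn]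
  · simp [St.upd_apply]
  · rw [St.upd_of_ne _ hy', hy]
  · exact hy'.symm

@[simp] theorem mods_levelCmd (x y : Arr) : (levelCmd x y).mods = [tmp, tmp, x] := rfl

theorem run_sizeCmd {σ : St Arr} {n d u : ℕ} (hn : σ Arr.n 0 = n) (hdep : σ dep 0 = d)
    (hcap : σ cap 0 = d + 1) (hinner : σ inner 0 = 0) (hstart : σ start 0 = u) :
    Shape n d (sizeCmd.run σ) ∧ sizeCmd.run σ row 0 = 2 + 3 * n + 3 * n * u := by
  set σ₁ := (Cmd.rep dep (levelCmd inner inner)).run σ with hσ₁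
  have h1 : σ₁ inner 0 = levels n d := by
    refine Cmd.run_rep hdep (fun j τ => τ inner 0 = levels n j) hinner ?_
    intro j τ _ hf h
    rw [run_levelCmd (n := n) (v := levels n j) (by rw [hf _ (by simp), hn]) h (by simp)]
    simp [St.upd_apply, levels]
  have hf1 : ∀ a, a ≠ tmp → a ≠ Arr.inner → σ₁ a = σ a := fun a a1 a2 =>
    run_of_notMem (by simp [a1, a2]) σ
  set σ₂ := (σ₁.upd tmp 0 (n * levels n d)).upd total 0 (levels n (d + 1)) with hσ₂
  set σ₃ := ((σ₂.upd tmp 0 (n * levels n (d + 1))).upd lim 0 (levels n (d + 2))).upd row 0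
    (2 + 3 * n) with hσ₃
  have hn1 : σ₁ Arr.n 0 = n := by rw [hf1 _ (by simp) (by simp), hn]
  have hrun : sizeCmd.run σ =
      (Cmd.rep start (.set row 0 (.get row 0 + triple (.reg Arr.n)))).run σ₃ := by
    have h2 : sizeCmd.run σ = (Cmd.rep start (.set row 0 (.get row 0 + triple (.reg Arr.n)))).run
      ((Cmd.set row 0 (2 + triple (.reg Arr.n))).run
        ((levelCmd lim total).run ((levelCmd total inner).run σ₁))) := rfl
    rw [h2, run_levelCmd (n := n) (v := levels n d) hn1 h1 (by simp),
      run_levelCmd (n := n) (v := levels n (d + 1)) (by simp [St.upd_apply, hn1])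
        (by simp [St.upd_apply, levels]) (by simp)]
    simp [hσ₃, hσ₂, hn1, St.upd_apply, levels]
  have h3 : ∀ a, a ≠ row → sizeCmd.run σ a = σ₃ a := fun a ha => by
    rw [hrun, run_of_notMem (by simp [ha])]
  refine ⟨⟨?_, ?_, ?_, ?_, ?_⟩, ?_⟩
  · rw [h3 _ (by simp)]; simp [hσ₃, hσ₂, St.upd_apply, hn1]
  · rw [h3 _ (by simp)]; simp [hσ₃, hσ₂, St.upd_apply, hf1, hcap]
  · rw [h3 _ (by simp)]; simp [hσ₃, hσ₂, St.upd_apply, h1]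
  · rw [h3 _ (by simp)]; simp [hσ₃, hσ₂, St.upd_apply]
  · rw [h3 _ (by simp)]; simp [hσ₃, hσ₂, St.upd_apply]
  · rw [hrun]
    refine Cmd.run_rep (k := u) ?_ (fun j τ => τ row 0 = 2 + 3 * n + 3 * n * j) ?_ ?_
    · simp [hσ₃, hσ₂, St.upd_apply, hf1, hstart]
    · simp [hσ₃, St.upd_apply]
    · intro j τ _ hf h
      have h4 : τ Arr.n 0 = n := by
        rw [hf _ (by simp)]; simp [hσ₃, hσ₂, St.upd_apply, hn1]
      simp [St.upd_apply, h, h4]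
      ring

end RegretGame

namespace RegretGame

open Arr Cmd Arena

/-! ### Correctness and running time -/

/-- The algorithm, without the relocation of the input. -/
def core : Program :=
  .seq (unpackCmd.compile Arr.num 0) (.seq (sumCmd.compile Arr.num 0)
    (.seq (depthCmd.compile Arr.num 0) (.seq (sizeCmd.compile Arr.num 0)
      (.seq (setupCmd.compile Arr.num 0) (iterCmd.compile Arr.num 0)))))

/-- `Cmd.exec_compile` for the outermost level. -/
theorem exec_phase (c : Cmd Arr) (hmod : ∀ a ∈ c.loopRegs, a ∉ c.mods) :
    ∃ p : ℕ, ∀ (X base : ℕ) (m : Memory) (σ : St Arr), Represents Arr.num base m σ →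
      (∀ a ∈ c.loopRegs, σ a 0 ≤ X) →
      ∃ t m', Exec (c.compile Arr.num 0) m t m' ∧ t ≤ (X + 2) ^ p ∧
        Represents Arr.num base m' (c.run σ) := by
  obtain ⟨p, hp⟩ := c.exec_compile Arr.num_injective Arr.num_lt hmod
  refine ⟨p, fun X base m σ h hX => ?_⟩
  obtain ⟨t, m', h1, h2, h3, -⟩ := hp X 0 base m σ h hX
  exact ⟨t, m', h1, h2, h3⟩

/-- The sum of the numbers in the description of the arena. -/
def size {S : Type} [DecidableEq S] (G : Arena S) {n : ℕ} (e : S ≃ Fin n) : ℕ := (G.encode e).sum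

theorem sum_getD {l : List ℕ} {b : ℕ} (hb : l.length ≤ b) :
    ∑ k ∈ Finset.range b, l.getD k 0 = l.sum := by
  induction l generalizing b with
  | nil => simp
  | cons x l ih =>
    obtain ⟨b, rfl⟩ := Nat.exists_eq_add_of_le' (show 1 ≤ b by simp at hb; omega)
    rw [Finset.sum_range_succ', List.sum_cons, add_comm]
    congr 1
    rw [← ih (b := b) (by simpa using hb)]
    rfl

theorem loopRegs_setupCmd : setupCmd.loopRegs = [Arr.inner, Arr.n] := rfl

theorem mem_loopRegs_iterCmd {a : Arr} : a ∈ iterCmd.loopRegs ↔ a = total ∨ a = Arr.n := by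
  by_cases h1 : a = total <;> by_cases h2 : a = Arr.n <;>
    simp [iterCmd, roundCmd, evalPass, bottomUp, topDown, backupNode, children, devNode, pruneNode,
      siblings, leafCmd, outCmd, h1, h2]

theorem notMem_mods_iterCmd : ∀ a ∈ iterCmd.loopRegs, a ∉ iterCmd.mods := by
  intro a ha
  rw [mem_loopRegs_iterCmd] at ha
  have h1 : ∀ i, a ∉ (evalPass i).mods := by
    intro i
    apply notMem_mods_evalPass <;> rcases ha with rfl | rfl <;> simp
  have h2 : a ∉ roundCmd.mods := by
    simp only [roundCmd, mods_block_cons, mods_block_nil, List.mem_append, h1, false_or]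
    rcases ha with rfl | rfl <;> simp
  simp only [iterCmd, mods_block_cons, mods_block_nil, List.mem_append, h1, false_or, mods]
  rcases ha with rfl | rfl <;> simp [h2]

/-- The program computes the values of the last tree of the iteration.  The number `X` bounds the
lengths of all loops. -/
theorem exec_core : ∃ p : ℕ, ∀ (S : Type) [Fintype S] [DecidableEq S] (G : Arena S) (n : ℕ)
    (e : S ≃ Fin n) (X b base : ℕ) (m : Memory) (σ : St Arr), Represents Arr.num base m σ →
    σ inp 2 = (G.encode e).getD 2 0 + 2 * (G.encode e).getD 3 0 + 4 * (G.encode e).getD 4 0 →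
    (∀ k, k ≠ 2 → k ≠ 3 → k ≠ 4 → σ inp k = (G.encode e).getD k 0) →
    σ len 0 = b → (G.encode e).length ≤ b → (∀ k, σ alive k = 0) →
    b ≤ X → n ≤ X → size G e ≤ X → 6 * size G e ^ 3 ≤ X → levels n (6 * size G e ^ 3 + 1) ≤ X →
    ∃ t m' σ', Exec core m t m' ∧ t ≤ 6 * (X + 2) ^ p ∧ Represents Arr.num base m' σ' ∧
      ∀ i, σ' (out i) 0 = regretCode (uncap (6 * size G e ^ 3)
        (G.val (G.tree (6 * size G e ^ 3) (levels n (6 * size G e ^ 3 + 1))) (6 * size G e ^ 3) i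
          [G.init])) := by
  obtain ⟨p₁, H1⟩ := exec_phase unpackCmd (by simp [unpackCmd])
  obtain ⟨p₂, H2⟩ := exec_phase sumCmd (by simp [sumCmd])
  obtain ⟨p₃, H3⟩ := exec_phase depthCmd (by simp [depthCmd])
  obtain ⟨p₄, H4⟩ := exec_phase sizeCmd (by simp [sizeCmd, levelCmd])
  obtain ⟨p₅, H5⟩ := exec_phase setupCmd (by rw [loopRegs_setupCmd]; simp [setupCmd])
  obtain ⟨p₆, H6⟩ := exec_phase iterCmd notMem_mods_iterCmd
  refine ⟨p₁ + p₂ + p₃ + p₄ + p₅ + p₆, ?_⟩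
  intro S _ _ G n e X b base m σ hσ hinp2 hinp hlen hb hal hbX hnX hqX hdX hlX
  have hn : 0 < n := (e G.init).pos
  set D := 6 * size G e ^ 3 with hD
  -- the description of the first position has entries `0` and `1`
  have hf2 : (G.encode e).getD 2 0 ≤ 1 := by
    have h := G.encode_owner e ⟨0, hn⟩
    simp only [Nat.mul_zero, Nat.add_zero] at h
    rw [h]; exact Player.code_le _
  have hft : ∀ i : Player, (G.encode e).getD (2 + (i.code + 1)) 0 ≤ 1 := by
    intro i
    have h := G.encode_target e ⟨0, hn⟩ i
    simp only [Nat.mul_zero, Nat.add_zero] at h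
    rw [h]; split_ifs <;> omega
  obtain ⟨a1, a2, a3, a4, a5⟩ := run_unpackCmd (f := fun k => (G.encode e).getD k 0) hinp2 hinp
    hf2 (hft .one) (hft .two)
  obtain ⟨t₁, m₁, x1, y1, z1⟩ := H1 X base m σ hσ (by simp [unpackCmd])
  set σ₁ := unpackCmd.run σ with hσ₁
  have f1 : ∀ a, a ∉ [tmp, inp, Arr.n, start, q, t] → σ₁ a = σ a := fun a ha => by
    refine run_of_notMem ?_ σ
    simp only [List.mem_cons, List.not_mem_nil, or_false, not_or] at ha
    simp [unpackCmd, ha]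
  have hlen1 : σ₁ len 0 = b := by rw [f1 _ (by simp), hlen]
  have hsum := run_sumCmd hlen1 a4 a5
  rw [a1, sum_getD hb] at hsum
  change _ = size G e at hsum
  obtain ⟨t₂, m₂, x2, y2, z2⟩ := H2 X base m₁ σ₁ z1 (by simp [sumCmd, hlen1, hbX])
  set σ₂ := sumCmd.run σ₁ with hσ₂
  have f2 : ∀ a, a ∉ [q, t] → σ₂ a = σ₁ a := fun a ha => by
    refine run_of_notMem ?_ σ₁
    simpa [sumCmd] using ha
  obtain ⟨b1, b2, b3⟩ := run_depthCmd hsum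
  obtain ⟨t₃, m₃, x3, y3, z3⟩ := H3 X base m₂ σ₂ z2 (by
    simp only [depthCmd, loopRegs_block_cons, loopRegs, loopRegs_assign, inc, loopRegs_block_nil]
    simp only [List.nil_append, List.append_nil, List.cons_append, List.mem_cons,
      List.not_mem_nil, or_false, or_self, forall_eq]
    rw [hsum]; exact hqX)
  set σ₃ := depthCmd.run σ₂ with hσ₃
  have f3 : ∀ a, a ∉ [q2, q3, dep, cap, Arr.inner] → σ₃ a = σ₂ a := fun a ha => by
    refine run_of_notMem ?_ σ₂
    simp only [List.mem_cons, List.not_mem_nil, or_false, not_or] at ha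
    simp [depthCmd, ha]
  have hn3 : σ₃ Arr.n 0 = n := by rw [f3 _ (by simp), f2 _ (by simp), a2, encode_zero]
  have hstart3 : σ₃ start 0 = e G.init := by rw [f3 _ (by simp), f2 _ (by simp), a3, encode_one]
  obtain ⟨c1, c2⟩ := run_sizeCmd hn3 b1 b2 b3 hstart3
  obtain ⟨t₄, m₄, x4, y4, z4⟩ := H4 X base m₃ σ₃ z3 (by
    have hs := (e G.init).2
    have h3 : σ₃ dep 0 ≤ X := by rw [b1]; exact hdX
    simp [sizeCmd, levelCmd, hn3, hstart3, h3]
    omega)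
  set σ₄ := sizeCmd.run σ₃ with hσ₄
  have f4 : ∀ a, a ∉ [tmp, Arr.inner, total, lim, row] → σ₄ a = σ₃ a := fun a ha => by
    refine run_of_notMem ?_ σ₃
    simp only [List.mem_cons, List.not_mem_nil, or_false, not_or] at ha
    simp [sizeCmd, ha]
  have hin4 : IsInput G e σ₄ := by
    intro k
    rw [f4 _ (by simp), f3 _ (by simp), f2 _ (by simp), a1]
  have hready := run_setupCmd (G := G) (e := e) c1 hin4 (by rw [f4 _ (by simp), hstart3]) c2
    (by intro k; rw [f4 _ (by simp), f3 _ (by simp), f2 _ (by simp), f1 _ (by simp), hal])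
  have hlev : levels n D ≤ X := (levels_mono n (Nat.le_succ D) hn).trans hlX
  obtain ⟨t₅, m₅, x5, y5, z5⟩ := H5 X base m₄ σ₄ z4 (by
    intro a ha
    rw [loopRegs_setupCmd, List.mem_cons, List.mem_singleton] at ha
    rcases ha with rfl | rfl
    · rw [c1.inner_eq]; exact hlev
    · rw [c1.n_eq]; exact hnX)
  set σ₅ := setupCmd.run σ₄ with hσ₅
  obtain ⟨t₆, m₆, x6, y6, z6⟩ := H6 X base m₅ σ₅ z5 (by
    intro a ha
    rw [mem_loopRegs_iterCmd] at ha
    rcases ha with rfl | rfl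
    · rw [hready.shape.total_eq]; exact hlX
    · rw [hready.shape.n_eq]; exact hnX)
  refine ⟨_, m₆, _, .seq x1 (.seq x2 (.seq x3 (.seq x4 (.seq x5 x6)))), ?_, z6,
    run_iterCmd hready⟩
  have hpow : ∀ {q}, q ≤ p₁ + p₂ + p₃ + p₄ + p₅ + p₆ →
      (X + 2) ^ q ≤ (X + 2) ^ (p₁ + p₂ + p₃ + p₄ + p₅ + p₆) :=
    fun h => Nat.pow_le_pow_right (by omega) h
  have g1 := hpow (q := p₁) (by omega)
  have g2 := hpow (q := p₂) (by omega)
  have g3 := hpow (q := p₃) (by omega)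
  have g4 := hpow (q := p₄) (by omega)
  have g5 := hpow (q := p₅) (by omega)
  have g6 := hpow (q := p₆) (by omega)
  omega

end RegretGame

namespace RegretGame

open Arr

/-! ### Relocating the input -/

/-- The contents of a fixed memory cell. -/
def Expr.cell (k : ℕ) : Expr := .read (.const k)

/-- Twice the value of an expression. -/
def Expr.double (x : Expr) : Expr := .add x x

/-- A loop that is counted down in the cell `4`. -/
def countdown (c : Program) : Program := .loop (.cell 4) c

/-- Decrementing the cell `4`. -/
def decrement : Program := .assign (.const 4) (.sub (.cell 4) (.const 1))

/-- Freeing the cells `3` and `4`: since the cells `2`, `3` and `4` hold bits, the cell `2` can hold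
all three of them. -/
def packCells : Program :=
  .assign (.const 2) (.add (.cell 2) (.add (Expr.cell 3).double (Expr.cell 4).double.double))

/-- Adding `8 * n`. -/
def addRow : Program := .assign (.const 3) (.add (.cell 3) (Expr.cell 0).double.double.double)

/-- The cell `3` becomes `8 * n * n`, an address beyond the input. -/
def findBase : Program :=
  .seq (.assign (.const 4) (.cell 0)) (.seq (.assign (.const 3) (.const 0))
    (countdown (.seq addRow decrement)))

/-- Copying the input cell whose number is in the cell `4`. -/
def copyCell : Program := .assign (cellAddr (num inp) (.cell 4)) (.read (.cell 4))

/-- Copying the cells below the address that the cell `3` holds, from the last one to the first. -/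
def copyInput : Program := .seq (.assign (.const 4) (.cell 3)) (countdown (.seq decrement copyCell))

/-- Moving the input to the array `inp`, and its length to the register `len`. -/
def relocate : Program :=
  .seq packCells (.seq findBase (.seq copyInput
    (.assign (cellAddr (num len) (.const 0)) (.cell 3))))

theorem exec_assign {a v : Expr} {m : Memory} {x y : ℕ} (ha : a.eval m = x) (hv : v.eval m = y) :
    Exec (.assign a v) m (a.cost + v.cost + 1) (Function.update m x y) := by
  subst ha hv; exact .assign a v m

theorem exec_countdown {c : Program} {κ : ℕ} (J : ℕ → Memory → Prop)
    (hJ : ∀ r m, J r m → m 4 = r)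
    (hs : ∀ r m, J (r + 1) m → ∃ m', Exec c m κ m' ∧ J r m') {r : ℕ} {m : Memory} (h : J r m) :
    ∃ m', Exec (countdown c) m (r * (κ + 3) + 3) m' ∧ J 0 m' := by
  induction r generalizing m with
  | zero => exact ⟨m, by rw [Nat.zero_mul]; exact Exec.loopStop (g := .cell 4) (hJ 0 m h), h⟩
  | succ r ih =>
    obtain ⟨m₁, h1, h2⟩ := hs r m h
    obtain ⟨m₂, h3, h4⟩ := ih h2
    have hg : (Expr.cell 4).eval m ≠ 0 := by
      have := hJ _ m h
      simp only [Expr.cell, Expr.eval]; omega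
    refine ⟨m₂, ?_, h4⟩
    have e : (r + 1) * (κ + 3) + 3 = (Expr.cell 4).cost + 1 + κ + (r * (κ + 3) + 3) := by
      rw [Nat.succ_mul]; simp only [Expr.cell, Expr.cost]; omega
    rw [e]
    exact .loopStep hg h1 h3

theorem exec_findBase : ∃ C : ℕ, ∀ (n : ℕ) (m : Memory), m 0 = n →
    ∃ t m', Exec findBase m t m' ∧ t ≤ C * (n + 1) ∧ m' 3 = 8 * n * n ∧
      ∀ x, x ≠ 3 → x ≠ 4 → m' x = m x := by
  refine ⟨100, fun n m hm => ?_⟩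
  obtain ⟨m', h1, h2, -, h3, h4⟩ := exec_countdown (c := .seq addRow decrement)
    (κ := ((Expr.const 3).cost + (Expr.add (.cell 3) (Expr.cell 0).double.double.double).cost + 1) +
      ((Expr.const 4).cost + (Expr.sub (.cell 4) (.const 1)).cost + 1))
    (fun r m' => m' 4 = r ∧ r ≤ n ∧ m' 3 = 8 * n * (n - r) ∧ ∀ x, x ≠ 3 → x ≠ 4 → m' x = m x)
    (fun r m' h => h.1) (r := n)
    (m := Function.update (Function.update m 4 n) 3 0) (by
      rintro r m' ⟨h1, hr, h2, h3⟩
      refine ⟨_, .seq (.assign _ _ _) (.assign _ _ _), ?_, by omega, ?_, ?_⟩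
      · simp [Expr.eval, Expr.cell, h1]
      · have e : n - r = (n - (r + 1)) + 1 := by omega
        rw [e, Nat.mul_succ, ← h2]
        have h0 := h3 0 (by omega) (by omega)
        simp [Expr.eval, Expr.cell, Expr.double, h0, hm]
        omega
      · intro x hx3 hx4
        simp only [Expr.eval]
        rw [Function.update_of_ne hx4, Function.update_of_ne hx3, h3 x hx3 hx4]) (by
      refine ⟨by simp, le_rfl, by simp, fun x h3 h4 => by simp [h3, h4]⟩)
  have e1 : Exec (.assign (.const 4) (.cell 0)) m 4 (Function.update m 4 n) := by
    exact exec_assign rfl hm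
  refine ⟨_, m', .seq e1 (.seq (.assign _ _ _) h1), ?_, by simpa using h3, h4⟩
  simp only [Expr.cost, Expr.cell, Expr.double]
  omega

theorem exec_copyInput : ∃ C : ℕ, ∀ (b : ℕ) (m : Memory), 4 < b → m 3 = b → (∀ x ≥ b, m x = 0) →
    ∃ t m', Exec copyInput m t m' ∧ t ≤ C * (b + 1) ∧ m' 3 = b ∧
      (∀ k, k ≠ 4 → m' (b + 64 * k) = m k) ∧
      ∀ k, m' (b + (num alive + 64 * k)) = 0 := by
  refine ⟨1000, fun b m hb hm h0 => ?_⟩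
  obtain ⟨m', h1, h2, -, h3, h4, h5, h6⟩ := exec_countdown (c := .seq decrement copyCell)
    (κ := ((Expr.const 4).cost + (Expr.sub (.cell 4) (.const 1)).cost + 1) +
      ((cellAddr (num inp) (.cell 4)).cost + (Expr.read (.cell 4)).cost + 1))
    (fun r m' => m' 4 = r ∧ r ≤ b ∧ m' 3 = b ∧ (∀ x < b, x ≠ 4 → m' x = m x) ∧
      (∀ k, k ≠ 4 → m' (b + 64 * k) = if r ≤ k then m k else 0) ∧
      ∀ k, m' (b + (num alive + 64 * k)) = 0)
    (fun r m' h => h.1) (r := b)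
    (m := Function.update m 4 b) (by
      rintro r m' ⟨h1, hr, h2, h3, h4, h5⟩
      set m₁ := Function.update m' 4 r with hm₁
      have e1 : m₁ 3 = b := by rw [hm₁, Function.update_of_ne (by omega), h2]
      have e2 : Exec decrement m' ((Expr.const 4).cost +
          (Expr.sub (.cell 4) (.const 1)).cost + 1) m₁ := by
        exact exec_assign rfl (by simp [Expr.eval, Expr.cell, h1])
      have e3 : (cellAddr (num inp) (.cell 4)).eval m₁ = b + 64 * r := by
        rw [eval_cellAddr e1]; simp [Expr.eval, Expr.cell, hm₁, Arr.num]
      have e4 : (Expr.read (.cell 4)).eval m₁ = m₁ r := by simp [Expr.eval, Expr.cell, hm₁]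
      refine ⟨_, .seq e2 (.assign _ _ m₁), ?_, by omega, ?_, ?_, ?_, ?_⟩
      all_goals rw [e3, e4]
      · rw [Function.update_of_ne (by omega), hm₁, Function.update_self]
      · rw [Function.update_of_ne (by omega), e1]
      · intro x hx hx4
        rw [Function.update_of_ne (by omega), hm₁, Function.update_of_ne hx4, h3 x hx hx4]
      · intro k hk
        by_cases hkr : k = r
        · subst hkr
          rw [Function.update_self, if_pos le_rfl, hm₁, Function.update_of_ne hk]
          exact h3 k hr hk
        · rw [Function.update_of_ne (by omega), hm₁, Function.update_of_ne (by omega), h4 k hk]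
          congr 1
          exact propext ⟨fun _ => by omega, fun _ => by omega⟩
      · intro k
        rw [Function.update_of_ne (by simp only [Arr.num]; omega), hm₁,
          Function.update_of_ne (by omega), h5]) (by
      refine ⟨by simp, le_rfl, by simp [hm], fun x h3 h4 => by simp [h4], fun k hk => ?_, fun k => ?_⟩
      · rw [Function.update_of_ne (by omega), h0 _ (by omega)]
        split_ifs with h
        · rw [h0 _ h]
        · rfl
      · rw [Function.update_of_ne (by omega), h0 _ (by omega)])
  have e1 : Exec (.assign (.const 4) (.cell 3)) m 4 (Function.update m 4 b) := by
    exact exec_assign rfl hm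
  refine ⟨_, m', .seq e1 h1, ?_, h3, fun k hk => ?_, h6⟩
  · simp only [Expr.cost, Expr.cell, cellAddr, mulStride, Function.iterate_succ,
      Function.iterate_zero, Function.comp_apply, id_eq]
    omega
  · rw [h5 k hk, if_pos (Nat.zero_le k)]

end RegretGame

namespace RegretGame

open Arr Cmd Arena

theorem exec_relocate : ∃ C : ℕ, ∀ (n : ℕ) (m : Memory), m 0 = n → 0 < n →
    (∀ x ≥ 8 * n * n, m x = 0) → ∃ t m' σ, Exec relocate m t m' ∧ t ≤ C * (8 * n * n + 1) ∧
      Represents num (8 * n * n) m' σ ∧ σ inp 2 = m 2 + 2 * m 3 + 4 * m 4 ∧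
      (∀ k, k ≠ 2 → k ≠ 3 → k ≠ 4 → σ inp k = m k) ∧ σ len 0 = 8 * n * n ∧
      ∀ k, σ alive k = 0 := by
  obtain ⟨C₁, H₁⟩ := exec_findBase
  obtain ⟨C₂, H₂⟩ := exec_copyInput
  refine ⟨C₁ + C₂ + 1000, fun n m hm hn h0 => ?_⟩
  have hb : 8 * n ≤ 8 * n * n := Nat.le_mul_of_pos_right _ hn
  set b := 8 * n * n with hbdef
  set m₁ := Function.update m 2 (m 2 + 2 * m 3 + 4 * m 4) with hm₁
  have x1 := exec_assign (a := .const 2) (m := m) (x := 2) (y := m 2 + 2 * m 3 + 4 * m 4)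
    (v := .add (.cell 2) (.add (Expr.cell 3).double (Expr.cell 4).double.double)) rfl
    (by simp only [Expr.eval, Expr.cell, Expr.double]; omega)
  obtain ⟨t₂, m₂, x2, y2, z2, w2⟩ := H₁ n m₁ (by rw [hm₁, Function.update_of_ne (by omega), hm])
  obtain ⟨t₃, m₃, x3, y3, z3, u3, v3⟩ := H₂ b m₂ (by omega) z2 (by
    intro x hx
    rw [w2 x (by omega) (by omega), hm₁, Function.update_of_ne (by omega), h0 x hx])
  set m₄ := Function.update m₃ (b + 4) b with hm₄
  have x4 := exec_assign (a := cellAddr (num len) (.const 0)) (v := .cell 3) (m := m₃)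
    (x := b + 4) (y := b) (by rw [eval_cellAddr z3]; rfl) z3
  have h4 : ∀ x, x ≠ b + 4 → m₄ x = m₃ x := fun x hx => by rw [hm₄, Function.update_of_ne hx]
  refine ⟨_, m₄, fun a k => m₄ (b + (num a + 64 * k)), .seq x1 (.seq x2 (.seq x3 x4)), ?_,
    ⟨by omega, by rw [h4 _ (by omega), z3], fun _ _ => rfl⟩, ?_, fun k k2 k3 k4 => ?_, ?_,
    fun k => ?_⟩
  · have e1 : C₁ * (n + 1) ≤ C₁ * (b + 1) := Nat.mul_le_mul_left _ (by omega)
    rw [Nat.add_mul, Nat.add_mul]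
    simp only [Expr.cost, Expr.cell, Expr.double, cellAddr, mulStride, Function.iterate_succ,
      Function.iterate_zero, Function.comp_apply, id_eq]
    omega
  · simp only [Arr.num]
    rw [h4 _ (by omega), Nat.zero_add, u3 2 (by omega), w2 2 (by omega) (by omega), hm₁,
      Function.update_self]
  · simp only [Arr.num]
    rw [h4 _ (by omega), Nat.zero_add, u3 k k4, w2 k k3 k4, hm₁, Function.update_of_ne k2]
  · simp only [Arr.num]
    rw [hm₄, Nat.mul_zero, Nat.add_zero, Function.update_self]
  · exact (h4 _ (by simp only [Arr.num]; omega)).trans (v3 k)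

/-! ### The bound on the running time -/

variable {S : Type} [Fintype S] [DecidableEq S] {G : Arena S} {n : ℕ} {e : S ≃ Fin n}

omit [Fintype S] in
theorem length_encode_le : (G.encode e).length ≤ 8 * n * n := by
  have hn : 0 < n := (e G.init).pos
  rw [length_encode]
  nlinarith

omit [Fintype S] in
theorem size_le : size G e ≤ 8 * n * n * (n + G.maxWeight + 1) := by
  refine (List.sum_le_card_nsmul _ _ fun x hx => G.le_of_mem_encode e hx).trans ?_
  rw [smul_eq_mul]
  exact Nat.mul_le_mul_right _ length_encode_le

omit [Fintype S] in
theorem le_size : n ≤ size G e :=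
  List.le_sum_of_mem (by simp [encode])

omit [Fintype S] in
theorem maxWeight_le_size : G.maxWeight ≤ size G e :=
  G.maxWeight_le e fun _ hx => List.le_sum_of_mem hx

/-- The depth of the tree suffices for its values to be the regrets. -/
theorem depth_ge (hn : n = Fintype.card S) :
    2 * ((2 * ((0 + Fintype.card S) * G.maxWeight) + Fintype.card S) * G.maxWeight) ≤
      6 * size G e ^ 3 := by
  subst hn
  have h1 := le_size (G := G) (e := e)
  have h2 := maxWeight_le_size (G := G) (e := e)
  have h3 : 1 ≤ size G e := (e G.init).pos.trans_le h1
  set x := size G e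
  calc 2 * ((2 * ((0 + Fintype.card S) * G.maxWeight) + Fintype.card S) * G.maxWeight)
      ≤ 2 * ((2 * ((0 + x) * x) + x) * x) := by gcongr
    _ = 4 * x ^ 3 + 2 * x ^ 2 * 1 := by ring
    _ ≤ 4 * x ^ 3 + 2 * x ^ 2 * x := by gcongr
    _ = 6 * x ^ 3 := by ring

/-- A polynomial bound on the binary logarithms of all loop lengths. -/
noncomputable def logBound : Polynomial ℕ :=
  8 * .X ^ 2 + 24 * .X ^ 3 + 6 * (24 * .X ^ 3) ^ 3 + .X * (6 * (24 * .X ^ 3) ^ 3 + 1)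

omit [Fintype S] in
theorem le_two_pow_logBound {Y : ℕ} (hY : n + G.maxWeight ≤ Y) :
    8 * n * n ≤ 2 ^ logBound.eval Y ∧ n ≤ 2 ^ logBound.eval Y ∧ size G e ≤ 2 ^ logBound.eval Y ∧
      6 * size G e ^ 3 ≤ 2 ^ logBound.eval Y ∧
      levels n (6 * size G e ^ 3 + 1) ≤ 2 ^ logBound.eval Y := by
  have hn : 0 < n := (e G.init).pos
  have hx : size G e ≤ 24 * Y ^ 3 := calc
    size G e ≤ 8 * n * n * (n + G.maxWeight + 1) := size_le
    _ ≤ 8 * Y * Y * (Y + Y + Y) := by gcongr <;> omega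
    _ = 24 * Y ^ 3 := by ring
  have hD : 6 * size G e ^ 3 ≤ 6 * (24 * Y ^ 3) ^ 3 := by gcongr
  have hb : 8 * n * n ≤ 8 * Y ^ 2 := by rw [pow_two, ← mul_assoc]; gcongr <;> omega
  have hR : logBound.eval Y = 8 * Y ^ 2 + 24 * Y ^ 3 + 6 * (24 * Y ^ 3) ^ 3 +
      Y * (6 * (24 * Y ^ 3) ^ 3 + 1) := by simp [logBound]
  have hle : ∀ {x}, x ≤ logBound.eval Y → x ≤ 2 ^ logBound.eval Y :=
    fun h => h.trans Nat.lt_two_pow_self.le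
  have hn' : n ≤ 8 * n * n := by nlinarith
  refine ⟨hle ?_, hle ?_, hle ?_, hle ?_, ?_⟩
  · rw [hR]; omega
  · rw [hR]; omega
  · rw [hR]; omega
  · rw [hR]; omega
  · have h1 : n * (6 * size G e ^ 3 + 1) ≤ Y * (6 * (24 * Y ^ 3) ^ 3 + 1) := by
      gcongr; omega
    calc levels n (6 * size G e ^ 3 + 1) ≤ (n + 1) ^ (6 * size G e ^ 3 + 1) := levels_le _ _
      _ ≤ (2 ^ n) ^ (6 * size G e ^ 3 + 1) := Nat.pow_le_pow_left Nat.lt_two_pow_self _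
      _ = 2 ^ (n * (6 * size G e ^ 3 + 1)) := (pow_mul _ _ _).symm
      _ ≤ 2 ^ logBound.eval Y := Nat.pow_le_pow_right (by omega) (by rw [hR]; omega)

/-- Reading the result for Player `i`. -/
def output (i : Player) : Program :=
  .assign (.const i.code) (.read (cellAddr (num (out i)) (.const 0)))

/-- The whole program. -/
def solver : Program := .seq relocate (.seq core (.seq (output .one) (output .two)))

theorem exec_output {b : ℕ} {m : Memory} (hm : m 3 = b) (i : Player) :
    ∃ t, t ≤ 1000 ∧ Exec (output i) m t (Function.update m i.code (m (b + num (out i)))) := by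
  refine ⟨_, ?_, exec_assign rfl (by rw [Expr.eval, eval_cellAddr hm]; rfl)⟩
  simp only [Expr.cost, cellAddr, mulStride, Function.iterate_succ, Function.iterate_zero,
    Function.comp_apply, id_eq]
  omega

theorem exec_solver : ∃ q : ℕ, ∀ (S : Type) [Fintype S] [DecidableEq S] (G : Arena S) (n : ℕ)
    (e : S ≃ Fin n) (X : ℕ), 8 * n * n ≤ X → n ≤ X → size G e ≤ X → 6 * size G e ^ 3 ≤ X →
    levels n (6 * size G e ^ 3 + 1) ≤ X →
    ∃ t m, Exec solver (memoryOfList (G.encode e)) t m ∧ t ≤ (X + 2) ^ q ∧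
      ∀ i, m i.code = regretCode (uncap (6 * size G e ^ 3)
        (G.val (G.tree (6 * size G e ^ 3) (levels n (6 * size G e ^ 3 + 1))) (6 * size G e ^ 3) i
          [G.init])) := by
  obtain ⟨C, H₁⟩ := exec_relocate
  obtain ⟨p, H₂⟩ := exec_core
  refine ⟨(C + 2000) + 1 + (p + 3) + 1, ?_⟩
  intro S _ _ G n e X h1 h2 h3 h4 h5
  have hn : 0 < n := (e G.init).pos
  have hlen := length_encode_le (G := G) (e := e)
  obtain ⟨t₁, m₁, σ, x1, y1, z1, a1, a2, a3, a4⟩ := H₁ n (memoryOfList (G.encode e))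
    (G.encode_zero e) hn (fun x hx => by
      rw [memoryOfList, List.getD_eq_default _ _ (hlen.trans hx)])
  obtain ⟨t₂, m₂, σ', x2, y2, z2, a5⟩ := H₂ S G n e X _ _ m₁ σ z1 a1 a2 a3 hlen a4 h1 h2 h3 h4 h5
  obtain ⟨t₃, y3, x3⟩ := exec_output z2.base_eq .one
  obtain ⟨t₄, y4, x4⟩ := exec_output (b := 8 * n * n)
    (m := Function.update m₂ Player.one.code (m₂ (8 * n * n + num (out .one))))
    (by rw [Function.update_of_ne (by simp [Player.code]), z2.base_eq]) .two
  refine ⟨_, _, .seq x1 (.seq x2 (.seq x3 x4)), ?_, fun i => ?_⟩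
  · have g0 : ∀ a, a ≤ (X + 2) ^ a := fun a => (Nat.lt_pow_self (by omega)).le
    have g1 : t₁ + 2000 ≤ (X + 2) ^ (C + 2000 + 1) := calc
      t₁ + 2000 ≤ C * (8 * n * n + 1) + 2000 * 1 := by omega
      _ ≤ C * (X + 2) + 2000 * (X + 2) := by gcongr <;> omega
      _ = (C + 2000) * (X + 2) := by ring
      _ ≤ (X + 2) ^ (C + 2000) * (X + 2) := Nat.mul_le_mul_right _ (g0 _)
      _ = (X + 2) ^ (C + 2000 + 1) := (pow_succ _ _).symm
    have g2 : t₂ ≤ (X + 2) ^ (p + 3) := calc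
      t₂ ≤ 6 * (X + 2) ^ p := y2
      _ ≤ (X + 2) ^ 3 * (X + 2) ^ p := by
        gcongr
        calc 6 ≤ 2 ^ 3 := by norm_num
          _ ≤ (X + 2) ^ 3 := Nat.pow_le_pow_left (by omega) 3
      _ = (X + 2) ^ (p + 3) := by ring
    have g3 : (X + 2) ^ (C + 2000 + 1) ≤ (X + 2) ^ (C + 2000 + 1 + (p + 3)) :=
      Nat.pow_le_pow_right (by omega) (by omega)
    have g4 : (X + 2) ^ (p + 3) ≤ (X + 2) ^ (C + 2000 + 1 + (p + 3)) :=
      Nat.pow_le_pow_right (by omega) (by omega)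
    have g5 : (X + 2) ^ (C + 2000 + 1 + (p + 3)) * 2 ≤ (X + 2) ^ (C + 2000 + 1 + (p + 3) + 1) := by
      rw [pow_succ]; gcongr; omega
    omega
  · have hb : 8 * n ≤ 8 * n * n := Nat.le_mul_of_pos_right _ hn
    have h6 : ∀ i, m₂ (8 * n * n + num (out i)) = σ' (out i) 0 := fun i => z2.cell (out i) 0
    rw [← a5 i, ← h6]
    cases i
    · rw [Function.update_of_ne (by simp [Player.code]), Function.update_self]
    · rw [Function.update_self, Function.update_of_ne (by simp [Player.code]; omega)]

end RegretGame

theorem mainTheorem4 :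
    ∃ (prog : RegretGame.Program) (p : Polynomial ℕ),
      ∀ (S : Type) [Fintype S] [DecidableEq S] (G : RegretGame.Arena S), G.Positive →
        ∀ e : S ≃ Fin (Fintype.card S),
          ∃ r : RegretGame.Player → ℕ∞,
            (∀ i, G.IsIteratedRegret i (r i)) ∧
            ∃ (t : ℕ) (m : RegretGame.Memory),
              RegretGame.Exec prog (RegretGame.memoryOfList (G.encode e)) t m ∧
              t ≤ 2 ^ p.eval (Fintype.card S + G.edges.card + G.maxWeight) ∧
              m 0 = RegretGame.regretCode (r .one) ∧
              m 1 = RegretGame.regretCode (r .two) := by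
  obtain ⟨q, H⟩ := RegretGame.exec_solver
  refine ⟨RegretGame.solver, (RegretGame.logBound + 2) * Polynomial.C q, ?_⟩
  intro S _ _ G hpos e
  set Y := Fintype.card S + G.edges.card + G.maxWeight with hY
  obtain ⟨h1, h2, h3, h4, h5⟩ := RegretGame.le_two_pow_logBound (G := G) (e := e) (Y := Y) (by omega)
  obtain ⟨t, m, hx, ht, hm⟩ := H S G _ e _ h1 h2 h3 h4 h5
  refine ⟨_, fun i => RegretGame.isIteratedRegret e hpos (RegretGame.depth_ge rfl) i, t, m, hx,
    ht.trans ?_, hm .one, hm .two⟩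
  have h6 : (RegretGame.logBound + 2 : Polynomial ℕ).eval Y = RegretGame.logBound.eval Y + 2 := by
    simp
  rw [Polynomial.eval_mul, Polynomial.eval_C, h6, pow_mul]
  refine Nat.pow_le_pow_left ?_ q
  have h7 : 0 < 2 ^ RegretGame.logBound.eval Y := by positivity
  rw [pow_add]
  omega
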